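/- Let $\mathbb K$ be a field of characteristic $0$ (for example $\mathbb C$, or $\mathbb C(q)$ with $q$ an indeterminate), let $q\in\mathbb K^\times$ be not a root of unity, and let $m,n\ge 2$, $d\ge 1$, $N=m+n$. **Roots.** Put $\bar d_k=1$, $p(k)=0$ for $1\le k\le m$ and $\bar d_k=-1$, $p(k)=1$ for $m<k\le N$. On $\bigoplus_{k=1}^{N}\mathbb Z\bar\varepsilon_k\oplus\mathbb Z\delta$ let $(\bar\varepsilon_k,\bar\varepsilon_l)=\delta_{kl}\bar d_k$, with $\delta$ orthogonal to everything. Put $\alpha_i=\bar\varepsilon_i-\bar\varepsilon_{i+1}$ $(1\le i<N)$ and $\alpha_0=\delta+\bar\varepsilon_N-\bar\varepsilon_1$; $p(\alpha_0)=p(\alpha_m)=1$ and $p(\alpha_i)=0$ otherwise; indices of the $\alpha_i$ are taken modulo $N$. Let $\Gamma$ be $\sum_i\mathbb Z\alpha_i$ if $m\ne n$, and the whole lattice $\bigoplus_k\mathbb Z\bar\varepsilon_k\oplus\mathbb Z\delta$ if $m=n$. Put $q_i=q^{\bar d_i}$ $(1\le i\le N)$ and $q_0=q^{-1}$. **The quantum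 superalgebra.** $\widetilde U=\widetilde U_q^\sigma$ is the $\mathbb K$-algebra with generators $\sigma$, $K_\gamma$ $(\gamma\in\Gamma)$, $E_i,F_i$ $(0\le i<N)$ and relations: $\sigma^2=1$, $\sigma K_\gamma=K_\gamma\sigma$, $\sigma X_i=(-1)^{p(\alpha_i)}X_i\sigma$ for $X=E,F$; $K_0=1$ (for $0\in\Gamma$), $K_\gamma K_{\gamma'}=K_{\gamma+\gamma'}$; $K_\gamma E_i=q^{(\gamma,\alpha_i)}E_iK_\gamma$, $K_\gamma F_i=q^{-(\gamma,\alpha_i)}F_iK_\gamma$; and $E_iF_j-(-1)^{p(\alpha_i)p(\alpha_j)}F_jE_i=\delta_{ij}\dfrac{K_{\alpha_i}-K_{\alpha_i}^{-1}}{q_i-q_i^{-1}}$. Its comultiplication is $\Delta\sigma=\sigma\otimes\sigma$, $\Delta K_\gamma=K_\gamma\otimes K_\gamma$, $\Delta E_i=E_i\otimes1+K_{\alpha_i}\sigma^{p(\alpha_i)}\otimes E_i$, $\Delta F_i=F_i\otimes K_{\alpha_i}^{-1}+\sigma^{p(\alpha_i)}\otimes F_i$. For elements of parities $a,b$ and weights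 $\alpha,\beta$ put $[x,y]=xy-(-1)^{ab}yx$ and $\llbracket x,y\rrbracket=xy-(-1)^{ab}q^{-(\alpha,\beta)}yx$. The algebra $U=U_{q,a}^\sigma(\mathrm{sl}(m,n))$ is the quotient of $\widetilde U$ by the quantum Serre relations, for $X=E$ and for $X=F$: $[X_i,X_j]=0$ if $i\ne j$ and $(\alpha_i,\alpha_j)=0$; $X_0^2=X_m^2=0$; $\llbracket X_i,\llbracket X_i,X_{i\pm1}\rrbracket\rrbracket=0$ for $i\ne0,m$; $[\llbracket\llbracket X_{i-1},X_i\rrbracket,X_{i+1}\rrbracket,X_i]=0$ for $i=0,m$. **Evaluation modules.** Let $V=\mathbb K^N$ with basis $\bar\varepsilon_1,\dots,\bar\varepsilon_N$ and matrix units $E_{k,l}$. For $a\in\mathbb K^\times$ let $V(a)$ be the $\widetilde U$-module $V$ in which $\sigma\bar\varepsilon_k=(-1)^{p(k)}\bar\varepsilon_k$, $K_\gamma\bar\varepsilon_k=q^{(\gamma,\bar\varepsilon_k)}\bar\varepsilon_k$, $E_i=q_{i+1}^{-1}E_{i,i+1}$ and $F_i=q_{i+1}E_{i+1,i}$ for $1\le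 i<N$, and $E_0=aF_\Pi$, $F_0=a^{-1}E_\Pi$, where $E_\Pi=E_1E_2\cdots E_{N-1}$ and $F_\Pi=F_{N-1}\cdots F_2F_1$. Tensor products of $\widetilde U$-modules are formed through $\Delta$. Put $K_\Pi=K_{\alpha_1}\cdots K_{\alpha_{N-1}}$. **Hecke algebras.** $H^a_d(q^2)$ is the $\mathbb K$-algebra with generators $\widehat T_i$ $(1\le i<d)$, $y_j^{\pm1}$ $(1\le j\le d)$ and relations $\widehat T_i\widehat T_{i+1}\widehat T_i=\widehat T_{i+1}\widehat T_i\widehat T_{i+1}$, $\widehat T_i\widehat T_j=\widehat T_j\widehat T_i$ $(|i-j|>1)$, $\widehat T_i^2=(q-q^{-1})\widehat T_i+1$, $y_jy_j^{-1}=1=y_j^{-1}y_j$, $y_jy_k=y_ky_j$, $y_j\widehat T_i=\widehat T_iy_j$ $(j\ne i,i+1)$, $\widehat T_iy_i\widehat T_i=y_{i+1}$; $H_d(q^2)$ is the algebra with generators $\widehat T_i$ and those of the relations that involve only them. $H_d(q^2)$ acts on $V^{\otimes d}$ from the left: $\widehat T_i$ acts as $\check R$ on the factors $i,i+1$, where $\check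 R(\bar\varepsilon_k\otimes\bar\varepsilon_k)=(-1)^{p(k)}q^{\bar d_k}\bar\varepsilon_k\otimes\bar\varepsilon_k$ and, for $k\neq l$, $\check R(\bar\varepsilon_k\otimes\bar\varepsilon_l)=(-1)^{p(k)p(l)}\bar\varepsilon_l\otimes\bar\varepsilon_k$, plus $(q-q^{-1})\bar\varepsilon_k\otimes\bar\varepsilon_l$ if $k<l$. **The functor.** For a right $H^a_d(q^2)$-module $M$, $\mathcal F(M)$ is the space $M\otimes_{H_d(q^2)}V^{\otimes d}$ with the action of $U$ in which $\sigma$, $K_\gamma$ $(\gamma\in\Gamma)$ and $E_i,F_i$ $(i\ne0)$ act through their natural action on $V^{\otimes d}$, and $$E_0(x\otimes v)=\sum_{j=1}^d xy_j^{-1}\otimes\big((\sigma K_\Pi^{-1})^{\otimes(j-1)}\otimes F_\Pi\otimes1^{\otimes(d-j)}\big)v,\qquad F_0(x\otimes v)=\sum_{j=1}^d xy_j\otimes\big(\sigma^{\otimes(j-1)}\otimes E_\Pi\otimes K_\Pi^{\otimes(d-j)}\big)v.$$ **Proposition 17.2.** Let $c=(c_1,\dots,c_d)\in(\mathbb K^\times)^d$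 and let $M_c=H^a_d(q^2)/H_c$, where $H_c$ is the right ideal generated by the elements $y_j-c_j$ $(1\le j\le d)$. Then the $U$-module $\mathcal F(M_c)$ is well defined (there is exactly one action of $U$ as above), the $\widetilde U$-module $V(c_1^{-1})\otimes\cdots\otimes V(c_d^{-1})$ is a $U$-module, and the canonical map $v\mapsto1\otimes v$ is an isomorphism of $U$-modules $$V(c_1^{-1})\otimes\cdots\otimes V(c_d^{-1})\;\xrightarrow{\ \sim\ }\;\mathcal F(M_c).$$ -/

import Mathlib

open scoped TensorProduct

noncomputable section

namespace QSuper

/-! ### Combinatorial data of type `(AA)`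

Basis vectors of the superspace `V` of dimension `(m, n)` and nodes of the affine Dynkin diagram are
both indexed by `Fin (m + n)`.  The basis vector with (zero-based) index `k` is the usual `ε̄_{k+1}`;
the node `i` carries the simple root `α_i`, where node `0` is the affine one. -/

/-- The cyclic predecessor. -/
def pre {N : ℕ} (i : Fin N) : Fin N :=
  ⟨if i.val = 0 then N - 1 else i.val - 1, by have := i.isLt; split_ifs <;> omega⟩

/-- The cyclic successor. -/
def nxt {N : ℕ} (i : Fin N) : Fin N :=
  ⟨if i.val + 1 = N then 0 else i.val + 1, by have := i.isLt; split_ifs <;> omega⟩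

/-- The parity of a basis vector: the first `m` are even, the others are odd. -/
def vpar (m : ℕ) {N : ℕ} (k : Fin N) : ℕ := if k.val < m then 0 else 1

/-- The sign `d̄ = (-1) ^ parity` of a basis vector; this is also the self-pairing of `ε̄`. -/
def dbar (m : ℕ) {N : ℕ} (k : Fin N) : ℤ := if k.val < m then 1 else -1

/-- The parity of the simple root `α_i`, i.e. the sum of the parities of the two basis vectors
which it involves. -/
def npar (m : ℕ) {N : ℕ} (i : Fin N) : ℕ := (vpar m (pre i) + vpar m i) % 2

/-- The odd simple roots are exactly `α_0` and `α_m`. -/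
theorem npar_eq {m n : ℕ} (hm : 1 ≤ m) (hn : 1 ≤ n) (i : Fin (m + n)) :
    npar m i = if i.val = 0 ∨ i.val = m then 1 else 0 := by
  have := i.isLt
  unfold npar vpar pre
  dsimp only
  split_ifs <;> omega

/-- Integral weights `∑ a_k ε̄_k + r δ`, written as `(a, r)`. -/
abbrev Wt (N : ℕ) : Type := (Fin N → ℤ) × ℤ

/-- The bilinear form: `(ε̄_k, ε̄_l) = δ_{kl} d̄_k`, and `δ` is orthogonal to everything. -/
def form (m : ℕ) {N : ℕ} (x y : Wt N) : ℤ := ∑ k, dbar m k * x.1 k * y.1 k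

/-- The simple roots: `α_i = ε̄_i - ε̄_{i+1}` for `i ≠ 0` (one-based indices of `ε̄`) and
`α_0 = δ + ε̄_{m+n} - ε̄_1`. -/
def root {N : ℕ} (i : Fin N) : Wt N :=
  (Pi.single (pre i) 1 - Pi.single i 1, if i.val = 0 then 1 else 0)

/-- The lattice `Γ`: the root lattice if `m ≠ n`, and all integral weights if `m = n` (without the
degree direction `Λ_0`, which does not act on finite dimensional modules). -/
def lattice (m n : ℕ) : AddSubgroup (Wt (m + n)) :=
  if m = n then ⊤ else AddSubgroup.closure (Set.range root)

theorem root_mem {m n : ℕ} (i : Fin (m + n)) : root i ∈ lattice m n := by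
  unfold lattice
  split_ifs
  · trivial
  · exact AddSubgroup.subset_closure ⟨i, rfl⟩

/-- The simple root as an element of `Γ`. -/
def rootL {m n : ℕ} (i : Fin (m + n)) : lattice m n := ⟨root i, root_mem i⟩

/-- `x_1 x_2 ⋯ x_{N-1}` (the entry at the affine node `0` is left out). -/
def upProd {A : Type*} [Monoid A] {N : ℕ} (x : Fin N → A) : A :=
  (List.ofFn fun k : Fin (N - 1) => x ⟨k.val + 1, by omega⟩).prod

/-- `x_{N-1} ⋯ x_2 x_1` (the entry at the affine node `0` is left out). -/
def downProd {A : Type*} [Monoid A] {N : ℕ} (x : Fin N → A) : A :=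
  (List.ofFn fun k : Fin (N - 1) => x ⟨k.val + 1, by omega⟩).reverse.prod

/-! ### The affine quantum superalgebra -/

/-- Generators of the affine quantum superalgebra. -/
inductive Gen (m n : ℕ) : Type
  | sig : Gen m n
  | K : lattice m n → Gen m n
  | E : Fin (m + n) → Gen m n
  | F : Fin (m + n) → Gen m n

section
variable {𝕜 : Type*} [Field 𝕜]

/-- The scalar `q ^ z`. -/
def qz (q : 𝕜ˣ) (z : ℤ) : 𝕜 := ((q ^ z : 𝕜ˣ) : 𝕜)

/-- The sign `(-1) ^ k` as a scalar. -/
def sgn (𝕜 : Type*) [Field 𝕜] (k : ℕ) : 𝕜 := (-1) ^ k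

/-- Elements `σ, K_γ, E_i, F_i` of an algebra satisfy the relations of `Ũ_q^σ` (all relations
except the quantum Serre relations), where `σ` is an involution which acts by the parity.  Here `q_i = q ^ d_i` with
`d_i = d̄` of the basis vector with one-based index `i` (and `d_0 = d_{m+n}`); in the last relation
the denominator `q_i - q_i⁻¹` has been cleared. -/
structure TildeRelations (m n : ℕ) (q : 𝕜ˣ) {A : Type*} [Ring A] [Algebra 𝕜 A]
    (s : A) (K : lattice m n → A) (E F : Fin (m + n) → A) : Prop where
  sig_sig : s * s = 1
  sig_K : ∀ γ, s * K γ = K γ * s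
  sig_E : ∀ i, s * E i = sgn 𝕜 (npar m i) • (E i * s)
  sig_F : ∀ i, s * F i = sgn 𝕜 (npar m i) • (F i * s)
  K_zero : K 0 = 1
  K_mul : ∀ γ γ', K γ * K γ' = K (γ + γ')
  K_E : ∀ γ i, K γ * E i = qz q (form m γ.1 (root i)) • (E i * K γ)
  K_F : ∀ γ i, K γ * F i = qz q (-form m γ.1 (root i)) • (F i * K γ)
  E_F : ∀ i j, (qz q (dbar m (pre i)) - qz q (-dbar m (pre i))) •
      (E i * F j - sgn 𝕜 (npar m i * npar m j) • (F j * E i)) =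
        if i = j then K (rootL i) - K (-rootL i) else 0

/-- The relation on the free algebra which defines `Ũ_q^σ`. -/
inductive TildeRel (m n : ℕ) (q : 𝕜ˣ) :
    FreeAlgebra 𝕜 (Gen m n) → FreeAlgebra 𝕜 (Gen m n) → Prop
  | sig_sig : TildeRel m n q (.ι 𝕜 .sig * .ι 𝕜 .sig) 1
  | sig_K (γ) : TildeRel m n q (.ι 𝕜 .sig * .ι 𝕜 (.K γ)) (.ι 𝕜 (.K γ) * .ι 𝕜 .sig)
  | sig_E (i) : TildeRel m n q (.ι 𝕜 .sig * .ι 𝕜 (.E i))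
      (sgn 𝕜 (npar m i) • (.ι 𝕜 (.E i) * .ι 𝕜 .sig))
  | sig_F (i) : TildeRel m n q (.ι 𝕜 .sig * .ι 𝕜 (.F i))
      (sgn 𝕜 (npar m i) • (.ι 𝕜 (.F i) * .ι 𝕜 .sig))
  | K_zero : TildeRel m n q (.ι 𝕜 (.K 0)) 1
  | K_mul (γ γ') : TildeRel m n q (.ι 𝕜 (.K γ) * .ι 𝕜 (.K γ')) (.ι 𝕜 (.K (γ + γ')))
  | K_E (γ i) : TildeRel m n q (.ι 𝕜 (.K γ) * .ι 𝕜 (.E i))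
      (qz q (form m γ.1 (root i)) • (.ι 𝕜 (.E i) * .ι 𝕜 (.K γ)))
  | K_F (γ i) : TildeRel m n q (.ι 𝕜 (.K γ) * .ι 𝕜 (.F i))
      (qz q (-form m γ.1 (root i)) • (.ι 𝕜 (.F i) * .ι 𝕜 (.K γ)))
  | E_F (i j) : TildeRel m n q
      ((qz q (dbar m (pre i)) - qz q (-dbar m (pre i))) •
        (.ι 𝕜 (.E i) * .ι 𝕜 (.F j) -
          sgn 𝕜 (npar m i * npar m j) • (.ι 𝕜 (.F j) * .ι 𝕜 (.E i))))
      (if i = j then .ι 𝕜 (.K (rootL i)) - .ι 𝕜 (.K (-rootL i)) else 0)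

/-- The algebra `Ũ_q^σ`. -/
abbrev Tilde (m n : ℕ) (q : 𝕜ˣ) : Type _ := RingQuot (TildeRel m n q)

namespace Tilde
variable {m n : ℕ} {q : 𝕜ˣ}

/-- The image of a generator in `Ũ_q^σ`. -/
def of (m n : ℕ) (q : 𝕜ˣ) (g : Gen m n) : Tilde m n q :=
  RingQuot.mkAlgHom 𝕜 (TildeRel m n q) (FreeAlgebra.ι 𝕜 g)

def sig (m n : ℕ) (q : 𝕜ˣ) : Tilde m n q := of m n q .sig
def K (q : 𝕜ˣ) (γ : lattice m n) : Tilde m n q := of m n q (.K γ)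
def E (q : 𝕜ˣ) (i : Fin (m + n)) : Tilde m n q := of m n q (.E i)
def F (q : 𝕜ˣ) (i : Fin (m + n)) : Tilde m n q := of m n q (.F i)

theorem relations (m n : ℕ) (q : 𝕜ˣ) :
    TildeRelations m n q (sig m n q) (K q) (E q) (F q) where
  sig_sig := by
    simpa [sig, of] using RingQuot.mkAlgHom_rel 𝕜 (TildeRel.sig_sig (m := m) (n := n) (q := q))
  sig_K γ := by
    simpa [sig, K, of] using RingQuot.mkAlgHom_rel 𝕜 (TildeRel.sig_K (q := q) γ)
  sig_E i := by
    simpa [sig, E, of] using RingQuot.mkAlgHom_rel 𝕜 (TildeRel.sig_E (q := q) i)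
  sig_F i := by
    simpa [sig, F, of] using RingQuot.mkAlgHom_rel 𝕜 (TildeRel.sig_F (q := q) i)
  K_zero := by
    simpa [K, of] using RingQuot.mkAlgHom_rel 𝕜 (TildeRel.K_zero (m := m) (n := n) (q := q))
  K_mul γ γ' := by
    simpa [K, of] using RingQuot.mkAlgHom_rel 𝕜 (TildeRel.K_mul (q := q) γ γ')
  K_E γ i := by
    simpa [K, E, of] using RingQuot.mkAlgHom_rel 𝕜 (TildeRel.K_E (q := q) γ i)
  K_F γ i := by
    simpa [K, F, of] using RingQuot.mkAlgHom_rel 𝕜 (TildeRel.K_F (q := q) γ i)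
  E_F i j := by
    have h := RingQuot.mkAlgHom_rel 𝕜 (TildeRel.E_F (q := q) i j)
    simp only [map_smul, map_sub, map_mul, apply_ite (RingQuot.mkAlgHom 𝕜 (TildeRel m n q)),
      map_zero] at h
    exact h

/-- The images of the generators under a homomorphism. -/
def genMap {A : Type*} (s : A) (K : lattice m n → A) (E F : Fin (m + n) → A) : Gen m n → A
  | .sig => s
  | .K γ => K γ
  | .E i => E i
  | .F i => F i

/-- The homomorphism out of `Ũ_q^σ` given by elements which satisfy its defining relations. -/
def lift {A : Type*} [Ring A] [Algebra 𝕜 A]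
    {s : A} {K : lattice m n → A} {E F : Fin (m + n) → A} (h : TildeRelations m n q s K E F) :
    Tilde m n q →ₐ[𝕜] A :=
  RingQuot.liftAlgHom 𝕜 ⟨FreeAlgebra.lift 𝕜 (genMap s K E F), by
    rintro _ _ (_ | _ | _ | _ | _ | _ | _ | _ | ⟨i, j⟩)
    · simpa [genMap] using h.sig_sig
    · simpa [genMap] using h.sig_K _
    · simpa [genMap] using h.sig_E _
    · simpa [genMap] using h.sig_F _
    · simpa [genMap] using h.K_zero
    · simpa [genMap] using h.K_mul _ _
    · simpa [genMap] using h.K_E _ _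
    · simpa [genMap] using h.K_F _ _
    · simp only [map_smul, map_sub, map_mul,
        apply_ite (FreeAlgebra.lift 𝕜 (genMap s K E F)), map_zero, FreeAlgebra.lift_ι_apply]
      exact h.E_F i j⟩

/-- `σ ^ p(α_i)`. -/
def sigPow (q : 𝕜ˣ) (i : Fin (m + n)) : Tilde m n q := sig m n q ^ npar m i

theorem K_neg_mul (γ : lattice m n) : K q (-γ) * K q γ = 1 := by
  rw [(relations m n q).K_mul, neg_add_cancel, (relations m n q).K_zero]

theorem qz_add (z w : ℤ) : qz q (z + w) = qz q z * qz q w := by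
  simp [qz, zpow_add]

theorem K_comm (γ γ' : lattice m n) : K q γ * K q γ' = K q γ' * K q γ := by
  rw [(relations m n q).K_mul, (relations m n q).K_mul, add_comm]

theorem sigPow_K (i) (γ : lattice m n) : sigPow q i * K q γ = K q γ * sigPow q i := by
  have h : Commute (sig m n q) (K q γ) := (relations m n q).sig_K γ
  exact h.pow_left _

theorem npar_lt (m : ℕ) {N : ℕ} (i : Fin N) : npar m i = 0 ∨ npar m i = 1 := by
  unfold npar; omega

theorem sigPow_E (i j : Fin (m + n)) :
    sigPow q i * E q j = sgn 𝕜 (npar m i * npar m j) • (E q j * sigPow q i) := by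
  rcases npar_lt m i with h | h
  · simp [sigPow, h, sgn]
  · simp [sigPow, h, (relations m n q).sig_E]

theorem sigPow_F (i j : Fin (m + n)) :
    sigPow q i * F q j = sgn 𝕜 (npar m i * npar m j) • (F q j * sigPow q i) := by
  rcases npar_lt m i with h | h
  · simp [sigPow, h, sgn]
  · simp [sigPow, h, (relations m n q).sig_F]

theorem sig_sigPow (i : Fin (m + n)) : sig m n q * sigPow q i = sigPow q i * sig m n q :=
  ((Commute.refl (sig m n q)).pow_right _)

theorem sigPow_sigPow (i j : Fin (m + n)) :
    sigPow q i * sigPow q j = sigPow q j * sigPow q i :=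
  ((Commute.refl (sig m n q)).pow_pow _ _)

theorem sigPow_mul_self (i : Fin (m + n)) : sigPow q i * sigPow q i = 1 := by
  rcases npar_lt m i with h | h
  · simp [sigPow, h]
  · simp [sigPow, h, (relations m n q).sig_sig]

theorem form_comm (x y : Wt (m + n)) : form m x y = form m y x := by
  unfold form
  exact Finset.sum_congr rfl fun k _ => by ring

theorem form_neg (x y : Wt (m + n)) : form m (-x) y = -form m x y := by
  unfold form
  rw [← Finset.sum_neg_distrib]
  exact Finset.sum_congr rfl fun k _ => by simp

/-- The elements which define the comultiplication satisfy the relations. -/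
theorem comul_relations (m n : ℕ) (q : 𝕜ˣ) :
    TildeRelations m n q (A := Tilde m n q ⊗[𝕜] Tilde m n q)
      (sig m n q ⊗ₜ sig m n q)
      (fun γ => K q γ ⊗ₜ K q γ)
      (fun i => E q i ⊗ₜ 1 + (K q (rootL i) * sigPow q i) ⊗ₜ E q i)
      (fun i => F q i ⊗ₜ K q (-rootL i) + sigPow q i ⊗ₜ F q i) where
  sig_sig := by
    simp [(relations m n q).sig_sig, Algebra.TensorProduct.one_def]
  sig_K γ := by simp [(relations m n q).sig_K]
  sig_E i := by
    simp only [mul_add, add_mul, Algebra.TensorProduct.tmul_mul_tmul, smul_add, mul_one, one_mul,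
      (relations m n q).sig_E]
    rw [← mul_assoc, (relations m n q).sig_K, mul_assoc, sig_sigPow, mul_assoc]
    simp only [TensorProduct.tmul_smul, TensorProduct.smul_tmul']
  sig_F i := by
    simp only [mul_add, add_mul, Algebra.TensorProduct.tmul_mul_tmul, smul_add,
      (relations m n q).sig_F, (relations m n q).sig_K, sig_sigPow,
      TensorProduct.tmul_smul, TensorProduct.smul_tmul']
  K_zero := by simp [(relations m n q).K_zero, Algebra.TensorProduct.one_def]
  K_mul γ γ' := by simp [(relations m n q).K_mul]
  K_E γ i := by
    simp only [mul_add, add_mul, Algebra.TensorProduct.tmul_mul_tmul, smul_add, mul_one, one_mul,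
      (relations m n q).K_E]
    rw [← mul_assoc, K_comm, mul_assoc, ← sigPow_K, mul_assoc]
    simp only [TensorProduct.tmul_smul, TensorProduct.smul_tmul']
  K_F γ i := by
    simp only [mul_add, add_mul, Algebra.TensorProduct.tmul_mul_tmul, smul_add,
      (relations m n q).K_F, ← sigPow_K, K_comm γ (-rootL i),
      TensorProduct.tmul_smul, TensorProduct.smul_tmul']
  E_F i j := by
    have hR := relations m n q
    have e1 : E q i * sigPow q j = sgn 𝕜 (npar m i * npar m j) • (sigPow q j * E q i) := by
      rw [sigPow_E, smul_smul, mul_comm (npar m j), sgn, ← mul_pow]; simp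
    have e2 : K q (rootL i) * sigPow q i * F q j * 1 =
        (qz q (-form m (root i) (root j)) * sgn 𝕜 (npar m i * npar m j)) •
          (F q j * (K q (rootL i) * sigPow q i)) := by
      rw [mul_one, mul_assoc, sigPow_F, mul_smul_comm, ← mul_assoc, hR.K_F, smul_mul_assoc,
        smul_smul, mul_assoc, mul_comm (sgn 𝕜 _)]
      rfl
    have e3 : K q (-rootL j) * E q i =
        qz q (-form m (root i) (root j)) • (E q i * K q (-rootL j)) := by
      rw [hR.K_E]
      have : form m (-rootL j : lattice m n).1 (root i) = -form m (root i) (root j) := by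
        rw [form_comm (root i)]; exact form_neg _ _
      rw [this]
    have key : (E q i ⊗ₜ[𝕜] (1 : Tilde m n q) + (K q (rootL i) * sigPow q i) ⊗ₜ E q i) *
          (F q j ⊗ₜ K q (-rootL j) + sigPow q j ⊗ₜ F q j) -
        sgn 𝕜 (npar m i * npar m j) •
          ((F q j ⊗ₜ K q (-rootL j) + sigPow q j ⊗ₜ F q j) *
            (E q i ⊗ₜ (1 : Tilde m n q) + (K q (rootL i) * sigPow q i) ⊗ₜ E q i)) =
        (E q i * F q j - sgn 𝕜 (npar m i * npar m j) • (F q j * E q i)) ⊗ₜ K q (-rootL j) +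
        (K q (rootL i) * (sigPow q i * sigPow q j)) ⊗ₜ
          (E q i * F q j - sgn 𝕜 (npar m i * npar m j) • (F q j * E q i)) := by
      rw [mul_one] at e2
      have e4 : sigPow q j * (K q (rootL i) * sigPow q i) =
          K q (rootL i) * (sigPow q i * sigPow q j) := by
        rw [← mul_assoc, sigPow_K, mul_assoc, sigPow_sigPow]
      simp only [mul_add, add_mul, Algebra.TensorProduct.tmul_mul_tmul, mul_one, one_mul, e1, e2,
        e3, e4, mul_assoc, TensorProduct.tmul_smul, TensorProduct.smul_tmul',
        TensorProduct.sub_tmul, TensorProduct.tmul_sub, smul_add, smul_smul]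
      rw [mul_comm (sgn 𝕜 _) (qz q _)]
      abel
    rw [key, smul_add, TensorProduct.smul_tmul', ← TensorProduct.tmul_smul, hR.E_F]
    split_ifs with hij
    · subst hij
      rw [sigPow_mul_self, mul_one]
      simp only [TensorProduct.sub_tmul, TensorProduct.tmul_sub]
      abel
    · simp

/-- The comultiplication `Δ` of `Ũ_q^σ`:
`Δ σ = σ ⊗ σ`, `Δ K_γ = K_γ ⊗ K_γ`, `Δ E_i = E_i ⊗ 1 + K_{α_i} σ^{p(α_i)} ⊗ E_i`,
`Δ F_i = F_i ⊗ K_{α_i}⁻¹ + σ^{p(α_i)} ⊗ F_i`. -/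
def comul (m n : ℕ) (q : 𝕜ˣ) : Tilde m n q →ₐ[𝕜] Tilde m n q ⊗[𝕜] Tilde m n q :=
  lift (comul_relations m n q)

/-- The counit: `σ, K_γ ↦ 1` and `E_i, F_i ↦ 0`. -/
def counit (m n : ℕ) (q : 𝕜ˣ) : Tilde m n q →ₐ[𝕜] 𝕜 :=
  lift (s := 1) (K := fun _ => 1) (E := fun _ => 0) (F := fun _ => 0)
    { sig_sig := by simp
      sig_K := by simp
      sig_E := by simp
      sig_F := by simp
      K_zero := rfl
      K_mul := by simp
      K_E := by simp
      K_F := by simp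
      E_F := by simp }

end Tilde

/-! ### Evaluation modules and their tensor products -/

section Eval
variable (m n : ℕ) (q : 𝕜ˣ)

/-- `ε̄_k` as a weight. -/
def eps {N : ℕ} (k : Fin N) : Wt N := (Pi.single k 1, 0)

/-- `σ` acts on `V` by the parity. -/
def sigMat : Matrix (Fin (m + n)) (Fin (m + n)) 𝕜 :=
  Matrix.diagonal fun k => sgn 𝕜 (vpar m k)

/-- `K_γ` acts on `ε̄_k` by `q ^ (γ, ε̄_k)`. -/
def KMat (γ : lattice m n) : Matrix (Fin (m + n)) (Fin (m + n)) 𝕜 :=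
  Matrix.diagonal fun k => qz q (form m γ.1 (eps k))

/-- The action of `E_i` on `V` for `i ≠ 0`; in one-based indices of basis vectors this is
`q_{i+1}⁻¹ E_{i,i+1}`. -/
def EMat (i : Fin (m + n)) : Matrix (Fin (m + n)) (Fin (m + n)) 𝕜 :=
  Matrix.single (pre i) i (qz q (-dbar m i))

/-- The action of `F_i` on `V` for `i ≠ 0`; in one-based indices of basis vectors this is
`q_{i+1} E_{i+1,i}`. -/
def FMat (i : Fin (m + n)) : Matrix (Fin (m + n)) (Fin (m + n)) 𝕜 :=
  Matrix.single i (pre i) (qz q (dbar m i))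

/-- The action of `E_i` on `V(a)`; the affine `E_0` acts as `a F_{m+n-1} ⋯ F_1`. -/
def evalE (a : 𝕜ˣ) (i : Fin (m + n)) : Matrix (Fin (m + n)) (Fin (m + n)) 𝕜 :=
  if i.val = 0 then (a : 𝕜) • downProd (FMat m n q) else EMat m n q i

/-- The action of `F_i` on `V(a)`; the affine `F_0` acts as `a⁻¹ E_1 ⋯ E_{m+n-1}`. -/
def evalF (a : 𝕜ˣ) (i : Fin (m + n)) : Matrix (Fin (m + n)) (Fin (m + n)) 𝕜 :=
  if i.val = 0 then ((a⁻¹ : 𝕜ˣ) : 𝕜) • upProd (EMat m n q) else FMat m n q i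

theorem qz_ne_zero (z : ℤ) : qz q z ≠ 0 := Units.ne_zero _

theorem qz_neg (z : ℤ) : qz q (-z) = (qz q z)⁻¹ := by simp [qz]

theorem prod_aux (k : ℕ) (hk : k + 1 < m + n) : ∃ u : 𝕜, u ≠ 0 ∧
    (List.ofFn fun j : Fin (k + 1) => EMat m n q ⟨j.val + 1, by omega⟩).prod =
      Matrix.single ⟨0, by omega⟩ ⟨k + 1, hk⟩ u ∧
    (List.ofFn fun j : Fin (k + 1) => FMat m n q ⟨j.val + 1, by omega⟩).reverse.prod =
      Matrix.single ⟨k + 1, hk⟩ ⟨0, by omega⟩ u⁻¹ := by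
  induction k with
  | zero =>
    refine ⟨_, qz_ne_zero q (-dbar m (⟨1, hk⟩ : Fin (m + n))), ?_, ?_⟩
    · simp [EMat, pre]
    · simp [FMat, pre, qz_neg]
  | succ k ih =>
    obtain ⟨u, hu, h1, h2⟩ := ih (by omega)
    refine ⟨u * qz q (-dbar m (⟨k + 2, hk⟩ : Fin (m + n))),
      mul_ne_zero hu (qz_ne_zero q _), ?_, ?_⟩
    · rw [List.ofFn_succ_last, List.prod_append, List.prod_singleton]
      refine (congrArg (· * _) h1).trans ?_
      simp only [Fin.val_last, EMat]
      have : pre (⟨k + 1 + 1, hk⟩ : Fin (m + n)) = ⟨k + 1, by omega⟩ := by simp [pre]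
      rw [this, Matrix.single_mul_single_same]
    · rw [List.ofFn_succ_last, List.reverse_append, List.prod_append, List.reverse_singleton,
        List.prod_singleton]
      refine (congrArg (_ * ·) h2).trans ?_
      simp only [Fin.val_last, FMat]
      have : pre (⟨k + 1 + 1, hk⟩ : Fin (m + n)) = ⟨k + 1, by omega⟩ := by simp [pre]
      rw [this, Matrix.single_mul_single_same, qz_neg, mul_inv, inv_inv, mul_comm]

theorem eval_aux (a : 𝕜ˣ) (i : Fin (m + n)) : ∃ u : 𝕜, u ≠ 0 ∧
    evalE m n q a i = Matrix.single (pre i) i u ∧ evalF m n q a i = Matrix.single i (pre i) u⁻¹ := by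
  by_cases hi : i.val = 0
  · by_cases hN : m + n = 1
    · have hs : Subsingleton (Fin (m + n)) := by rw [hN]; infer_instance
      have h1 : ∀ c : 𝕜, c • (1 : Matrix (Fin (m + n)) (Fin (m + n)) 𝕜) =
          Matrix.single i i c := by
        intro c
        ext x y
        obtain rfl := Subsingleton.elim x i
        obtain rfl := Subsingleton.elim y x
        simp
      have hz : m + n - 1 = 0 := by omega
      refine ⟨a, a.ne_zero, ?_, ?_⟩
      · rw [Subsingleton.elim (pre i) i, ← h1]
        simp [evalE, hi, downProd, hz]
      · rw [Subsingleton.elim (pre i) i, ← h1]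
        simp [evalF, hi, upProd, hz]
    · have hlt := i.isLt
      obtain ⟨k, hk⟩ : ∃ k, m + n - 1 = k + 1 := ⟨m + n - 2, by omega⟩
      obtain ⟨u, hu, h1, h2⟩ := prod_aux m n q k (by omega)
      have e0 : i = ⟨0, by omega⟩ := Fin.ext hi
      have e1 : pre i = ⟨k + 1, by omega⟩ := Fin.ext (by simp [pre, hi, hk])
      have c1 : upProd (EMat m n q) = Matrix.single i (pre i) u := by
        have h : upProd (EMat m n q) = Matrix.single ⟨0, by omega⟩ ⟨k + 1, by omega⟩ u := by
          rw [← h1]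
          unfold upProd
          congr 1
          exact List.ofFn_congr hk _
        rw [h, e1]
        congr 1
        exact e0.symm
      have c2 : downProd (FMat m n q) = Matrix.single (pre i) i u⁻¹ := by
        have h : downProd (FMat m n q) = Matrix.single ⟨k + 1, by omega⟩ ⟨0, by omega⟩ u⁻¹ := by
          rw [← h2]
          unfold downProd
          congr 2
          exact List.ofFn_congr hk _
        rw [h, e1]
        congr 1
        exact e0.symm
      refine ⟨a * u⁻¹, mul_ne_zero a.ne_zero (inv_ne_zero hu), ?_, ?_⟩
      · simp [evalE, hi, c2]
      · simp [evalF, hi, c1, mul_comm]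
  · refine ⟨qz q (-dbar m i), qz_ne_zero q _, ?_, ?_⟩
    · simp [evalE, hi, EMat]
    · simp [evalF, hi, FMat, qz_neg]

theorem diagonal_mul_single {N : ℕ} (d : Fin N → 𝕜) (i j : Fin N) (u : 𝕜) :
    Matrix.diagonal d * Matrix.single i j u = d i • Matrix.single i j u := by
  ext x y
  rw [Matrix.diagonal_mul]
  by_cases h : i = x
  · subst h; simp
  · simp [Matrix.single, h]

theorem single_mul_diagonal {N : ℕ} (d : Fin N → 𝕜) (i j : Fin N) (u : 𝕜) :
    Matrix.single i j u * Matrix.diagonal d = d j • Matrix.single i j u := by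
  ext x y
  rw [Matrix.mul_diagonal]
  by_cases h : j = y
  · subst h; simp [mul_comm]
  · simp [Matrix.single, h]

theorem form_eps {N : ℕ} (γ : Wt N) (k : Fin N) : form m γ (eps k) = dbar m k * γ.1 k := by
  unfold form eps
  rw [Finset.sum_eq_single k] <;> simp +contextual

theorem form_root {N : ℕ} (γ : Wt N) (i : Fin N) :
    form m γ (root i) = form m γ (eps (pre i)) - form m γ (eps i) := by
  unfold form root eps
  rw [← Finset.sum_sub_distrib]
  exact Finset.sum_congr rfl fun k _ => by simp [mul_sub]

theorem sgn_vpar {N : ℕ} (k : Fin N) : sgn 𝕜 (vpar m k) = ((dbar m k : ℤ) : 𝕜) := by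
  unfold sgn vpar dbar; split_ifs <;> simp

theorem sgn_npar {N : ℕ} (i : Fin N) :
    sgn 𝕜 (npar m i) = ((dbar m (pre i) * dbar m i : ℤ) : 𝕜) := by
  unfold sgn npar vpar dbar; split_ifs <;> simp

theorem dbar_mul_self {N : ℕ} (k : Fin N) : ((dbar m k : ℤ) : 𝕜) * ((dbar m k : ℤ) : 𝕜) = 1 := by
  unfold dbar; split_ifs <;> simp

theorem pre_injective {N : ℕ} : Function.Injective (pre (N := N)) := by
  intro i j h
  have := i.isLt
  have := j.isLt
  have h' := congrArg Fin.val h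
  simp only [pre] at h'
  ext
  split_ifs at h' <;> omega

theorem eval_relations (a : 𝕜ˣ) :
    TildeRelations m n q (sigMat m n) (KMat m n q) (evalE m n q a) (evalF m n q a) where
  sig_sig := by
    simp only [sigMat, Matrix.diagonal_mul_diagonal, sgn_vpar, dbar_mul_self]
    exact Matrix.diagonal_one
  sig_K γ := by simp [sigMat, KMat, mul_comm]
  sig_E i := by
    obtain ⟨u, -, h, -⟩ := eval_aux m n q a i
    rw [h, sigMat, diagonal_mul_single, single_mul_diagonal, smul_smul, sgn_npar, sgn_vpar,
      sgn_vpar]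
    congr 1
    push_cast
    rw [mul_assoc, dbar_mul_self, mul_one]
  sig_F i := by
    obtain ⟨u, -, -, h⟩ := eval_aux m n q a i
    rw [h, sigMat, diagonal_mul_single, single_mul_diagonal, smul_smul, sgn_npar, sgn_vpar,
      sgn_vpar]
    congr 1
    push_cast
    rw [mul_right_comm, dbar_mul_self, one_mul]
  K_zero := by
    have : ∀ k : Fin (m + n), form m (0 : Wt (m + n)) (eps k) = 0 := by
      intro k; simp [form_eps]
    simp [KMat, this, qz]
  K_mul γ γ' := by
    simp only [KMat, Matrix.diagonal_mul_diagonal, ← Tilde.qz_add]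
    congr 1
    ext k
    simp [form_eps, mul_add]
  K_E γ i := by
    obtain ⟨u, -, h, -⟩ := eval_aux m n q a i
    rw [h, KMat, diagonal_mul_single, single_mul_diagonal, smul_smul, ← Tilde.qz_add, form_root]
    congr 2
    ring
  K_F γ i := by
    obtain ⟨u, -, -, h⟩ := eval_aux m n q a i
    rw [h, KMat, diagonal_mul_single, single_mul_diagonal, smul_smul, ← Tilde.qz_add, form_root]
    congr 2
    ring
  E_F i j := by
    obtain ⟨u, hu, h, -⟩ := eval_aux m n q a i
    obtain ⟨v, hv, -, h'⟩ := eval_aux m n q a j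
    rw [h, h']
    by_cases hij : i = j
    · subst hij
      obtain ⟨w, hw, g, g'⟩ := eval_aux m n q a i
      have huw : u = w := by
        have := congrFun (congrFun (h.symm.trans g) (pre i)) i
        simpa using this
      have hvw : v = w := by
        have := congrFun (congrFun (h'.symm.trans g') i) (pre i)
        simpa using this
      subst huw hvw
      rw [if_pos rfl, Matrix.single_mul_single_same, Matrix.single_mul_single_same,
        mul_inv_cancel₀ hu, inv_mul_cancel₀ hu]
      have hd : ∀ k : Fin (m + n), dbar m k = 1 ∨ dbar m k = -1 := by
        intro k; unfold dbar; split_ifs <;> simp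
      have hs : sgn 𝕜 (npar m i * npar m i) = sgn 𝕜 (npar m i) := by
        rcases Tilde.npar_lt m i with h | h <;> rw [h]
      have hr : ∀ k : Fin (m + n), form m (rootL i : lattice m n).1 (eps k) =
          dbar m k * ((if k = pre i then 1 else 0) - (if k = i then 1 else 0)) := by
        intro k
        rw [form_eps]
        simp [rootL, root, Pi.single_apply]
      have hr' : ∀ k : Fin (m + n), form m (-rootL i : lattice m n).1 (eps k) =
          -form m (rootL i : lattice m n).1 (eps k) := fun k => Tilde.form_neg _ _
      have hg : ∀ (z : Fin (m + n)) (c : 𝕜),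
          Matrix.single z z c = Matrix.diagonal fun k => if k = z then c else 0 := by
        intro z c
        ext x y
        by_cases h : x = y
        · subst h
          by_cases h' : x = z
          · subst h'; simp
          · simp [Matrix.single, h', Ne.symm h']
        · by_cases h' : z = x
          · subst h'; simp [Matrix.single, h]
          · simp [Matrix.single, h, h']
      rw [hg, hg]
      simp only [KMat, hr', hr, hs, sgn_npar, Matrix.diagonal_sub, ← Matrix.diagonal_smul]
      congr 1
      ext k
      simp only [Pi.smul_apply, smul_eq_mul]
      by_cases h1 : k = pre i <;> by_cases h2 : k = i
      · rw [← h1, ← h2]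
        simp [dbar_mul_self, qz]
      · have h3 : ¬ pre i = i := fun h => h2 (h1.trans h)
        subst h1
        simp [h3]
      · subst h2
        have h3 : ¬ pre k = k := fun h => h1 h.symm
        rcases hd k with e | e <;> rcases hd (pre k) with e' | e' <;> simp [e, e', h1]
      · simp [h1, h2]
    · rw [if_neg hij, Matrix.single_mul_single_of_ne, Matrix.single_mul_single_of_ne]
      · simp
      · exact fun e => hij (pre_injective e).symm
      · exact hij

/-- The underlying space of the fundamental representation. -/
abbrev V (𝕜 : Type*) (m n : ℕ) : Type _ := Fin (m + n) → 𝕜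

/-- The evaluation module `V(a)` of `Ũ_q^σ`. -/
def evalRep (a : 𝕜ˣ) : Tilde m n q →ₐ[𝕜] Module.End 𝕜 (V 𝕜 m n) :=
  Matrix.toLinAlgEquiv'.toAlgHom.comp (Tilde.lift (eval_relations m n q a))

/-- `V^{⊗ d}`. -/
abbrev VT (𝕜 : Type*) [Field 𝕜] (m n d : ℕ) : Type _ := ⨂[𝕜]^d (V 𝕜 m n)

/-- The tensor product of two representations, through the comultiplication. -/
def tensorRep₂ {A B : Type*} [AddCommGroup A] [Module 𝕜 A] [AddCommGroup B] [Module 𝕜 B]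
    (φ : Tilde m n q →ₐ[𝕜] Module.End 𝕜 A) (ψ : Tilde m n q →ₐ[𝕜] Module.End 𝕜 B) :
    Tilde m n q →ₐ[𝕜] Module.End 𝕜 (A ⊗[𝕜] B) :=
  (Module.endTensorEndAlgHom (R := 𝕜) (S := 𝕜) (A := 𝕜)).comp
    ((Algebra.TensorProduct.map φ ψ).comp (Tilde.comul m n q))

/-- The identification `V^{⊗ d} ⊗ V = V^{⊗ (d+1)}`. -/
def snocEquiv (𝕜 : Type*) [Field 𝕜] (m n d : ℕ) :
    (VT 𝕜 m n d ⊗[𝕜] V 𝕜 m n) ≃ₗ[𝕜] VT 𝕜 m n (d + 1) :=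
  (TensorProduct.congr (LinearEquiv.refl 𝕜 (VT 𝕜 m n d))
    (PiTensorProduct.subsingletonEquiv (R := 𝕜) (s := fun _ : Fin 1 => V 𝕜 m n) 0).symm).trans
    TensorPower.mulEquiv

/-- The module `V(a_1) ⊗ ⋯ ⊗ V(a_d)` of `Ũ_q^σ`, built through the iterated comultiplication. -/
def tensorRep : (d : ℕ) → (Fin d → 𝕜ˣ) → (Tilde m n q →ₐ[𝕜] Module.End 𝕜 (VT 𝕜 m n d))
  | 0, _ => (Algebra.ofId 𝕜 (Module.End 𝕜 (VT 𝕜 m n 0))).comp (Tilde.counit m n q)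
  | d + 1, a => (LinearEquiv.conjAlgEquiv 𝕜 (snocEquiv 𝕜 m n d)).toAlgHom.comp
      (tensorRep₂ m n q (tensorRep d (Fin.init a)) (evalRep m n q (a (Fin.last d))))

end Eval

/-! ### The quantum Serre relations -/

section Serre
variable {A : Type*} [Ring A] [Algebra 𝕜 A]

/-- The superbracket `[x, y] = x y - (-1)^{p(x) p(y)} y x` of elements of parities `a`, `b`. -/
def sbr (𝕜 : Type*) [Field 𝕜] [Algebra 𝕜 A] (a b : ℕ) (x y : A) : A :=
  x * y - sgn 𝕜 (a * b) • (y * x)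

/-- The bracket `⟦x, y⟧ = x y - (-1)^{p(x) p(y)} q^{-(α, β)} y x` of elements of parities `a`, `b`
and weights `α`, `β`. -/
def qbr (m : ℕ) {N : ℕ} (q : 𝕜ˣ) (a b : ℕ) (α β : Wt N) (x y : A) : A :=
  x * y - (sgn 𝕜 (a * b) * qz q (-form m α β)) • (y * x)

/-- The elements which are set to zero by the quantum Serre relations for a family `X_i`, which is
either `E_i` or `F_i` (in the second case the weights of both entries of every bracket change
sign, and the brackets stay the same). -/
inductive SerreElt (m : ℕ) {N : ℕ} (q : 𝕜ˣ) (X : Fin N → A) : A → Prop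
  | distant (i j) (hij : i ≠ j) (h : form m (root i) (root j) = 0) :
      SerreElt m q X (sbr 𝕜 (npar m i) (npar m j) (X i) (X j))
  | square (i) (hi : npar m i = 1) : SerreElt m q X (X i * X i)
  | cubic (i j) (hi : npar m i = 0) (hj : j = pre i ∨ j = nxt i) :
      SerreElt m q X (qbr m q (npar m i) (npar m i + npar m j) (root i) (root i + root j) (X i)
        (qbr m q (npar m i) (npar m j) (root i) (root j) (X i) (X j)))
  | quartic (i) (hi : npar m i = 1) :
      SerreElt m q X
        (sbr 𝕜 (npar m (pre i) + npar m i + npar m (nxt i)) (npar m i)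
          (qbr m q (npar m (pre i) + npar m i) (npar m (nxt i))
            (root (pre i) + root i) (root (nxt i))
            (qbr m q (npar m (pre i)) (npar m i) (root (pre i)) (root i) (X (pre i)) (X i))
            (X (nxt i)))
          (X i))

/-- The relation on `Ũ_q^σ` given by the quantum Serre relations for the `E_i` and
for the `F_i`. -/
inductive SerreRel (m n : ℕ) (q : 𝕜ˣ) : Tilde m n q → Tilde m n q → Prop
  | E (x) (h : SerreElt m q (Tilde.E (m := m) (n := n) q) x) : SerreRel m n q x 0
  | F (x) (h : SerreElt m q (Tilde.F (m := m) (n := n) q) x) : SerreRel m n q x 0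

/-- The affine quantum superalgebra `U_{q,a}^σ(sl(m,n))`. -/
abbrev U (m n : ℕ) (q : 𝕜ˣ) : Type _ := RingQuot (SerreRel m n q)

/-- The projection from `Ũ_q^σ` to `U_{q,a}^σ(sl(m,n))`. -/
def U.proj (m n : ℕ) (q : 𝕜ˣ) : Tilde m n q →ₐ[𝕜] U m n q :=
  RingQuot.mkAlgHom 𝕜 (SerreRel m n q)

end Serre

/-! ### Hecke algebras -/

section Hecke

/-- The positions `i` and `i + 1` on which the `i`-th generator `T̂_i` acts (zero-based). -/
def lo {d : ℕ} (i : Fin (d - 1)) : Fin d := ⟨i.val, by omega⟩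
def hi {d : ℕ} (i : Fin (d - 1)) : Fin d := ⟨i.val + 1, by omega⟩

/-- Generators of the affine Hecke algebra. -/
inductive HGen (d : ℕ) : Type
  | T : Fin (d - 1) → HGen d
  | y : Fin d → HGen d
  | yinv : Fin d → HGen d

/-- The relations of the finite Hecke algebra for elements `T_i`. -/
structure HeckeRelations (d : ℕ) (q : 𝕜ˣ) {A : Type*} [Ring A] [Algebra 𝕜 A]
    (T : Fin (d - 1) → A) : Prop where
  braid : ∀ i j : Fin (d - 1), i.val + 1 = j.val → T i * T j * T i = T j * T i * T j
  comm : ∀ i j : Fin (d - 1), i.val + 1 < j.val → T i * T j = T j * T i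
  quad : ∀ i, T i * T i = (qz q 1 - qz q (-1)) • T i + 1

/-- The defining relation of the finite Hecke algebra `H_d(q²)`. -/
inductive HeckeRel (d : ℕ) (q : 𝕜ˣ) :
    FreeAlgebra 𝕜 (Fin (d - 1)) → FreeAlgebra 𝕜 (Fin (d - 1)) → Prop
  | braid (i j) (h : i.val + 1 = j.val) :
      HeckeRel d q (.ι 𝕜 i * .ι 𝕜 j * .ι 𝕜 i) (.ι 𝕜 j * .ι 𝕜 i * .ι 𝕜 j)
  | comm (i j) (h : i.val + 1 < j.val) : HeckeRel d q (.ι 𝕜 i * .ι 𝕜 j) (.ι 𝕜 j * .ι 𝕜 i)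
  | quad (i) : HeckeRel d q (.ι 𝕜 i * .ι 𝕜 i) ((qz q 1 - qz q (-1)) • .ι 𝕜 i + 1)

/-- The finite Hecke algebra `H_d(q²)`. -/
abbrev Hecke (d : ℕ) (q : 𝕜ˣ) : Type _ := RingQuot (HeckeRel d q)

/-- The generator `T̂_i` of the finite Hecke algebra. -/
def Hecke.T {d : ℕ} (q : 𝕜ˣ) (i : Fin (d - 1)) : Hecke d q :=
  RingQuot.mkAlgHom 𝕜 (HeckeRel d q) (.ι 𝕜 i)

/-- The homomorphism out of `H_d(q²)` given by elements which satisfy its defining relations. -/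
def Hecke.lift {d : ℕ} {q : 𝕜ˣ} {A : Type*} [Ring A] [Algebra 𝕜 A] {T : Fin (d - 1) → A}
    (h : HeckeRelations d q T) : Hecke d q →ₐ[𝕜] A :=
  RingQuot.liftAlgHom 𝕜 ⟨FreeAlgebra.lift 𝕜 T, by
    rintro _ _ (⟨i, j, hij⟩ | ⟨i, j, hij⟩ | ⟨i⟩)
    · simpa using h.braid i j hij
    · simpa using h.comm i j hij
    · simpa using h.quad i⟩

/-- The defining relation of the affine Hecke algebra `H^a_d(q²)`. -/
inductive AffHeckeRel (d : ℕ) (q : 𝕜ˣ) :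
    FreeAlgebra 𝕜 (HGen d) → FreeAlgebra 𝕜 (HGen d) → Prop
  | braid (i j) (h : i.val + 1 = j.val) :
      AffHeckeRel d q (.ι 𝕜 (.T i) * .ι 𝕜 (.T j) * .ι 𝕜 (.T i))
        (.ι 𝕜 (.T j) * .ι 𝕜 (.T i) * .ι 𝕜 (.T j))
  | comm (i j) (h : i.val + 1 < j.val) :
      AffHeckeRel d q (.ι 𝕜 (.T i) * .ι 𝕜 (.T j)) (.ι 𝕜 (.T j) * .ι 𝕜 (.T i))
  | quad (i) : AffHeckeRel d q (.ι 𝕜 (.T i) * .ι 𝕜 (.T i))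
      ((qz q 1 - qz q (-1)) • .ι 𝕜 (.T i) + 1)
  | y_yinv (j) : AffHeckeRel d q (.ι 𝕜 (.y j) * .ι 𝕜 (.yinv j)) 1
  | yinv_y (j) : AffHeckeRel d q (.ι 𝕜 (.yinv j) * .ι 𝕜 (.y j)) 1
  | y_y (j k) : AffHeckeRel d q (.ι 𝕜 (.y j) * .ι 𝕜 (.y k)) (.ι 𝕜 (.y k) * .ι 𝕜 (.y j))
  | y_T (j i) (h1 : j ≠ lo i) (h2 : j ≠ hi i) :
      AffHeckeRel d q (.ι 𝕜 (.y j) * .ι 𝕜 (.T i)) (.ι 𝕜 (.T i) * .ι 𝕜 (.y j))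
  | T_y_T (i) : AffHeckeRel d q (.ι 𝕜 (.T i) * .ι 𝕜 (.y (lo i)) * .ι 𝕜 (.T i)) (.ι 𝕜 (.y (hi i)))

/-- The affine Hecke algebra `H^a_d(q²)`. -/
abbrev AffHecke (d : ℕ) (q : 𝕜ˣ) : Type _ := RingQuot (AffHeckeRel d q)

namespace AffHecke
variable {d : ℕ}

def T (q : 𝕜ˣ) (i : Fin (d - 1)) : AffHecke d q :=
  RingQuot.mkAlgHom 𝕜 (AffHeckeRel d q) (.ι 𝕜 (.T i))
def y (q : 𝕜ˣ) (j : Fin d) : AffHecke d q :=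
  RingQuot.mkAlgHom 𝕜 (AffHeckeRel d q) (.ι 𝕜 (.y j))
/-- The inverse of `y_j`. -/
def yinv (q : 𝕜ˣ) (j : Fin d) : AffHecke d q :=
  RingQuot.mkAlgHom 𝕜 (AffHeckeRel d q) (.ι 𝕜 (.yinv j))

theorem hecke_relations (q : 𝕜ˣ) : HeckeRelations d q (T (d := d) q) where
  braid i j h := by
    simpa only [map_mul, T] using RingQuot.mkAlgHom_rel 𝕜 (AffHeckeRel.braid (q := q) i j h)
  comm i j h := by
    simpa only [map_mul, T] using RingQuot.mkAlgHom_rel 𝕜 (AffHeckeRel.comm (q := q) i j h)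
  quad i := by
    simpa only [map_mul, map_add, map_smul, map_one, T] using
      RingQuot.mkAlgHom_rel 𝕜 (AffHeckeRel.quad (q := q) i)

/-- The natural map `H_d(q²) → H^a_d(q²)`. -/
def ofHecke (d : ℕ) (q : 𝕜ˣ) : Hecke d q →ₐ[𝕜] AffHecke d q := Hecke.lift (hecke_relations q)

end AffHecke

/-- The right ideal of `H^a_d(q²)` generated by the elements `y_j - c_j`. -/
def Hc {d : ℕ} (q : 𝕜ˣ) (c : Fin d → 𝕜ˣ) : Submodule (AffHecke d q)ᵐᵒᵖ (AffHecke d q) :=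
  Submodule.span _ (Set.range fun j => AffHecke.y q j - algebraMap 𝕜 _ (c j : 𝕜))

/-- The universal right module `M_c = H^a_d(q²) / H_c`.  Right modules over `A` are modules over
`Aᵐᵒᵖ`. -/
abbrev Mc {d : ℕ} (q : 𝕜ˣ) (c : Fin d → 𝕜ˣ) : Type _ := AffHecke d q ⧸ Hc q c

end Hecke

/-! ### The action of the Hecke algebra on `V^{⊗ d}` -/

section RMatrix
variable (m n : ℕ) (q : 𝕜ˣ) {d : ℕ}

/-- The matrix unit `E_{a,b}` as an endomorphism of `V`. -/
def unit (𝕜 : Type*) [Field 𝕜] (m n : ℕ) (a b : Fin (m + n)) : Module.End 𝕜 (V 𝕜 m n) :=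
  Matrix.toLinAlgEquiv' (Matrix.single a b 1)

/-- `X ⊗ Y` on the tensor factors `i`, `i + 1` and the identity on the others. -/
def twoLeg {m n : ℕ} (i : Fin (d - 1)) (X Y : Module.End 𝕜 (V 𝕜 m n)) :
    Module.End 𝕜 (VT 𝕜 m n d) :=
  PiTensorProduct.map fun k => if k = lo i then X else if k = hi i then Y else LinearMap.id

/-- The operator `Ř_i`, which is `Ř` on the tensor factors `i`, `i + 1`.  Here `Ř` maps
`ε̄_a ⊗ ε̄_a` to `(-1)^{p(a)} q^{(-1)^{p(a)}} ε̄_a ⊗ ε̄_a`, and for `a ≠ b` it maps `ε̄_a ⊗ ε̄_b` to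
`(-1)^{p(a) p(b)} ε̄_b ⊗ ε̄_a`, plus `(q - q⁻¹) ε̄_a ⊗ ε̄_b` if `a < b`.  (The sign
`(-1)^{p(a) p(b)}` comes from the sign rule for the graded action of `E_{b,a} ⊗ E_{a,b}`; the tensor
products of operators below are ungraded.) -/
def Rcheck (i : Fin (d - 1)) : Module.End 𝕜 (VT 𝕜 m n d) :=
  (∑ a : Fin (m + n), (sgn 𝕜 (vpar m a) * qz q (dbar m a)) •
      twoLeg i (unit 𝕜 m n a a) (unit 𝕜 m n a a)) +
    (∑ a : Fin (m + n), ∑ b : Fin (m + n), if a = b then 0 else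
      sgn 𝕜 (vpar m a * vpar m b) • twoLeg i (unit 𝕜 m n b a) (unit 𝕜 m n a b)) +
    ∑ a : Fin (m + n), ∑ b : Fin (m + n), if a < b then
      (qz q 1 - qz q (-1)) • twoLeg i (unit 𝕜 m n a a) (unit 𝕜 m n b b) else 0

/-- The tensor of basis vectors `ε̄_{f 1} ⊗ ⋯ ⊗ ε̄_{f d}`. -/
def tb (𝕜 : Type*) [Field 𝕜] {m n d : ℕ} (f : Fin d → Fin (m + n)) : VT 𝕜 m n d :=
  PiTensorProduct.tprod 𝕜 fun k => (Pi.single (f k) 1 : V 𝕜 m n)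

theorem end_ext {m n : ℕ} {X Y : Module.End 𝕜 (VT 𝕜 m n d)}
    (h : ∀ f : Fin d → Fin (m + n), X (tb 𝕜 f) = Y (tb 𝕜 f)) : X = Y := by
  refine PiTensorProduct.ext (Module.Basis.ext_multilinear (fun _ => Pi.basisFun 𝕜 _) fun f => ?_)
  simpa [tb] using h f

theorem unit_single (a b c : Fin (m + n)) :
    unit 𝕜 m n a b (Pi.single c 1) = if b = c then Pi.single a 1 else 0 := by
  ext k
  by_cases h : b = c
  · subst h
    simp [unit, Matrix.single, Pi.single_apply, eq_comm]
  · simp [unit, Matrix.single, h]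

theorem lo_ne_hi (i : Fin (d - 1)) : lo i ≠ hi i := by
  simp [lo, hi, Fin.ext_iff]

/-- A basis tensor with prescribed entries at two positions. -/
def upd2 {α : Type*} (f : Fin d → α) (i : Fin (d - 1)) (a b : α) : Fin d → α :=
  Function.update (Function.update f (lo i) a) (hi i) b

theorem twoLeg_unit (i : Fin (d - 1)) (a b a' b' : Fin (m + n)) (f : Fin d → Fin (m + n)) :
    twoLeg i (unit 𝕜 m n a b) (unit 𝕜 m n a' b') (tb 𝕜 f) =
      if b = f (lo i) ∧ b' = f (hi i) then tb 𝕜 (upd2 f i a a') else 0 := by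
  have hne := lo_ne_hi i
  rw [twoLeg, tb, PiTensorProduct.map_tprod]
  split_ifs with h
  · rw [tb]
    congr 1
    ext1 k
    by_cases h1 : k = lo i
    · subst h1
      simp [unit_single, h.1, upd2, hne]
    · by_cases h2 : k = hi i
      · subst h2
        simp [unit_single, h.2, upd2, hne.symm]
      · simp [upd2, h1, h2]
  · rw [not_and_or] at h
    rcases h with h | h
    · refine MultilinearMap.map_coord_zero _ (lo i) ?_
      simp [unit_single, h]
    · refine MultilinearMap.map_coord_zero _ (hi i) ?_
      simp [unit_single, h, hne.symm]

theorem upd2_self {α : Type*} (f : Fin d → α) (i : Fin (d - 1)) :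
    upd2 f i (f (lo i)) (f (hi i)) = f := by
  simp [upd2]

theorem Rcheck_tb (i : Fin (d - 1)) (f : Fin d → Fin (m + n)) :
    Rcheck m n q i (tb 𝕜 f) =
      (if f (lo i) = f (hi i) then
        (sgn 𝕜 (vpar m (f (lo i))) * qz q (dbar m (f (lo i)))) • tb 𝕜 f
      else sgn 𝕜 (vpar m (f (lo i)) * vpar m (f (hi i))) •
        tb 𝕜 (upd2 f i (f (hi i)) (f (lo i)))) +
      if f (lo i) < f (hi i) then (qz q 1 - qz q (-1)) • tb 𝕜 f else 0 := by
  simp only [Rcheck, LinearMap.add_apply, LinearMap.sum_apply]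
  congr 1
  · have h1 : ∑ a : Fin (m + n), ((sgn 𝕜 (vpar m a) * qz q (dbar m a)) •
        twoLeg i (unit 𝕜 m n a a) (unit 𝕜 m n a a)) (tb 𝕜 f) =
        if f (lo i) = f (hi i) then
          (sgn 𝕜 (vpar m (f (lo i))) * qz q (dbar m (f (lo i)))) • tb 𝕜 f else 0 := by
      rw [Finset.sum_eq_single (f (lo i))]
      · rw [LinearMap.smul_apply, twoLeg_unit]
        split_ifs with h h' h'
        · congr 2
          nth_rewrite 2 [h']
          exact upd2_self f i
        · exact absurd h.2 h'
        · exact absurd ⟨rfl, h'⟩ h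
        · simp
      · intro a _ ha
        rw [LinearMap.smul_apply, twoLeg_unit, if_neg (fun h => ha h.1), smul_zero]
      · simp
    have h2 : ∑ a : Fin (m + n), ∑ b : Fin (m + n), (if a = b then 0 else
        sgn 𝕜 (vpar m a * vpar m b) • twoLeg i (unit 𝕜 m n b a) (unit 𝕜 m n a b)) (tb 𝕜 f) =
        if f (lo i) = f (hi i) then 0 else sgn 𝕜 (vpar m (f (lo i)) * vpar m (f (hi i))) •
          tb 𝕜 (upd2 f i (f (hi i)) (f (lo i))) := by
      rw [Finset.sum_eq_single (f (lo i)), Finset.sum_eq_single (f (hi i))]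
      · split_ifs with h
        · simp
        · rw [LinearMap.smul_apply, twoLeg_unit, if_pos ⟨rfl, rfl⟩]
      · intro b _ hb
        split_ifs
        · simp
        · rw [LinearMap.smul_apply, twoLeg_unit, if_neg (fun h => hb h.2), smul_zero]
      · simp
      · intro a _ ha
        refine Finset.sum_eq_zero fun b _ => ?_
        split_ifs
        · simp
        · rw [LinearMap.smul_apply, twoLeg_unit, if_neg (fun h => ha h.1), smul_zero]
      · simp
    rw [h1, h2]
    split_ifs <;> simp
  · rw [Finset.sum_eq_single (f (lo i)), Finset.sum_eq_single (f (hi i))]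
    · split_ifs with h
      · rw [LinearMap.smul_apply, twoLeg_unit, if_pos ⟨rfl, rfl⟩, upd2_self]
      · simp
    · intro b _ hb
      split_ifs
      · rw [LinearMap.smul_apply, twoLeg_unit, if_neg (fun h => hb h.2), smul_zero]
      · simp
    · simp
    · intro a _ ha
      refine Finset.sum_eq_zero fun b _ => ?_
      split_ifs
      · rw [LinearMap.smul_apply, twoLeg_unit, if_neg (fun h => ha h.1), smul_zero]
      · simp
    · simp

theorem upd2_lo {α : Type*} (f : Fin d → α) (i : Fin (d - 1)) (a b : α) :
    upd2 f i a b (lo i) = a := by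
  simp [upd2, lo_ne_hi]

theorem upd2_hi {α : Type*} (f : Fin d → α) (i : Fin (d - 1)) (a b : α) :
    upd2 f i a b (hi i) = b := by
  simp [upd2]

theorem upd2_upd2 {α : Type*} (f : Fin d → α) (i : Fin (d - 1)) (a b a' b' : α) :
    upd2 (upd2 f i a b) i a' b' = upd2 f i a' b' := by
  ext1 k
  by_cases h2 : k = hi i
  · simp [upd2, h2]
  · by_cases h1 : k = lo i <;> simp [upd2, h1, h2, lo_ne_hi]

theorem twoLeg_comm (i j : Fin (d - 1)) (h : i.val + 1 < j.val)
    (X Y X' Y' : Module.End 𝕜 (V 𝕜 m n)) : Commute (twoLeg i X Y) (twoLeg j X' Y') := by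
  unfold twoLeg Commute SemiconjBy
  rw [← PiTensorProduct.map_mul, ← PiTensorProduct.map_mul]
  congr 1
  ext1 k
  have h1 : ¬ (k = lo i ∧ k = lo j) := by simp only [lo, Fin.ext_iff]; omega
  have h2 : ¬ (k = lo i ∧ k = hi j) := by simp only [lo, hi, Fin.ext_iff]; omega
  have h3 : ¬ (k = hi i ∧ k = lo j) := by simp only [lo, hi, Fin.ext_iff]; omega
  have h4 : ¬ (k = hi i ∧ k = hi j) := by simp only [hi, Fin.ext_iff]; omega
  split_ifs <;> first | rfl | (exfalso; tauto)

theorem eigen_cases (a : Fin (m + n)) :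
    sgn 𝕜 (vpar m a) * qz q (dbar m a) = q ∨
      sgn 𝕜 (vpar m a) * qz q (dbar m a) = -(q : 𝕜)⁻¹ := by
  unfold sgn vpar dbar
  split_ifs <;> simp [qz]

theorem sgn_cases (k : ℕ) : sgn 𝕜 k = 1 ∨ sgn 𝕜 k = -1 := neg_one_pow_eq_or 𝕜 k

set_option maxHeartbeats 1000000 in
set_option linter.unusedSimpArgs false in
theorem braid_aux {α M : Type*} [LinearOrder α] [AddCommGroup M] [Module 𝕜 M]
    (W : α → α → α → M) (e : α → 𝕜) (s : α → α → 𝕜) (A B : Module.End 𝕜 M)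
    (he : ∀ a, e a = q ∨ e a = -(q : 𝕜)⁻¹) (hss : ∀ a b, s a b = s b a)
    (hA : ∀ a b c, A (W a b c) = (if a = b then e a • W a b c else s a b • W b a c) +
      if a < b then ((q : 𝕜) - (q : 𝕜)⁻¹) • W a b c else 0)
    (hB : ∀ a b c, B (W a b c) = (if b = c then e b • W a b c else s b c • W a c b) +
      if b < c then ((q : 𝕜) - (q : 𝕜)⁻¹) • W a b c else 0)
    (hs : ∀ a b, s a b = 1 ∨ s a b = -1) (a b c : α) :
    A (B (A (W a b c))) = B (A (B (W a b c))) := by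
  have hq : (q : 𝕜) ≠ 0 := q.ne_zero
  have s1 := hss b a
  have s2 := hss c b
  have s3 := hss c a
  have t1 := hs a b
  have t2 := hs b c
  have t3 := hs a c
  have t4 := he a
  have t5 := he b
  clear hss he hs
  rcases lt_trichotomy a b with h1 | h1 | h1 <;> rcases lt_trichotomy b c with h2 | h2 | h2 <;>
    rcases lt_trichotomy a c with h3 | h3 | h3 <;>
    first
    | (exfalso; order)
    | ((try subst h1); (try subst h2)
       simp only [hA, hB, map_add, map_smul, map_zero, if_true, if_false, lt_irrefl, h1, h2, h3,
         h1.ne, h2.ne, h3.ne, h1.ne', h2.ne', h3.ne', h1.not_gt, h2.not_gt, h3.not_gt, s1, s2, s3,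
         add_zero, smul_zero, smul_add, smul_smul]
       rcases t1 with t1 | t1 <;> rcases t2 with t2 | t2 <;> rcases t3 with t3 | t3 <;>
         simp only [t1, t2, t3] <;> module)
    | (subst h1
       simp only [hA, hB, map_add, map_smul, map_zero, if_true, if_false, lt_irrefl, h2, h3, h2.ne, h2.ne', h2.not_gt,
         h3.ne, h3.ne', h3.not_gt, s2, s3, add_zero, smul_zero, smul_add, smul_smul]
       rcases t3 with t3 | t3 <;> rcases t4 with t4 | t4 <;>
         simp only [t3, t4] <;> match_scalars <;> field_simp <;> ring)
    | (subst h2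
       simp only [hA, hB, map_add, map_smul, map_zero, if_true, if_false, lt_irrefl, h1, h3, h1.ne, h1.ne', h1.not_gt,
         h3.ne, h3.ne', h3.not_gt, s1, s3, add_zero, smul_zero, smul_add, smul_smul]
       rcases t1 with t1 | t1 <;> rcases t5 with t5 | t5 <;>
         simp only [t1, t5] <;> match_scalars <;> field_simp <;> ring)
    | (subst h3
       simp only [hA, hB, map_add, map_smul, map_zero, if_true, if_false, lt_irrefl, h1, h2, h1.ne, h1.ne', h1.not_gt,
         h2.ne, h2.ne', h2.not_gt, s1, add_zero, smul_zero, smul_add, smul_smul]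
       rcases t1 with t1 | t1 <;> rcases t4 with t4 | t4 <;>
         simp only [t1, t4] <;> match_scalars <;> field_simp)
    | (subst h1 h2
       simp only [hA, hB, map_add, map_smul, map_zero, if_true, if_false, lt_irrefl])

theorem Rcheck_relations : HeckeRelations d q (Rcheck (d := d) m n q) where
  braid i j hij := by
    refine end_ext fun f => ?_
    have h1 : qz q 1 = (q : 𝕜) := by simp [qz]
    have h2 : qz q (-1) = (q : 𝕜)⁻¹ := by simp [qz]
    have e : lo j = hi i := Fin.ext hij.symm
    have n1 : lo i ≠ hi i := lo_ne_hi i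
    have n2 : hi i ≠ hi j := by simp only [hi, ne_eq, Fin.ext_iff]; omega
    have n3 : lo i ≠ hi j := by simp only [lo, hi, ne_eq, Fin.ext_iff]; omega
    let g : Fin (m + n) → Fin (m + n) → Fin (m + n) → Fin d → Fin (m + n) := fun a b c =>
      Function.update (Function.update (Function.update f (lo i) a) (hi i) b) (hi j) c
    have g1 : ∀ a b c, g a b c (lo i) = a := by intro a b c; simp [g, n1, n3]
    have g2 : ∀ a b c, g a b c (hi i) = b := by intro a b c; simp [g, n2]
    have g3 : ∀ a b c, g a b c (hi j) = c := by intro a b c; simp [g]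
    have g4 : ∀ a b c a' b', upd2 (g a b c) i a' b' = g a' b' c := by
      intro a b c a' b'
      ext1 k
      by_cases k1 : k = lo i
      · subst k1; rw [upd2_lo, g1]
      by_cases k2 : k = hi i
      · subst k2; rw [upd2_hi, g2]
      by_cases k3 : k = hi j
      · subst k3; simp [upd2, g, n2.symm, n3.symm]
      · simp [upd2, g, k1, k2, k3]
    have g5 : ∀ a b c b' c', upd2 (g a b c) j b' c' = g a b' c' := by
      intro a b c b' c'
      ext1 k
      by_cases k2 : k = hi i
      · subst k2; rw [← e, upd2_lo, e, g2]
      by_cases k3 : k = hi j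
      · subst k3; rw [upd2_hi, g3]
      · simp [upd2, g, e, k2, k3]
    have hf : f = g (f (lo i)) (f (hi i)) (f (hi j)) := by simp [g]
    rw [hf]
    exact braid_aux q (fun a b c => tb 𝕜 (g a b c))
      (fun a => sgn 𝕜 (vpar m a) * qz q (dbar m a)) (fun a b => sgn 𝕜 (vpar m a * vpar m b))
      (Rcheck m n q i) (Rcheck m n q j) (eigen_cases m n q)
      (fun a b => by rw [mul_comm])
      (fun a b c => by rw [Rcheck_tb, g1, g2, g4, h1, h2])
      (fun a b c => by rw [Rcheck_tb, e, g2, g3, g5, h1, h2])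
      (fun a b => sgn_cases _) _ _ _
  comm i j hij := by
    have hc := twoLeg_comm (𝕜 := 𝕜) m n i j hij
    change Commute _ _
    unfold Rcheck
    refine Commute.add_left (Commute.add_left ?_ ?_) ?_ <;>
      refine Commute.add_right (Commute.add_right ?_ ?_) ?_ <;>
      (try refine Commute.sum_left _ _ _ fun a _ => ?_) <;>
      (try refine Commute.sum_left _ _ _ fun a' _ => ?_) <;>
      (try refine Commute.sum_right _ _ _ fun b _ => ?_) <;>
      (try refine Commute.sum_right _ _ _ fun b' _ => ?_) <;>
      (try split_ifs) <;>
      first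
      | exact Commute.zero_left _
      | exact Commute.zero_right _
      | exact ((hc _ _ _ _).smul_left _).smul_right _
  quad i := by
    refine end_ext fun f => ?_
    have hq : (q : 𝕜) ≠ 0 := q.ne_zero
    have h1 : qz q 1 = (q : 𝕜) := by simp [qz]
    have h2 : qz q (-1) = (q : 𝕜)⁻¹ := by simp [qz]
    rw [Module.End.mul_apply, LinearMap.add_apply, LinearMap.smul_apply, Rcheck_tb, h1, h2]
    simp only [map_add, apply_ite (Rcheck m n q i), map_smul, map_zero, Module.End.one_apply,
      Rcheck_tb, upd2_lo, upd2_hi, upd2_upd2, upd2_self, h1, h2]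
    rcases lt_trichotomy (f (lo i)) (f (hi i)) with h | h | h
    · rcases sgn_cases (𝕜 := 𝕜) (vpar m (f (lo i)) * vpar m (f (hi i))) with e | e <;>
      simp [h, h.ne, h.ne', h.not_gt, mul_comm (vpar m (f (hi i))), e] <;> module
    · rcases eigen_cases (n := n) m q (f (lo i)) with e | e <;>
      simp [← h, e] <;> match_scalars <;> field_simp <;> ring
    · rcases sgn_cases (𝕜 := 𝕜) (vpar m (f (lo i)) * vpar m (f (hi i))) with e | e <;>
      simp [h, h.ne, h.ne', h.not_gt, mul_comm (vpar m (f (hi i))), e] <;> module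

/-- The left action `π_d` of `H_d(q²)` on `V^{⊗ d}`, in which `T̂_i` acts as `Ř_i`. -/
def heckeRep (d : ℕ) : Hecke d q →ₐ[𝕜] Module.End 𝕜 (VT 𝕜 m n d) :=
  Hecke.lift (Rcheck_relations m n q)

end RMatrix

/-! ### The affine Schur-Weyl functor -/

section Functor
variable (m n d : ℕ) (q : 𝕜ˣ)
variable (M : Type*) [AddCommGroup M] [Module 𝕜 M] [Module (AffHecke d q)ᵐᵒᵖ M]

/-- The subspace of `M ⊗ V^{⊗ d}` spanned by all `x h ⊗ v - x ⊗ h v` with `h ∈ H_d(q²)`. -/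
def balanced : Submodule 𝕜 (M ⊗[𝕜] VT 𝕜 m n d) :=
  Submodule.span 𝕜 {z | ∃ (h : Hecke d q) (x : M) (v : VT 𝕜 m n d),
    z = (MulOpposite.op (AffHecke.ofHecke d q h) • x) ⊗ₜ v - x ⊗ₜ (heckeRep m n q d h v)}

/-- `J(M) = M ⊗_{H_d(q²)} V^{⊗ d}` for a right `H^a_d(q²)`-module `M`. -/
abbrev J : Type _ := (M ⊗[𝕜] VT 𝕜 m n d) ⧸ balanced m n d q M

variable {M} in
/-- The element `x ⊗ v` of `J(M)`. -/
def J.tmul (x : M) (v : VT 𝕜 m n d) : J m n d q M :=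
  (balanced m n d q M).mkQ (x ⊗ₜ v)

/-- The action of `E_Π = E_1 E_2 ⋯ E_{m+n-1}` on `V`. -/
def EPi : Module.End 𝕜 (V 𝕜 m n) := evalRep m n q 1 (upProd (Tilde.E q))

/-- The action of `F_Π = F_{m+n-1} ⋯ F_2 F_1` on `V`. -/
def FPi : Module.End 𝕜 (V 𝕜 m n) := evalRep m n q 1 (downProd (Tilde.F q))

/-- The action of `K_Π = K_{α_1} ⋯ K_{α_{m+n-1}}` on `V`. -/
def KPi : Module.End 𝕜 (V 𝕜 m n) := evalRep m n q 1 (upProd fun i => Tilde.K q (rootL i))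

/-- The action of `K_Π⁻¹` on `V`. -/
def KPiInv : Module.End 𝕜 (V 𝕜 m n) := evalRep m n q 1 (downProd fun i => Tilde.K q (-rootL i))

/-- The action of `σ` on `V`. -/
def sigV : Module.End 𝕜 (V 𝕜 m n) := evalRep m n q 1 (Tilde.sig m n q)

/-- `(σ K_Π⁻¹)^{⊗ (j-1)} ⊗ F_Π ⊗ 1^{⊗ (d-j)}` on `V^{⊗ d}`. -/
def YE (j : Fin d) : Module.End 𝕜 (VT 𝕜 m n d) :=
  PiTensorProduct.map fun k =>
    if k < j then sigV m n q * KPiInv m n q else if k = j then FPi m n q else LinearMap.id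

/-- `σ^{⊗ (j-1)} ⊗ E_Π ⊗ K_Π^{⊗ (d-j)}` on `V^{⊗ d}`. -/
def YF (j : Fin d) : Module.End 𝕜 (VT 𝕜 m n d) :=
  PiTensorProduct.map fun k =>
    if k < j then sigV m n q else if k = j then EPi m n q else KPi m n q

/-- `Φ` is the `U_{q,a}^σ(sl(m,n))`-module structure of `𝓕(M)` on the space `J(M)`: the generators
`σ`, `K_γ`, `E_i`, `F_i` (`i ≠ 0`) act through their natural action on `V^{⊗ d}`, and
`E_0 (x ⊗ v) = ∑_j x y_j⁻¹ ⊗ Y_{j,E} v`, `F_0 (x ⊗ v) = ∑_j x y_j ⊗ Y_{j,F} v`.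
The natural action of the generators with `i ≠ 0` is the one on `V(1)^{⊗ d}` (on these generators
all `V(a)` agree).  These formulas determine `Φ`. -/
structure IsSchurWeyl (Φ : U m n q →ₐ[𝕜] Module.End 𝕜 (J m n d q M)) : Prop where
  sig : ∀ (x : M) (v : VT 𝕜 m n d), Φ (U.proj m n q (Tilde.sig m n q)) (J.tmul m n d q x v) =
    J.tmul m n d q x (tensorRep m n q d (fun _ => 1) (Tilde.sig m n q) v)
  K : ∀ γ (x : M) (v : VT 𝕜 m n d), Φ (U.proj m n q (Tilde.K q γ)) (J.tmul m n d q x v) =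
    J.tmul m n d q x (tensorRep m n q d (fun _ => 1) (Tilde.K q γ) v)
  E : ∀ i, i.val ≠ 0 → ∀ (x : M) (v : VT 𝕜 m n d),
    Φ (U.proj m n q (Tilde.E q i)) (J.tmul m n d q x v) =
      J.tmul m n d q x (tensorRep m n q d (fun _ => 1) (Tilde.E q i) v)
  F : ∀ i, i.val ≠ 0 → ∀ (x : M) (v : VT 𝕜 m n d),
    Φ (U.proj m n q (Tilde.F q i)) (J.tmul m n d q x v) =
      J.tmul m n d q x (tensorRep m n q d (fun _ => 1) (Tilde.F q i) v)
  E_zero : ∀ i, i.val = 0 → ∀ (x : M) (v : VT 𝕜 m n d),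
    Φ (U.proj m n q (Tilde.E q i)) (J.tmul m n d q x v) =
      ∑ j, J.tmul m n d q (MulOpposite.op (AffHecke.yinv q j) • x) (YE m n d q j v)
  F_zero : ∀ i, i.val = 0 → ∀ (x : M) (v : VT 𝕜 m n d),
    Φ (U.proj m n q (Tilde.F q i)) (J.tmul m n d q x v) =
      ∑ j, J.tmul m n d q (MulOpposite.op (AffHecke.y q j) • x) (YF m n d q j v)

end Functor

end
end QSuper
end

/-!
The two halves of the argument are independent of each other.

*The Serre relations.*  Written out in words, the quantum Serre relations are homogeneous identities
which pass from two `q`-commuting families `X_i` and `X_i'` to the family `X_i + X_i'`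
(`SerreWords.add`).  As the two summands of `Δ E_i` and of `Δ F_i` `q`-commute, the relations pass
to tensor products, and on an evaluation module they hold because all words in matrix units which
occur in them vanish.  Hence every tensor product of evaluation modules is a `U`-module
(`tensorRepU`).

*The canonical map* `v ↦ 1 ⊗ v` is surjective, because the exchange relations between `T̂_i` and
`y_j^{±1}` allow one to move all `y_j` to the left, where they act on `M_c` by scalars: `M_c` is the
image of `H_d(q²)` (`AffHecke.mem_ySub_mul`, `exists_ofHecke`).  It is injective because
`V^{⊗ d}` can be induced to the affine Hecke algebra: on Laurent polynomials with coefficients in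
`V^{⊗ d}` let `y_j` act by multiplication and `T̂_i` by `s_i ⊗ Ř_i + (q - q⁻¹) ∂_i ⊗ 1`, where `∂_i`
is the Demazure operator (`bernstein`, `affRep`).  Evaluation of the Laurent polynomials at
`y_j = c_j` then yields a map `J(M_c) → V^{⊗ d}` (`fromJ`) which is a left inverse.

It remains to identify the action of `U` transported from `V(c_1⁻¹) ⊗ ⋯ ⊗ V(c_d⁻¹)`.  On elements
`1 ⊗ v` it is given by the formulas which define `𝓕(M_c)`, since `1 · y_j = c_j` in `M_c`.  As every
element of `M_c` has the form `1 · h` with `h ∈ H_d(q²)`, it suffices that these formulas are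
compatible with the relation `x h ⊗ v = x ⊗ h v`.  For `σ`, `K_γ`, `E_i`, `F_i` with `i ≠ 0` this
says that `Ř` commutes with their action (`R2_diag`, `R2_raise`, `R2_lower`).  For `E_0` and `F_0`
it follows from the fact that `Ř_i` exchanges the `i`-th and `(i+1)`-st summand of the defining
operator in one order, the quadratic relation accounting for the other order (`sum_mkJ_T`).
-/

noncomputable section
namespace QSuper

/-! ### Sums of `q`-commuting solutions of the Serre relations -/

section Sums
variable {𝕜 : Type*} [Field 𝕜] {A : Type*} [Ring A] [Algebra 𝕜 A]

/-- The cubic relation `x² y - (r + r⁻¹) x y x + y x² = 0` is inherited by the sum of two solutions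
`(x, y)` and `(x', y')` which `r`-commute with each other. -/
theorem cubic_add {r : 𝕜} (hr : r ≠ 0) {x y x' y' : A}
    (hxx : x' * x = (r⁻¹ * r⁻¹) • (x * x')) (hxy : x' * y = r • (y * x'))
    (hyx : y' * x = r • (x * y'))
    (h : x * (x * y) + y * (x * x) = (r + r⁻¹) • (x * (y * x)))
    (h' : x' * (x' * y') + y' * (x' * x') = (r + r⁻¹) • (x' * (y' * x'))) :
    (x + x') * ((x + x') * (y + y')) + (y + y') * ((x + x') * (x + x')) =
      (r + r⁻¹) • ((x + x') * ((y + y') * (x + x'))) := by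
  have hxx2 : ∀ w, x' * (x * w) = (r⁻¹ * r⁻¹) • (x * (x' * w)) := fun w => by
    rw [← mul_assoc, hxx, smul_mul_assoc, mul_assoc]
  have hxy2 : ∀ w, x' * (y * w) = r • (y * (x' * w)) := fun w => by
    rw [← mul_assoc, hxy, smul_mul_assoc, mul_assoc]
  have hyx2 : ∀ w, y' * (x * w) = r • (x * (y' * w)) := fun w => by
    rw [← mul_assoc, hyx, smul_mul_assoc, mul_assoc]
  have e : x * (x * y) = (r + r⁻¹) • (x * (y * x)) - y * (x * x) := eq_sub_of_add_eq h
  have e' : x' * (x' * y') = (r + r⁻¹) • (x' * (y' * x')) - y' * (x' * x') := eq_sub_of_add_eq h'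
  simp only [mul_add, add_mul, hxx, hxy, hyx, hxx2, hxy2, hyx2, e, e', mul_smul_comm, smul_smul,
    smul_add]
  match_scalars <;> field_simp <;> ring

/-- The quartic relation of the odd nodes is inherited by the sum of two `r`-commuting solutions
`(x, y, z)` and `(x', y', z')`, where the odd elements are `y` and `y'`. -/
theorem quartic_add {r : 𝕜} (hr : r ≠ 0) {x y z x' y' z' : A}
    (hxy : x' * y = r • (y * x')) (hyx : y' * x = r • (x * y'))
    (hzy : z' * y = r⁻¹ • (y * z')) (hyz : y' * z = r⁻¹ • (z * y'))
    (hxz : x' * z = z * x') (hzx : z' * x = x * z') (hyy : y' * y = -(y * y'))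
    (sy : y * y = 0) (sy' : y' * y' = 0) (c : z * x = x * z) (c' : z' * x' = x' * z')
    (h : x * (y * (z * y)) + z * (y * (x * y)) + y * (x * (y * z)) + y * (z * (y * x)) =
      (r + r⁻¹) • (y * (x * (z * y))))
    (h' : x' * (y' * (z' * y')) + z' * (y' * (x' * y')) + y' * (x' * (y' * z')) +
      y' * (z' * (y' * x')) = (r + r⁻¹) • (y' * (x' * (z' * y')))) :
    (x + x') * ((y + y') * ((z + z') * (y + y'))) + (z + z') * ((y + y') * ((x + x') * (y + y'))) +
      (y + y') * ((x + x') * ((y + y') * (z + z'))) +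
      (y + y') * ((z + z') * ((y + y') * (x + x'))) =
      (r + r⁻¹) • ((y + y') * ((x + x') * ((z + z') * (y + y')))) := by
  have hxy2 : ∀ w, x' * (y * w) = r • (y * (x' * w)) := fun w => by
    rw [← mul_assoc, hxy, smul_mul_assoc, mul_assoc]
  have hyx2 : ∀ w, y' * (x * w) = r • (x * (y' * w)) := fun w => by
    rw [← mul_assoc, hyx, smul_mul_assoc, mul_assoc]
  have hzy2 : ∀ w, z' * (y * w) = r⁻¹ • (y * (z' * w)) := fun w => by
    rw [← mul_assoc, hzy, smul_mul_assoc, mul_assoc]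
  have hyz2 : ∀ w, y' * (z * w) = r⁻¹ • (z * (y' * w)) := fun w => by
    rw [← mul_assoc, hyz, smul_mul_assoc, mul_assoc]
  have hxz2 : ∀ w, x' * (z * w) = z * (x' * w) := fun w => by
    rw [← mul_assoc, hxz, mul_assoc]
  have hzx2 : ∀ w, z' * (x * w) = x * (z' * w) := fun w => by
    rw [← mul_assoc, hzx, mul_assoc]
  have hyy2 : ∀ w, y' * (y * w) = -(y * (y' * w)) := fun w => by
    rw [← mul_assoc, hyy, neg_mul, mul_assoc]
  have sy2 : ∀ w, y * (y * w) = 0 := fun w => by rw [← mul_assoc, sy, zero_mul]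
  have sy2' : ∀ w, y' * (y' * w) = 0 := fun w => by rw [← mul_assoc, sy', zero_mul]
  have c2 : ∀ w, z * (x * w) = x * (z * w) := fun w => by rw [← mul_assoc, c, mul_assoc]
  have c2' : ∀ w, z' * (x' * w) = x' * (z' * w) := fun w => by rw [← mul_assoc, c', mul_assoc]
  have e : x * (y * (z * y)) = (r + r⁻¹) • (y * (x * (z * y))) - z * (y * (x * y)) -
      y * (x * (y * z)) - y * (z * (y * x)) := by rw [← h]; abel
  have e' : x' * (y' * (z' * y')) = (r + r⁻¹) • (y' * (x' * (z' * y'))) - z' * (y' * (x' * y')) -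
      y' * (x' * (y' * z')) - y' * (z' * (y' * x')) := by rw [← h']; abel
  simp only [mul_add, add_mul, mul_neg, mul_zero, smul_zero, mul_smul_comm, smul_smul,
    smul_add, smul_neg, e, e', hxy, hyx, hzy, hyz, hxz, hzx, hyy, sy', c', hxy2, hyx2, hzy2,
    hyz2, hxz2, hzx2, hyy2, sy2, sy2', c2, c2']
  match_scalars <;> field_simp <;> ring

end Sums

/-! ### Neighbours and pairings in the Dynkin diagram -/

section Combinatorics
variable {N : ℕ}

theorem pre_nxt (i : Fin N) : pre (nxt i) = i := by
  have := i.isLt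
  ext
  simp only [pre, nxt]
  split_ifs <;> first | omega | simp_all

theorem pre_ne_self (hN : 2 ≤ N) (i : Fin N) : pre i ≠ i := by
  have := i.isLt
  simp only [pre, ne_eq, Fin.ext_iff]
  split_ifs <;> omega

theorem pre_pre_ne_self (hN : 3 ≤ N) (i : Fin N) : pre (pre i) ≠ i := by
  have := i.isLt
  simp only [pre, ne_eq, Fin.ext_iff]
  split_ifs <;> omega

theorem pre_pre_pre_ne_self (hN : 4 ≤ N) (i : Fin N) : pre (pre (pre i)) ≠ i := by
  have := i.isLt
  simp only [pre, ne_eq, Fin.ext_iff]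
  split_ifs <;> omega

theorem dbar_cases (m : ℕ) (k : Fin N) : dbar m k = 1 ∨ dbar m k = -1 := by
  unfold dbar; split_ifs <;> simp

theorem form_add_right (m : ℕ) (x y z : Wt N) : form m x (y + z) = form m x y + form m x z := by
  simp [form, mul_add, Finset.sum_add_distrib]

theorem form_add_left (m : ℕ) (x y z : Wt N) : form m (x + y) z = form m x z + form m y z := by
  simp [form, mul_add, add_mul, Finset.sum_add_distrib]

theorem form_root_root (m : ℕ) (i j : Fin N) : form m (root i) (root j) =
    dbar m (pre j) * ((if pre j = pre i then 1 else 0) - if pre j = i then 1 else 0) -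
      dbar m j * ((if j = pre i then 1 else 0) - if j = i then 1 else 0) := by
  rw [form_root, form_eps, form_eps]
  simp [root, Pi.single_apply]

theorem form_root_self (hN : 2 ≤ N) (m : ℕ) (i : Fin N) :
    form m (root i) (root i) = dbar m (pre i) + dbar m i := by
  have h := pre_ne_self hN i
  simp [form_root_root, h, h.symm]

theorem form_root_pre (hN : 3 ≤ N) (m : ℕ) (i : Fin N) :
    form m (root i) (root (pre i)) = -dbar m (pre i) := by
  have h := pre_ne_self (by omega) i
  have h' := pre_pre_ne_self hN i
  have h'' := pre_ne_self (by omega) (pre i)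
  simp [form_root_root, h, h', h'']

theorem form_pre_root (hN : 3 ≤ N) (m : ℕ) (i : Fin N) :
    form m (root (pre i)) (root i) = -dbar m (pre i) := by
  have h := pre_ne_self (by omega) i
  have h' := pre_pre_ne_self hN i
  have h'' := pre_ne_self (by omega) (pre i)
  simp [form_root_root, h.symm, h'.symm, h''.symm]

theorem form_root_nxt (hN : 3 ≤ N) (m : ℕ) (i : Fin N) :
    form m (root i) (root (nxt i)) = -dbar m i := by
  have := form_pre_root hN m (nxt i)
  rwa [pre_nxt] at this

theorem form_nxt_root (hN : 3 ≤ N) (m : ℕ) (i : Fin N) :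
    form m (root (nxt i)) (root i) = -dbar m i := by
  have := form_root_pre hN m (nxt i)
  rwa [pre_nxt] at this

theorem pre_ne_nxt (hN : 3 ≤ N) (i : Fin N) : pre i ≠ nxt i := fun h =>
  pre_pre_ne_self hN i (by rw [h, pre_nxt])

theorem form_pre_nxt (hN : 4 ≤ N) (m : ℕ) (i : Fin N) :
    form m (root (pre i)) (root (nxt i)) = 0 := by
  have h1 := (pre_ne_self (by omega) i).symm
  have h2 := (pre_pre_ne_self (by omega) i).symm
  have h3 := (pre_ne_nxt (by omega) i).symm
  have h4 : nxt i ≠ pre (pre i) := fun h => pre_pre_pre_ne_self hN i (by rw [← h, pre_nxt])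
  simp [form_root_root, pre_nxt, h1, h2, h3, h4]

theorem form_nxt_pre (hN : 4 ≤ N) (m : ℕ) (i : Fin N) :
    form m (root (nxt i)) (root (pre i)) = 0 := by
  have h1 := (pre_ne_self (by omega) i)
  have h2 := (pre_pre_ne_self (by omega) i)
  have h3 := (pre_ne_nxt (by omega) i)
  have h4 : pre (pre i) ≠ nxt i := fun h => pre_pre_pre_ne_self hN i (by rw [h, pre_nxt])
  simp [form_root_root, pre_nxt, h1, h2, h3, h4]

/-- Distinct nodes with orthogonal simple roots are not neighbours. -/
theorem pre_ne_of_form_eq_zero (hN : 3 ≤ N) {m : ℕ} {i j : Fin N}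
    (h : form m (root i) (root j) = 0) : pre i ≠ j ∧ pre j ≠ i := by
  constructor
  · rintro rfl
    rw [form_root_pre hN] at h
    rcases dbar_cases m (pre i) with e | e <;> omega
  · rintro rfl
    rw [form_pre_root hN] at h
    rcases dbar_cases m (pre j) with e | e <;> omega

theorem dbar_pre_of_even {m : ℕ} {i : Fin N} (h : npar m i = 0) : dbar m (pre i) = dbar m i := by
  unfold npar vpar at h
  unfold dbar
  split_ifs at h ⊢ <;> rfl

theorem dbar_pre_of_odd {m : ℕ} {i : Fin N} (h : npar m i = 1) : dbar m (pre i) = -dbar m i := by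
  unfold npar vpar at h
  unfold dbar
  split_ifs at h ⊢ <;> rfl

theorem form_root_of_even (hN : 3 ≤ N) {m : ℕ} {i j : Fin N} (h : npar m i = 0)
    (hj : j = pre i ∨ j = nxt i) :
    form m (root i) (root j) = -dbar m i ∧ form m (root j) (root i) = -dbar m i := by
  rcases hj with rfl | rfl
  · rw [form_root_pre hN, form_pre_root hN, dbar_pre_of_even h]; simp
  · rw [form_root_nxt hN, form_nxt_root hN]; simp

theorem npar_neighbours {m n : ℕ} (hm : 2 ≤ m) (hn : 2 ≤ n) {i : Fin (m + n)}
    (h : npar m i = 1) : npar m (pre i) = 0 ∧ npar m (nxt i) = 0 := by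
  have := i.isLt
  rw [npar_eq (by omega) (by omega)] at h
  rw [npar_eq (by omega) (by omega), npar_eq (by omega) (by omega)]
  have h' : i.val = 0 ∨ i.val = m := by
    by_contra h0
    simp [h0] at h
  constructor <;> refine if_neg ?_ <;> simp only [pre, nxt] <;> split_ifs <;>
    first | omega | (simp only [false_or]; omega)

end Combinatorics

/-! ### The Serre relations as identities between words -/

section Words
variable {𝕜 : Type*} [Field 𝕜] {A : Type*} [Ring A] [Algebra 𝕜 A]

theorem qz_add_neg (q : 𝕜ˣ) {z : ℤ} (h : z = 1 ∨ z = -1) :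
    qz q z + (qz q z)⁻¹ = (q : 𝕜) + (q : 𝕜)⁻¹ := by
  rcases h with rfl | rfl <;> simp [qz, add_comm]

/-- The quantum Serre relations for a family `X_i`, with all brackets expanded into words.  Up to
the other relations, they are invariant under `q ↦ q⁻¹`, so that they have the same shape for the
`E_i` and for the `F_i`. -/
structure SerreWords {A : Type*} [Semiring A] [Algebra 𝕜 A] (m : ℕ) {N : ℕ} (q : 𝕜ˣ)
    (X : Fin N → A) : Prop where
  distant : ∀ i j, i ≠ j → form m (root i) (root j) = 0 →
    X i * X j = sgn 𝕜 (npar m i * npar m j) • (X j * X i)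
  square : ∀ i, npar m i = 1 → X i * X i = 0
  cubic : ∀ i j, npar m i = 0 → (j = pre i ∨ j = nxt i) →
    X i * (X i * X j) + X j * (X i * X i) = ((q : 𝕜) + (q : 𝕜)⁻¹) • (X i * (X j * X i))
  quartic : ∀ i, npar m i = 1 →
    X (pre i) * (X i * (X (nxt i) * X i)) + X (nxt i) * (X i * (X (pre i) * X i)) +
        X i * (X (pre i) * (X i * X (nxt i))) + X i * (X (nxt i) * (X i * X (pre i))) =
      ((q : 𝕜) + (q : 𝕜)⁻¹) • (X i * (X (pre i) * (X (nxt i) * X i)))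

theorem SerreElt.map {B : Type*} [Ring B] [Algebra 𝕜 B] {m N : ℕ} {q : 𝕜ˣ} {X : Fin N → A} {x : A}
    (h : SerreElt m q X x) (f : A →ₐ[𝕜] B) : SerreElt m q (fun i => f (X i)) (f x) := by
  cases h with
  | distant i j hij h0 => simpa [sbr] using SerreElt.distant (X := fun i => f (X i)) i j hij h0
  | square i hi => simpa using SerreElt.square (q := q) (X := fun i => f (X i)) i hi
  | cubic i j hi hj => simpa [qbr] using SerreElt.cubic (q := q) (X := fun i => f (X i)) i j hi hj
  | quartic i hi =>
    simpa [sbr, qbr] using SerreElt.quartic (q := q) (X := fun i => f (X i)) i hi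

namespace SerreWords
variable {m n N : ℕ} {q : 𝕜ˣ}

theorem map {A B : Type*} [Semiring A] [Algebra 𝕜 A] [Semiring B] [Algebra 𝕜 B] {X : Fin N → A}
    (h : SerreWords m q X)
    (f : A →ₐ[𝕜] B) : SerreWords m q fun i => f (X i) where
  distant i j hij h0 := by simpa using congrArg f (h.distant i j hij h0)
  square i hi := by simpa using congrArg f (h.square i hi)
  cubic i j hi hj := by simpa only [map_mul, map_add, map_smul] using congrArg f (h.cubic i j hi hj)
  quartic i hi := by
    simpa only [map_mul, map_add, map_smul] using congrArg f (h.quartic i hi)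

theorem zero (m N : ℕ) (q : 𝕜ˣ) : SerreWords m q (fun _ : Fin N => (0 : A)) where
  distant := by simp
  square := by simp
  cubic := by simp
  quartic := by simp

/-- The relations are homogeneous, so they survive multiplication by elements which commute with
each other and with all `X_i`. -/
theorem mul_right {X k : Fin N → A} (h : SerreWords m q X)
    (hk : ∀ i j, k i * k j = k j * k i) (hX : ∀ i j, k i * X j = X j * k i) :
    SerreWords m q fun i => X i * k i := by
  have hX2 : ∀ i j w, k i * (X j * w) = X j * (k i * w) := fun i j w => by
    rw [← mul_assoc, hX, mul_assoc]
  have hk2 : ∀ i j w, k i * (k j * w) = k j * (k i * w) := fun i j w => by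
    rw [← mul_assoc, hk, mul_assoc]
  constructor
  · intro i j hij h0
    have e := congrArg (· * (k i * k j)) (h.distant i j hij h0)
    simp only [mul_assoc, hX2, smul_mul_assoc] at e ⊢
    rw [e, hk i j]
  · intro i hi
    have e := congrArg (· * (k i * k i)) (h.square i hi)
    simpa only [mul_assoc, hX, hX2, zero_mul] using e
  · intro i j hi hj
    have e := congrArg (· * (k i * (k i * k j))) (h.cubic i j hi hj)
    simp only [mul_assoc, add_mul, hX2, smul_mul_assoc] at e ⊢
    simpa only [hk j i, hk2 j i] using e
  · intro i hi
    have e := congrArg (· * (k (pre i) * (k i * (k i * k (nxt i))))) (h.quartic i hi)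
    simp only [mul_assoc, add_mul, hX2, smul_mul_assoc] at e ⊢
    simpa only [hk i (pre i), hk2 i (pre i), hk (nxt i) i, hk2 (nxt i) i, hk (nxt i) (pre i),
      hk2 (nxt i) (pre i)] using e

/-- Two `q`-commuting solutions of the Serre relations add up to a solution.  This is what makes
the Serre relations compatible with the comultiplication. -/
theorem add (hm : 2 ≤ m) (hn : 2 ≤ n) {ε : ℤ} (hε : ε = 1 ∨ ε = -1) {a b : Fin (m + n) → A}
    (ha : SerreWords m q a) (hb : SerreWords m q b)
    (hab : ∀ i j, b i * a j =
      (sgn 𝕜 (npar m i * npar m j) * qz q (ε * form m (root i) (root j))) • (a j * b i)) :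
    SerreWords m q fun i => a i + b i := by
  have hd : ∀ k : Fin (m + n), -(ε * dbar m k) = 1 ∨ -(ε * dbar m k) = -1 := by
    intro k
    rcases hε with rfl | rfl <;> rcases dbar_cases m k with e | e <;> simp [e]
  constructor
  · intro i j hij h0
    have h0' : form m (root j) (root i) = 0 := by rwa [Tilde.form_comm]
    have h2 : sgn 𝕜 (npar m i * npar m j) * sgn 𝕜 (npar m i * npar m j) = 1 := by
      rw [sgn, ← mul_pow]; simp
    simp only [add_mul, mul_add, hab, h0, h0', ha.distant i j hij h0, hb.distant i j hij h0,
      smul_add, smul_smul, mul_comm (npar m j)]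
    simp only [mul_zero, qz, zpow_zero, Units.val_one, mul_one, h2, one_smul]
    abel
  · intro i hi
    have hs : form m (root i) (root i) = 0 := by
      rw [form_root_self (by omega), dbar_pre_of_odd hi, neg_add_cancel]
    simp [add_mul, mul_add, hab, hs, ha.square i hi, hb.square i hi, hi, sgn, qz]
  · intro i j hi hj
    obtain ⟨e1, e2⟩ := form_root_of_even (by omega) hi hj
    have e3 : form m (root i) (root i) = dbar m i + dbar m i := by
      rw [form_root_self (by omega), dbar_pre_of_even hi]
    have hc := qz_add_neg q (hd i)
    have h1 := ha.cubic i j hi hj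
    have h2 := hb.cubic i j hi hj
    rw [← hc] at h1 h2 ⊢
    refine cubic_add (qz_ne_zero q _) ?_ ?_ ?_ h1 h2
    · rw [hab, e3, hi, ← qz_neg, ← Tilde.qz_add]
      simp only [sgn, zero_mul, pow_zero, one_mul]
      congr 2; ring
    · rw [hab, e1, hi]
      simp only [sgn, zero_mul, pow_zero, one_mul]
      congr 2; ring
    · rw [hab, e2, hi]
      simp only [sgn, mul_zero, pow_zero, one_mul]
      congr 2; ring
  · intro i hi
    obtain ⟨p1, p2⟩ := npar_neighbours hm hn hi
    have hs : form m (root i) (root i) = 0 := by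
      rw [form_root_self (by omega), dbar_pre_of_odd hi, neg_add_cancel]
    have hc := qz_add_neg q (hd (pre i))
    have h1 := ha.quartic i hi
    have h2 := hb.quartic i hi
    have hpn := form_pre_nxt (by omega) m i
    have hnp := form_nxt_pre (by omega) m i
    have hne : nxt i ≠ pre i := (pre_ne_nxt (by omega) i).symm
    have hdd : dbar m i = -dbar m (pre i) := by rw [dbar_pre_of_odd hi, neg_neg]
    rw [← hc] at h1 h2 ⊢
    refine quartic_add (qz_ne_zero q _) ?_ ?_ ?_ ?_ ?_ ?_ ?_ (ha.square i hi) (hb.square i hi)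
      ?_ ?_ h1 h2
    · rw [hab, form_pre_root (by omega), p1]
      simp [sgn]
    · rw [hab, form_root_pre (by omega), p1]
      simp [sgn]
    · rw [hab, form_nxt_root (by omega), p2, hdd, ← qz_neg]
      simp [sgn]
    · rw [hab, form_root_nxt (by omega), p2, hdd, ← qz_neg]
      simp [sgn]
    · rw [hab, hpn, p1]
      simp [sgn, qz]
    · rw [hab, hnp, p1]
      simp [sgn, qz]
    · rw [hab, hs, hi]
      simp [sgn, qz]
    · rw [ha.distant _ _ hne hnp, p1]
      simp [sgn]
    · rw [hb.distant _ _ hne hnp, p1]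
      simp [sgn]

theorem serreElt_eq_zero (hm : 2 ≤ m) (hn : 2 ≤ n) {X : Fin (m + n) → A} (h : SerreWords m q X)
    {x : A} (hx : SerreElt m q X x) : x = 0 := by
  cases hx with
  | distant i j hij h0 =>
    rw [sbr, h.distant i j hij h0, sub_self]
  | square i hi => exact h.square i hi
  | cubic i j hi hj =>
    obtain ⟨e1, e2⟩ := form_root_of_even (by omega) hi hj
    have e3 : form m (root i) (root i) = dbar m i + dbar m i := by
      rw [form_root_self (by omega), dbar_pre_of_even hi]
    have hw := h.cubic i j hi hj
    rw [← qz_add_neg q (dbar_cases m i)] at hw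
    have hw' := eq_sub_of_add_eq hw
    have hq := qz_ne_zero q (dbar m i)
    simp only [qbr, form_add_right, e1, e3, hi, sgn, zero_mul, pow_zero, one_mul, neg_neg,
      neg_add_rev, Tilde.qz_add, qz_neg, mul_sub, sub_mul, mul_assoc, mul_smul_comm, smul_mul_assoc,
      hw', smul_sub, smul_smul]
    match_scalars <;> field_simp <;> ring
  | quartic i hi =>
    obtain ⟨p1, p2⟩ := npar_neighbours hm hn hi
    have hdd : dbar m (pre i) = -dbar m i := dbar_pre_of_odd hi
    have hpn := form_pre_nxt (by omega) m i
    have hnp := form_nxt_pre (by omega) m i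
    have hne : nxt i ≠ pre i := (pre_ne_nxt (by omega) i).symm
    have c : X (nxt i) * X (pre i) = X (pre i) * X (nxt i) := by
      rw [h.distant _ _ hne hnp, p1]; simp [sgn]
    have c2 : ∀ w, X (nxt i) * (X (pre i) * w) = X (pre i) * (X (nxt i) * w) := fun w => by
      rw [← mul_assoc, c, mul_assoc]
    have s := h.square i hi
    have s2 : ∀ w, X i * (X i * w) = 0 := fun w => by rw [← mul_assoc, s, zero_mul]
    have hw := h.quartic i hi
    rw [← qz_add_neg q (dbar_cases m i)] at hw
    have hw' : X (pre i) * (X i * (X (nxt i) * X i)) = _ - _ - _ - _ :=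
      eq_sub_of_add_eq (eq_sub_of_add_eq (eq_sub_of_add_eq hw))
    have hq := qz_ne_zero q (dbar m i)
    have e1 := form_pre_root (by omega) m i
    have e2 := form_root_nxt (by omega) m i
    simp only [sbr, qbr, form_add_left, e1, e2, hpn, hi, p1, p2, hdd, sgn, mul_zero,
      pow_zero, zero_add, add_zero, pow_one, one_mul, mul_one, neg_neg, qz_neg, mul_sub, sub_mul,
      mul_assoc, mul_smul_comm, smul_mul_assoc, smul_sub, smul_smul, s, s2, c2, hw', smul_zero]
    match_scalars <;> field_simp <;> ring

/-- The relations hold for matrix units `E_{i-1, i}`, since all words which occur vanish. -/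
theorem of_mul_eq_zero (hN : 4 ≤ N) (X : Fin N → A) (h : ∀ i j, pre j ≠ i → X i * X j = 0) :
    SerreWords m q X := by
  have h2 : ∀ i j, pre j ≠ i → ∀ w, X i * (X j * w) = 0 := fun i j hij w => by
    rw [← mul_assoc, h i j hij, zero_mul]
  constructor
  · intro i j hij h0
    obtain ⟨h3, h4⟩ := pre_ne_of_form_eq_zero (by omega) h0
    rw [h i j h4, h j i h3, smul_zero]
  · exact fun i _ => h i i (pre_ne_self (by omega) i)
  · intro i j _ hj
    have h3 := pre_ne_self (by omega) i
    rw [h2 i i h3, h i i h3]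
    rcases hj with rfl | rfl
    · rw [h2 _ _ (pre_pre_ne_self (by omega) i)]; simp
    · rw [h (nxt i) i (pre_ne_nxt (by omega) i)]; simp
  · intro i _
    rw [h (nxt i) i (pre_ne_nxt (by omega) i), h2 (nxt i) i (pre_ne_nxt (by omega) i),
      h2 i (pre i) (pre_pre_ne_self (by omega) i), h i (pre i) (pre_pre_ne_self (by omega) i)]
    simp

/-- The version of `of_mul_eq_zero` for matrix units `E_{i, i-1}`. -/
theorem of_mul_eq_zero' (hN : 4 ≤ N) (X : Fin N → A) (h : ∀ i j, pre i ≠ j → X i * X j = 0) :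
    SerreWords m q X := by
  have h2 : ∀ i j, pre i ≠ j → ∀ w, X i * (X j * w) = 0 := fun i j hij w => by
    rw [← mul_assoc, h i j hij, zero_mul]
  constructor
  · intro i j hij h0
    obtain ⟨h3, h4⟩ := pre_ne_of_form_eq_zero (by omega) h0
    rw [h i j h3, h j i h4, smul_zero]
  · exact fun i _ => h i i (pre_ne_self (by omega) i)
  · intro i j _ hj
    have h3 := pre_ne_self (by omega) i
    rw [h2 i i h3, h i i h3]
    rcases hj with rfl | rfl
    · rw [h (pre i) i (pre_pre_ne_self (by omega) i)]; simp
    · rw [h2 _ _ (pre_ne_nxt (by omega) i)]; simp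
  · intro i _
    have h4 : pre (pre i) ≠ nxt i := fun h => pre_pre_pre_ne_self hN i (by rw [h, pre_nxt])
    rw [h2 _ _ (pre_pre_ne_self (by omega) i), h (pre i) i (pre_pre_ne_self (by omega) i),
      h2 (pre i) i (pre_pre_ne_self (by omega) i), h2 i (nxt i) (pre_ne_nxt (by omega) i),
      h2 (pre i) (nxt i) h4]
    simp

end SerreWords

/-! ### The Serre relations on tensor products of evaluation modules -/

section TensorSerre
variable {m n : ℕ} {q : 𝕜ˣ}

theorem serreWords_evalRep_E (hm : 2 ≤ m) (hn : 2 ≤ n) (a : 𝕜ˣ) :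
    SerreWords m q fun i => evalRep m n q a (Tilde.E q i) := by
  have e : ∀ i, Tilde.lift (eval_relations m n q a) (Tilde.E q i) = evalE m n q a i := fun i => by
    simp [Tilde.lift, Tilde.E, Tilde.of, Tilde.genMap]
  suffices h : SerreWords m q (evalE m n q a) by
    have h' := h.map (Matrix.toLinAlgEquiv' (R := 𝕜) (n := Fin (m + n))).toAlgHom
    simp only [← e] at h'
    exact h'
  refine SerreWords.of_mul_eq_zero (by omega) _ fun i j hij => ?_
  obtain ⟨u, -, h, -⟩ := eval_aux m n q a i
  obtain ⟨v, -, h', -⟩ := eval_aux m n q a j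
  rw [h, h', Matrix.single_mul_single_of_ne]
  exact hij.symm

theorem serreWords_evalRep_F (hm : 2 ≤ m) (hn : 2 ≤ n) (a : 𝕜ˣ) :
    SerreWords m q fun i => evalRep m n q a (Tilde.F q i) := by
  have e : ∀ i, Tilde.lift (eval_relations m n q a) (Tilde.F q i) = evalF m n q a i := fun i => by
    simp [Tilde.lift, Tilde.F, Tilde.of, Tilde.genMap]
  suffices h : SerreWords m q (evalF m n q a) by
    have h' := h.map (Matrix.toLinAlgEquiv' (R := 𝕜) (n := Fin (m + n))).toAlgHom
    simp only [← e] at h'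
    exact h'
  refine SerreWords.of_mul_eq_zero' (by omega) _ fun i j hij => ?_
  obtain ⟨u, -, -, h⟩ := eval_aux m n q a i
  obtain ⟨v, -, -, h'⟩ := eval_aux m n q a j
  rw [h, h', Matrix.single_mul_single_of_ne]
  exact hij

theorem comul_E (i : Fin (m + n)) : Tilde.comul m n q (Tilde.E q i) =
    Tilde.E q i ⊗ₜ 1 + (Tilde.K q (rootL i) * Tilde.sigPow q i) ⊗ₜ Tilde.E q i := by
  simp [Tilde.comul, Tilde.lift, Tilde.E, Tilde.of, Tilde.genMap]

theorem comul_F (i : Fin (m + n)) : Tilde.comul m n q (Tilde.F q i) =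
    Tilde.F q i ⊗ₜ Tilde.K q (-rootL i) + Tilde.sigPow q i ⊗ₜ Tilde.F q i := by
  simp [Tilde.comul, Tilde.lift, Tilde.F, Tilde.of, Tilde.genMap]

theorem comul_K (γ : lattice m n) : Tilde.comul m n q (Tilde.K q γ) =
    Tilde.K q γ ⊗ₜ Tilde.K q γ := by
  simp [Tilde.comul, Tilde.lift, Tilde.K, Tilde.of, Tilde.genMap]

theorem comul_sig : Tilde.comul m n q (Tilde.sig m n q) =
    Tilde.sig m n q ⊗ₜ Tilde.sig m n q := by
  simp [Tilde.comul, Tilde.lift, Tilde.sig, Tilde.of, Tilde.genMap]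

variable {B C : Type*} [Ring B] [Algebra 𝕜 B] [Ring C] [Algebra 𝕜 C]

/-- If the Serre relations hold under `φ` and `ψ`, they hold under `(φ ⊗ ψ) ∘ Δ`: the two summands
of `Δ E_i` are solutions which `q`-commute with each other. -/
theorem serreWords_comul_E (hm : 2 ≤ m) (hn : 2 ≤ n) (φ : Tilde m n q →ₐ[𝕜] B)
    (ψ : Tilde m n q →ₐ[𝕜] C) (hφ : SerreWords m q fun i => φ (Tilde.E q i))
    (hψ : SerreWords m q fun i => ψ (Tilde.E q i)) :
    SerreWords m q fun i =>
      Algebra.TensorProduct.map φ ψ (Tilde.comul m n q (Tilde.E q i)) := by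
  have hR := Tilde.relations m n q
  have h1 := hφ.map (Algebra.TensorProduct.includeLeft (R := 𝕜) (S := 𝕜) (A := B) (B := C))
  have h2 := (hψ.map (Algebra.TensorProduct.includeRight (R := 𝕜) (A := B) (B := C))).mul_right
    (k := fun i => φ (Tilde.K q (rootL i) * Tilde.sigPow q i) ⊗ₜ 1)
    (fun i j => by
      simp only [Algebra.TensorProduct.tmul_mul_tmul, ← map_mul, mul_one]
      congr 2
      rw [mul_assoc, ← mul_assoc (Tilde.sigPow q i), Tilde.sigPow_K, mul_assoc (Tilde.K q _),
        ← mul_assoc, Tilde.K_comm, Tilde.sigPow_sigPow, mul_assoc, mul_assoc,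
        ← mul_assoc (Tilde.sigPow q j), Tilde.sigPow_K]
      simp only [mul_assoc])
    (fun i j => by simp [Algebra.TensorProduct.tmul_mul_tmul])
  have hs := SerreWords.add hm hn (ε := 1) (Or.inl rfl) h1 h2 ?_
  · simpa [comul_E, Algebra.TensorProduct.tmul_mul_tmul] using hs
  · intro i j
    simp only [Algebra.TensorProduct.includeLeft_apply, Algebra.TensorProduct.includeRight_apply,
      Algebra.TensorProduct.tmul_mul_tmul, ← map_mul, mul_one, one_mul]
    rw [mul_assoc, Tilde.sigPow_E, mul_smul_comm, ← mul_assoc, hR.K_E, smul_mul_assoc, smul_smul,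
      map_smul, TensorProduct.smul_tmul', mul_assoc]
    rfl

theorem serreWords_comul_F (hm : 2 ≤ m) (hn : 2 ≤ n) (φ : Tilde m n q →ₐ[𝕜] B)
    (ψ : Tilde m n q →ₐ[𝕜] C) (hφ : SerreWords m q fun i => φ (Tilde.F q i))
    (hψ : SerreWords m q fun i => ψ (Tilde.F q i)) :
    SerreWords m q fun i =>
      Algebra.TensorProduct.map φ ψ (Tilde.comul m n q (Tilde.F q i)) := by
  have hR := Tilde.relations m n q
  have h1 := (hφ.map (Algebra.TensorProduct.includeLeft (R := 𝕜) (S := 𝕜) (A := B)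
    (B := C))).mul_right (k := fun i => 1 ⊗ₜ ψ (Tilde.K q (-rootL i)))
    (fun i j => by
      simp only [Algebra.TensorProduct.tmul_mul_tmul, ← map_mul, mul_one, Tilde.K_comm])
    (fun i j => by simp [Algebra.TensorProduct.tmul_mul_tmul])
  have h2 := (hψ.map (Algebra.TensorProduct.includeRight (R := 𝕜) (A := B) (B := C))).mul_right
    (k := fun i => φ (Tilde.sigPow q i) ⊗ₜ 1)
    (fun i j => by
      simp only [Algebra.TensorProduct.tmul_mul_tmul, ← map_mul, mul_one, Tilde.sigPow_sigPow i j])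
    (fun i j => by simp [Algebra.TensorProduct.tmul_mul_tmul])
  have hs := SerreWords.add hm hn (ε := -1) (Or.inr rfl) h1 h2 ?_
  · simpa [comul_F, Algebra.TensorProduct.tmul_mul_tmul] using hs
  · intro i j
    have e : Tilde.F q i * Tilde.K q (-rootL j) =
        qz q (-form m (root i) (root j)) • (Tilde.K q (-rootL j) * Tilde.F q i) := by
      have : form m (-rootL j : lattice m n).1 (root i) = -form m (root i) (root j) := by
        rw [Tilde.form_comm (root i)]; exact Tilde.form_neg _ _
      rw [hR.K_F, this, smul_smul, ← Tilde.qz_add, neg_neg, neg_add_cancel]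
      simp [qz]
    simp only [Algebra.TensorProduct.includeLeft_apply, Algebra.TensorProduct.includeRight_apply,
      Algebra.TensorProduct.tmul_mul_tmul, ← map_mul, mul_one, one_mul]
    rw [Tilde.sigPow_F, e, map_smul, map_smul, TensorProduct.smul_tmul_smul, neg_one_mul]

/-- A representation of `Ũ` in which the quantum Serre relations hold. -/
def SerreHom {B : Type*} [Semiring B] [Algebra 𝕜 B] (φ : Tilde m n q →ₐ[𝕜] B) : Prop :=
  (SerreWords m q fun i => φ (Tilde.E q i)) ∧ SerreWords m q fun i => φ (Tilde.F q i)

namespace SerreHom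

theorem comp {B C : Type*} [Semiring B] [Algebra 𝕜 B] [Semiring C] [Algebra 𝕜 C]
    {φ : Tilde m n q →ₐ[𝕜] B} (h : SerreHom φ) (f : B →ₐ[𝕜] C) : SerreHom (f.comp φ) :=
  ⟨h.1.map f, h.2.map f⟩

theorem evalRep (hm : 2 ≤ m) (hn : 2 ≤ n) (a : 𝕜ˣ) : SerreHom (evalRep m n q a) :=
  ⟨serreWords_evalRep_E hm hn a, serreWords_evalRep_F hm hn a⟩

theorem comul (hm : 2 ≤ m) (hn : 2 ≤ n) {φ : Tilde m n q →ₐ[𝕜] B} {ψ : Tilde m n q →ₐ[𝕜] C}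
    (hφ : SerreHom φ) (hψ : SerreHom ψ) :
    SerreHom ((Algebra.TensorProduct.map φ ψ).comp (Tilde.comul m n q)) :=
  ⟨serreWords_comul_E hm hn φ ψ hφ.1 hψ.1, serreWords_comul_F hm hn φ ψ hφ.2 hψ.2⟩

theorem counit : SerreHom (Tilde.counit m n q) := by
  have h1 : ∀ i, Tilde.counit m n q (Tilde.E q i) = 0 := fun i => by
    simp [Tilde.counit, Tilde.lift, Tilde.E, Tilde.of, Tilde.genMap]
  have h2 : ∀ i, Tilde.counit m n q (Tilde.F q i) = 0 := fun i => by
    simp [Tilde.counit, Tilde.lift, Tilde.F, Tilde.of, Tilde.genMap]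
  simp only [SerreHom, h1, h2]
  exact ⟨.zero _ _ _, .zero _ _ _⟩

theorem tensorRep (hm : 2 ≤ m) (hn : 2 ≤ n) (d : ℕ) (a : Fin d → 𝕜ˣ) :
    SerreHom (tensorRep m n q d a) := by
  induction d with
  | zero => exact SerreHom.counit.comp _
  | succ d ih =>
    have h1 := SerreHom.comul (B := Module.End 𝕜 (VT 𝕜 m n d)) (C := Module.End 𝕜 (V 𝕜 m n))
      (φ := QSuper.tensorRep m n q d (Fin.init a)) (ψ := QSuper.evalRep m n q (a (Fin.last d)))
      hm hn (ih _) (.evalRep hm hn _)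
    have h2 := SerreHom.comp (B := Module.End 𝕜 (VT 𝕜 m n d) ⊗[𝕜] Module.End 𝕜 (V 𝕜 m n))
      (C := Module.End 𝕜 (VT 𝕜 m n d ⊗[𝕜] V 𝕜 m n)) h1
      (Module.endTensorEndAlgHom (R := 𝕜) (S := 𝕜) (A := 𝕜))
    exact SerreHom.comp (B := Module.End 𝕜 (VT 𝕜 m n d ⊗[𝕜] V 𝕜 m n))
      (C := Module.End 𝕜 (VT 𝕜 m n (d + 1))) h2
      (LinearEquiv.conjAlgEquiv 𝕜 (snocEquiv 𝕜 m n d)).toAlgHom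

theorem eq_of_serreRel (hm : 2 ≤ m) (hn : 2 ≤ n) {φ : Tilde m n q →ₐ[𝕜] B} (h : SerreHom φ)
    {x y : Tilde m n q} (hxy : SerreRel m n q x y) : φ x = φ y := by
  cases hxy with
  | E hx => rw [map_zero]; exact h.1.serreElt_eq_zero hm hn (hx.map φ)
  | F hx => rw [map_zero]; exact h.2.serreElt_eq_zero hm hn (hx.map φ)

end SerreHom

/-- The action of `U` on `V(a_1) ⊗ ⋯ ⊗ V(a_d)`. -/
def tensorRepU (hm : 2 ≤ m) (hn : 2 ≤ n) (d : ℕ) (a : Fin d → 𝕜ˣ) :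
    U m n q →ₐ[𝕜] Module.End 𝕜 (VT 𝕜 m n d) :=
  RingQuot.liftAlgHom 𝕜 (s := SerreRel m n q) ⟨tensorRep m n q d a, fun _ _ h =>
    SerreHom.eq_of_serreRel (B := Module.End 𝕜 (VT 𝕜 m n d)) (φ := tensorRep m n q d a) hm hn
      (.tensorRep hm hn d a) h⟩

theorem tensorRepU_comp_proj (hm : 2 ≤ m) (hn : 2 ≤ n) (d : ℕ) (a : Fin d → 𝕜ˣ) :
    (tensorRepU hm hn d a).comp (U.proj m n q) = tensorRep m n q d a :=
  AlgHom.ext fun _ => RingQuot.liftAlgHom_mkAlgHom_apply ..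

/-- Homomorphisms out of `U` are determined by the generators. -/
theorem U.hom_ext {B : Type*} [Semiring B] [Algebra 𝕜 B] {f g : U m n q →ₐ[𝕜] B}
    (hs : f (U.proj m n q (Tilde.sig m n q)) = g (U.proj m n q (Tilde.sig m n q)))
    (hK : ∀ γ, f (U.proj m n q (Tilde.K q γ)) = g (U.proj m n q (Tilde.K q γ)))
    (hE : ∀ i, f (U.proj m n q (Tilde.E q i)) = g (U.proj m n q (Tilde.E q i)))
    (hF : ∀ i, f (U.proj m n q (Tilde.F q i)) = g (U.proj m n q (Tilde.F q i))) : f = g := by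
  refine RingQuot.ringQuot_ext' _ _ _ (RingQuot.ringQuot_ext' _ _ _ (FreeAlgebra.hom_ext ?_))
  ext x
  cases x with
  | sig => exact hs
  | K γ => exact hK γ
  | E i => exact hE i
  | F i => exact hF i

end TensorSerre
end Words

/-! ### The R-matrix on two tensor factors -/

section TwoFactors
variable {𝕜 : Type*} [Field 𝕜] (m n : ℕ) (q : 𝕜ˣ)

/-- The operator `Ř` on `V ⊗ V`. -/
def R2 : V 𝕜 m n ⊗[𝕜] V 𝕜 m n →ₗ[𝕜] V 𝕜 m n ⊗[𝕜] V 𝕜 m n :=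
  (∑ a : Fin (m + n), (sgn 𝕜 (vpar m a) * qz q (dbar m a)) •
      TensorProduct.map (unit 𝕜 m n a a) (unit 𝕜 m n a a)) +
    (∑ a : Fin (m + n), ∑ b : Fin (m + n), if a = b then 0 else
      sgn 𝕜 (vpar m a * vpar m b) • TensorProduct.map (unit 𝕜 m n b a) (unit 𝕜 m n a b)) +
    ∑ a : Fin (m + n), ∑ b : Fin (m + n), if a < b then
      (qz q 1 - qz q (-1)) • TensorProduct.map (unit 𝕜 m n a a) (unit 𝕜 m n b b) else 0

/-- The basis vector `ε̄_a ⊗ ε̄_b` of `V ⊗ V`. -/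
def e2 (𝕜 : Type*) [Field 𝕜] {N : ℕ} (a b : Fin N) : (Fin N → 𝕜) ⊗[𝕜] (Fin N → 𝕜) :=
  Pi.single a 1 ⊗ₜ Pi.single b 1

theorem lin2_ext {N : ℕ} {W : Type*} [AddCommMonoid W] [Module 𝕜 W]
    {X Y : (Fin N → 𝕜) ⊗[𝕜] (Fin N → 𝕜) →ₗ[𝕜] W}
    (h : ∀ a b, X (e2 𝕜 a b) = Y (e2 𝕜 a b)) : X = Y := by
  refine ((Pi.basisFun 𝕜 (Fin N)).tensorProduct (Pi.basisFun 𝕜 (Fin N))).ext fun ⟨a, b⟩ => ?_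
  simpa [Module.Basis.tensorProduct_apply, e2] using h a b

theorem map_unit_e2 (a b a' b' x y : Fin (m + n)) :
    TensorProduct.map (unit 𝕜 m n a b) (unit 𝕜 m n a' b') (e2 𝕜 x y) =
      if b = x ∧ b' = y then e2 𝕜 a a' else 0 := by
  rw [e2, TensorProduct.map_tmul, unit_single, unit_single]
  by_cases h1 : b = x <;> by_cases h2 : b' = y <;> simp [h1, h2, e2]

theorem R2_e2 (x y : Fin (m + n)) : R2 m n q (e2 𝕜 x y) =
    (if x = y then (sgn 𝕜 (vpar m x) * qz q (dbar m x)) • e2 𝕜 x y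
      else sgn 𝕜 (vpar m x * vpar m y) • e2 𝕜 y x) +
      if x < y then (qz q 1 - qz q (-1)) • e2 𝕜 x y else 0 := by
  simp only [R2, LinearMap.add_apply, LinearMap.sum_apply,
    apply_ite (fun f : V 𝕜 m n ⊗[𝕜] V 𝕜 m n →ₗ[𝕜] V 𝕜 m n ⊗[𝕜] V 𝕜 m n => f (e2 𝕜 x y)),
    LinearMap.zero_apply, LinearMap.smul_apply, map_unit_e2]
  congr 1
  · rw [Finset.sum_eq_single x, Finset.sum_eq_single x, Finset.sum_eq_single y]
    · by_cases h : x = y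
      · simp [h]
      · simp [h]
    · intro b _ hb; simp [hb]
    · simp
    · intro a _ ha; simp [ha]
    · simp
    · intro a _ ha; simp [ha]
    · simp
  · rw [Finset.sum_eq_single x, Finset.sum_eq_single y]
    · simp
    · intro b _ hb; simp [hb]
    · simp
    · intro a _ ha; simp [ha]
    · simp

variable {m n q}

/-- `D` acts diagonally on the standard basis, with eigenvalues `κ`. -/
def IsDiag {N : ℕ} (D : Module.End 𝕜 (Fin N → 𝕜)) (κ : Fin N → 𝕜) : Prop :=
  ∀ a, D (Pi.single a 1) = κ a • Pi.single a 1

/-- `X` maps `ε̄_x` to `w ε̄_y` and all other basis vectors to zero. -/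
def IsArrow {N : ℕ} (X : Module.End 𝕜 (Fin N → 𝕜)) (x y : Fin N) (w : 𝕜) : Prop :=
  ∀ a, X (Pi.single a 1) = if a = x then w • Pi.single y 1 else 0

theorem IsDiag.map_e2 {N : ℕ} {D D' : Module.End 𝕜 (Fin N → 𝕜)} {κ κ' : Fin N → 𝕜}
    (h : IsDiag D κ) (h' : IsDiag D' κ') (a b : Fin N) :
    TensorProduct.map D D' (e2 𝕜 a b) = (κ a * κ' b) • e2 𝕜 a b := by
  rw [e2, TensorProduct.map_tmul, h, h', TensorProduct.smul_tmul_smul]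

theorem IsArrow.map_e2_left {N : ℕ} {X D : Module.End 𝕜 (Fin N → 𝕜)} {κ : Fin N → 𝕜} {x y : Fin N}
    {w : 𝕜} (h : IsArrow X x y w) (h' : IsDiag D κ) (a b : Fin N) :
    TensorProduct.map X D (e2 𝕜 a b) = if a = x then (w * κ b) • e2 𝕜 y b else 0 := by
  rw [e2, TensorProduct.map_tmul, h, h']
  split_ifs
  · rw [TensorProduct.smul_tmul_smul, e2]
  · rw [TensorProduct.zero_tmul]

theorem IsArrow.map_e2_right {N : ℕ} {X D : Module.End 𝕜 (Fin N → 𝕜)} {κ : Fin N → 𝕜} {x y : Fin N}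
    {w : 𝕜} (h : IsArrow X x y w) (h' : IsDiag D κ) (a b : Fin N) :
    TensorProduct.map D X (e2 𝕜 a b) = if b = x then (κ a * w) • e2 𝕜 a y else 0 := by
  rw [e2, TensorProduct.map_tmul, h, h']
  split_ifs
  · rw [TensorProduct.smul_tmul_smul, e2]
  · rw [TensorProduct.tmul_zero]

theorem R2_diag {D : Module.End 𝕜 (V 𝕜 m n)} {κ : Fin (m + n) → 𝕜} (h : IsDiag D κ) :
    R2 m n q ∘ₗ TensorProduct.map D D = TensorProduct.map D D ∘ₗ R2 m n q := by
  refine lin2_ext fun a b => ?_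
  simp only [LinearMap.comp_apply, h.map_e2 h, map_smul, R2_e2, map_add]
  by_cases h1 : a = b
  · subst h1
    simp only [lt_irrefl, if_true, if_false, add_zero, map_smul, h.map_e2 h, map_zero]
    module
  · by_cases h2 : a < b
    · simp only [h1, h2, if_true, if_false, map_smul, h.map_e2 h]
      module
    · simp only [h1, h2, if_false, map_smul, h.map_e2 h, map_zero, add_zero]
      module

/-- The eigenvalue of `Ř` on `ε̄_a ⊗ ε̄_a`. -/
def tau (m : ℕ) {n : ℕ} (q : 𝕜ˣ) (a : Fin (m + n)) : 𝕜 := sgn 𝕜 (vpar m a) * qz q (dbar m a)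

/-- The sign by which `Ř` exchanges `ε̄_a` and `ε̄_b`. -/
def sg (𝕜 : Type*) [Field 𝕜] (m : ℕ) {n : ℕ} (a b : Fin (m + n)) : 𝕜 := sgn 𝕜 (vpar m a * vpar m b)

theorem tau_ne_zero (a : Fin (m + n)) : tau m q a ≠ 0 := by
  rcases eigen_cases (n := n) m q a with h | h <;> simp [tau, h]

theorem qz_sub (q : 𝕜ˣ) : qz q 1 - qz q (-1) = (q : 𝕜) - (q : 𝕜)⁻¹ := by simp [qz]

theorem tau_sub_inv (a : Fin (m + n)) : qz q 1 - qz q (-1) = tau m q a - (tau m q a)⁻¹ := by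
  rw [qz_sub]
  rcases eigen_cases (n := n) m q a with h | h <;> (simp [tau, h]; try ring)

theorem sg_comm (a b : Fin (m + n)) : sg 𝕜 m a b = sg 𝕜 m b a := by rw [sg, mul_comm]; rfl

theorem sg_cases (a b : Fin (m + n)) : sg 𝕜 m a b = 1 ∨ sg 𝕜 m a b = -1 := sgn_cases _

theorem R2_e2_self (x : Fin (m + n)) : R2 m n q (e2 𝕜 x x) = tau m q x • e2 𝕜 x x := by
  simp [R2_e2, tau]

theorem R2_e2_lt {x y : Fin (m + n)} (h : x < y) : R2 m n q (e2 𝕜 x y) =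
    sg 𝕜 m x y • e2 𝕜 y x + (qz q 1 - qz q (-1)) • e2 𝕜 x y := by
  simp [R2_e2, sg, h, h.ne]

theorem R2_e2_gt {x y : Fin (m + n)} (h : y < x) : R2 m n q (e2 𝕜 x y) =
    sg 𝕜 m x y • e2 𝕜 y x := by
  simp [R2_e2, sg, h.ne', h.not_gt]

section Adjacent
variable {p i : Fin (m + n)} {X l r : Module.End 𝕜 (V 𝕜 m n)} {lv rv : Fin (m + n) → 𝕜} {w : 𝕜}

/-- `Ř` commutes with the coproduct of a raising operator between neighbouring basis vectors. -/
theorem R2_raise (hpi : p.val + 1 = i.val) (hX : IsArrow X i p w) (hl : IsDiag l lv)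
    (hr : IsDiag r rv) (hp : lv p = sg 𝕜 m p i * tau m q p * rv p)
    (hi : lv i = sg 𝕜 m p i * (tau m q i)⁻¹ * rv i)
    (h : ∀ b, b ≠ p → b ≠ i → lv b = sg 𝕜 m p b * sg 𝕜 m i b * rv b) :
    R2 m n q ∘ₗ (TensorProduct.map X r + TensorProduct.map l X) =
      (TensorProduct.map X r + TensorProduct.map l X) ∘ₗ R2 m n q := by
  have tp := tau_ne_zero (q := q) p
  have ti := tau_ne_zero (q := q) i
  have cp := tau_sub_inv (q := q) p
  have ci := tau_sub_inv (q := q) i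
  have hlt : p < i := by simp only [Fin.lt_def]; omega
  refine lin2_ext fun a b => ?_
  simp only [LinearMap.comp_apply, LinearMap.add_apply, hX.map_e2_left hr, hX.map_e2_right hl]
  by_cases ha : a = i
  · subst ha
    rcases lt_trichotomy b p with hb | rfl | hb
    · have hba : b < a := hb.trans hlt
      have e := h b hb.ne hba.ne
      simp only [if_true, if_false, hba.ne, add_zero, map_smul, R2_e2_gt hb, R2_e2_gt hba,
        hX.map_e2_left hr, hX.map_e2_right hl, zero_add, e,
        smul_smul, smul_zero]
      rcases sg_cases (𝕜 := 𝕜) p b with e1 | e1 <;> rcases sg_cases (𝕜 := 𝕜) a b with e2 | e2 <;>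
        simp [e1, e2, mul_comm w]
    · simp only [if_true, if_false, hlt.ne, add_zero, map_smul, R2_e2_self, R2_e2_gt hlt,
        hX.map_e2_left hr, hX.map_e2_right hl, zero_add, hp,
        smul_smul, smul_zero, sg_comm a b]
      rcases sg_cases (𝕜 := 𝕜) b a with e1 | e1 <;> simp [e1] <;> ring_nf
    · by_cases hba : b = a
      · subst hba
        simp only [if_true, map_add, map_smul, R2_e2_self, R2_e2_gt hlt, R2_e2_lt hlt,
          hX.map_e2_left hr, hX.map_e2_right hl, hi, smul_add, smul_smul,
          sg_comm b p, ci]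
        rcases sg_cases (𝕜 := 𝕜) p b with e1 | e1 <;> simp only [e1] <;> match_scalars <;>
          field_simp <;> ring
      · have hab : a < b := by simp only [Fin.lt_def, Fin.ext_iff] at *; omega
        have e := h b hb.ne' hba
        simp only [if_true, if_false, hba, add_zero, map_smul, R2_e2_lt hb, R2_e2_lt hab,
          hX.map_e2_left hr, hX.map_e2_right hl, map_add, zero_add, e,
          smul_smul, smul_add, smul_zero]
        rcases sg_cases (𝕜 := 𝕜) p b with e1 | e1 <;> rcases sg_cases (𝕜 := 𝕜) a b with e2 | e2 <;>
          simp only [e1, e2] <;> module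
  · by_cases hb : b = i
    · subst hb
      rcases lt_trichotomy a p with hap | rfl | hap
      · have hab : a < b := hap.trans hlt
        have e := h a hap.ne ha
        simp only [if_true, if_false, ha, add_zero, map_smul, R2_e2_lt hap, R2_e2_lt hab,
          hX.map_e2_left hr, hX.map_e2_right hl, map_add, zero_add, e,
          smul_smul, smul_add, smul_zero, sg_comm p a, sg_comm b a]
        rcases sg_cases (𝕜 := 𝕜) a p with e1 | e1 <;> rcases sg_cases (𝕜 := 𝕜) a b with e2 | e2 <;>
          simp only [e1, e2] <;> module
      · simp only [if_true, if_false, ha, add_zero, map_smul, R2_e2_self, R2_e2_lt hlt,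
          hX.map_e2_left hr, hX.map_e2_right hl, map_add, zero_add, hp,
          smul_smul, smul_zero, cp]
        rcases sg_cases (𝕜 := 𝕜) a b with e1 | e1 <;> simp only [e1] <;> match_scalars <;>
          field_simp <;> ring
      · have hba : b < a := by simp only [Fin.lt_def, Fin.ext_iff] at *; omega
        have e := h a hap.ne' ha
        simp only [if_true, if_false, ha, add_zero, map_smul, R2_e2_gt hap, R2_e2_gt hba,
          hX.map_e2_left hr, hX.map_e2_right hl, zero_add, e,
          smul_smul, smul_zero, sg_comm p a, sg_comm b a]
        rcases sg_cases (𝕜 := 𝕜) a p with e1 | e1 <;> rcases sg_cases (𝕜 := 𝕜) a b with e2 | e2 <;>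
          simp only [e1, e2] <;> module
    · simp only [R2_e2, map_add, apply_ite (TensorProduct.map X r), apply_ite (TensorProduct.map l X),
        map_smul, map_zero, hX.map_e2_left hr, hX.map_e2_right hl, ha, hb, if_false, smul_zero,
        add_zero, ite_self]

/-- `Ř` commutes with the coproduct of a lowering operator between neighbouring basis vectors. -/
theorem R2_lower (hpi : p.val + 1 = i.val) (hX : IsArrow X p i w) (hl : IsDiag l lv)
    (hr : IsDiag r rv) (hp : lv p = sg 𝕜 m p i * tau m q p * rv p)
    (hi : lv i = sg 𝕜 m p i * (tau m q i)⁻¹ * rv i)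
    (h : ∀ b, b ≠ p → b ≠ i → lv b = sg 𝕜 m p b * sg 𝕜 m i b * rv b) :
    R2 m n q ∘ₗ (TensorProduct.map X r + TensorProduct.map l X) =
      (TensorProduct.map X r + TensorProduct.map l X) ∘ₗ R2 m n q := by
  have tp := tau_ne_zero (q := q) p
  have ti := tau_ne_zero (q := q) i
  have cp := tau_sub_inv (q := q) p
  have ci := tau_sub_inv (q := q) i
  have hlt : p < i := by simp only [Fin.lt_def]; omega
  refine lin2_ext fun a b => ?_
  simp only [LinearMap.comp_apply, LinearMap.add_apply, hX.map_e2_left hr, hX.map_e2_right hl]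
  by_cases ha : a = p
  · subst ha
    rcases lt_trichotomy b i with hb | rfl | hb
    · by_cases hba : b = a
      · subst hba
        simp only [if_true, map_add, map_smul, R2_e2_self, R2_e2_gt hlt, R2_e2_lt hlt,
          hX.map_e2_left hr, hX.map_e2_right hl, hp, smul_add, smul_smul,
          sg_comm i b, cp]
        rcases sg_cases (𝕜 := 𝕜) b i with e1 | e1 <;> simp only [e1] <;> match_scalars <;>
          field_simp <;> ring
      · have hab : b < a := by simp only [Fin.lt_def, Fin.ext_iff] at *; omega
        have e := h b hba hb.ne
        simp only [if_true, if_false, hba, add_zero, map_smul, R2_e2_gt hb, R2_e2_gt hab,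
          hX.map_e2_left hr, hX.map_e2_right hl, zero_add, e,
          smul_smul, smul_zero]
        rcases sg_cases (𝕜 := 𝕜) a b with e1 | e1 <;> rcases sg_cases (𝕜 := 𝕜) i b with e2 | e2 <;>
          simp only [e1, e2] <;> module
    · simp only [if_true, if_false, hlt.ne', add_zero, map_smul, R2_e2_self, R2_e2_lt hlt,
        hX.map_e2_left hr, hX.map_e2_right hl, map_add, zero_add, hi,
        smul_smul, smul_zero, ci]
      rcases sg_cases (𝕜 := 𝕜) a b with e1 | e1 <;> simp only [e1] <;> match_scalars <;>
          field_simp <;> ring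
    · have hba : a < b := hlt.trans hb
      have e := h b hba.ne' hb.ne'
      simp only [if_true, if_false, hba.ne', add_zero, map_smul, R2_e2_lt hb, R2_e2_lt hba,
        hX.map_e2_left hr, hX.map_e2_right hl, map_add, zero_add, e,
        smul_smul, smul_add, smul_zero]
      rcases sg_cases (𝕜 := 𝕜) a b with e1 | e1 <;> rcases sg_cases (𝕜 := 𝕜) i b with e2 | e2 <;>
        simp only [e1, e2] <;> module
  · by_cases hb : b = p
    · subst hb
      rcases lt_trichotomy a i with hap | rfl | hap
      · have hab : a < b := by simp only [Fin.lt_def, Fin.ext_iff] at *; omega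
        have e := h a ha hap.ne
        simp only [if_true, if_false, ha, add_zero, map_smul, R2_e2_lt hap, R2_e2_lt hab,
          hX.map_e2_left hr, hX.map_e2_right hl, map_add, zero_add, e,
          smul_smul, smul_add, smul_zero, sg_comm i a, sg_comm b a]
        rcases sg_cases (𝕜 := 𝕜) a i with e1 | e1 <;> rcases sg_cases (𝕜 := 𝕜) a b with e2 | e2 <;>
          simp only [e1, e2] <;> module
      · simp only [if_true, if_false, ha, add_zero, map_smul, R2_e2_self, R2_e2_gt hlt,
          hX.map_e2_left hr, hX.map_e2_right hl, zero_add, hi,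
          smul_smul, smul_zero, sg_comm a b]
        rcases sg_cases (𝕜 := 𝕜) b a with e1 | e1 <;> simp only [e1] <;> match_scalars <;>
          field_simp
      · have hba : b < a := hlt.trans hap
        have e := h a ha hap.ne'
        simp only [if_true, if_false, ha, add_zero, map_smul, R2_e2_gt hap, R2_e2_gt hba,
          hX.map_e2_left hr, hX.map_e2_right hl, zero_add, e,
          smul_smul, smul_zero, sg_comm i a, sg_comm b a]
        rcases sg_cases (𝕜 := 𝕜) a i with e1 | e1 <;> rcases sg_cases (𝕜 := 𝕜) a b with e2 | e2 <;>
          simp only [e1, e2] <;> module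
    · simp only [R2_e2, map_add, apply_ite (TensorProduct.map X r), apply_ite (TensorProduct.map l X),
        map_smul, map_zero, hX.map_e2_left hr, hX.map_e2_right hl, ha, hb, if_false, smul_zero,
        add_zero, ite_self]

end Adjacent

section Extremal
variable {f z : Fin (m + n)} {X l r : Module.End 𝕜 (V 𝕜 m n)} {lv rv : Fin (m + n) → 𝕜} {w : 𝕜}

/-- `Ř` intertwines the two summands of the coproduct of an operator which maps the first basis
vector to the last one. -/
theorem R2_first_last (hf : ∀ a, a ≠ f → f < a) (hz : ∀ a, a ≠ z → a < z) (hfz : f ≠ z)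
    (hX : IsArrow X f z w) (hl : IsDiag l lv) (hr : IsDiag r rv)
    (h1 : lv f * tau m q f = sg 𝕜 m f z * rv f) (h2 : lv z * sg 𝕜 m f z = tau m q z * rv z)
    (h : ∀ b, b ≠ f → b ≠ z → lv b * sg 𝕜 m f b = sg 𝕜 m z b * rv b) :
    R2 m n q ∘ₗ TensorProduct.map X r = TensorProduct.map l X ∘ₗ R2 m n q := by
  refine lin2_ext fun a b => ?_
  simp only [LinearMap.comp_apply, hX.map_e2_left hr]
  by_cases ha : a = f
  · subst ha
    by_cases hb : b = z
    · subst hb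
      simp only [if_true, if_false, map_smul, R2_e2_self, R2_e2_lt (hf b hfz.symm), map_add,
        hX.map_e2_right hl, hfz.symm, smul_zero, add_zero, smul_smul]
      congr 1
      linear_combination (-w) * h2
    · by_cases hba : b = a
      · subst hba
        simp only [if_true, map_smul, R2_e2_self, R2_e2_gt (hz b hb), hX.map_e2_right hl,
          smul_smul, sg_comm z b]
        congr 1
        linear_combination (-w) * h1
      · simp only [if_true, if_false, map_smul, R2_e2_gt (hz b hb), R2_e2_lt (hf b hba), map_add,
          hX.map_e2_right hl, hba, smul_zero, add_zero, smul_smul]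
        congr 1
        linear_combination (-w) * h b hba hb
  · have hfa : f < a := hf a ha
    by_cases hb : b = f
    · subst hb
      simp [ha, R2_e2_gt hfa, hX.map_e2_right hl]
    · simp only [R2_e2, map_add, apply_ite (TensorProduct.map l X), map_smul, map_zero,
        hX.map_e2_right hl, ha, hb, if_false, smul_zero, add_zero, ite_self]

/-- `Ř` intertwines the two summands of the coproduct of an operator which maps the last basis
vector to the first one. -/
theorem R2_last_first (hf : ∀ a, a ≠ f → f < a) (hz : ∀ a, a ≠ z → a < z) (hfz : f ≠ z)
    (hX : IsArrow X z f w) (hl : IsDiag l lv) (hr : IsDiag r rv)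
    (h1 : lv f * tau m q f = sg 𝕜 m f z * rv f) (h2 : lv z * sg 𝕜 m f z = tau m q z * rv z)
    (h : ∀ b, b ≠ f → b ≠ z → lv b * sg 𝕜 m f b = sg 𝕜 m z b * rv b) :
    R2 m n q ∘ₗ TensorProduct.map l X = TensorProduct.map X r ∘ₗ R2 m n q := by
  refine lin2_ext fun a b => ?_
  simp only [LinearMap.comp_apply, hX.map_e2_right hl]
  by_cases hb : b = z
  · subst hb
    by_cases ha : a = f
    · subst ha
      simp only [if_true, if_false, map_smul, R2_e2_self, R2_e2_lt (hz a hfz), map_add,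
        hX.map_e2_left hr, hfz, smul_zero, add_zero, smul_smul]
      congr 1
      linear_combination w * h1
    · by_cases hab : a = b
      · subst hab
        simp only [if_true, map_smul, R2_e2_self, R2_e2_gt (hf a ha), hX.map_e2_left hr,
          smul_smul, sg_comm a f]
        congr 1
        linear_combination w * h2
      · simp only [if_true, if_false, map_smul, R2_e2_gt (hf a ha), R2_e2_lt (hz a hab), map_add,
          hX.map_e2_left hr, hab, smul_zero, add_zero, smul_smul, sg_comm a f, sg_comm a b]
        congr 1
        linear_combination w * h a ha hab
  · have hbz : b < z := hz b hb
    by_cases ha : a = z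
    · subst ha
      simp [hb, R2_e2_gt hbz, hX.map_e2_left hr]
    · simp only [R2_e2, map_add, apply_ite (TensorProduct.map X r), map_smul, map_zero,
        hX.map_e2_left hr, ha, hb, if_false, smul_zero, add_zero, ite_self]

end Extremal
end TwoFactors

/-! ### Operators on two neighbouring factors of the tensor power -/

section Legs
variable {𝕜 : Type*} [Field 𝕜] {m n d : ℕ} {q : 𝕜ˣ}

/-- The map `V ⊗ V → V^{⊗ d}` which inserts two vectors at the positions `i`, `i + 1` of a pure
tensor `v`. -/
def insert2 (i : Fin (d - 1)) (v : Fin d → V 𝕜 m n) : V 𝕜 m n ⊗[𝕜] V 𝕜 m n →ₗ[𝕜] VT 𝕜 m n d :=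
  TensorProduct.lift <| LinearMap.mk₂ 𝕜
    (fun x y => PiTensorProduct.tprod 𝕜 (Function.update (Function.update v (lo i) x) (hi i) y))
    (fun x x' y => by
      simp only [Function.update_comm (lo_ne_hi i), MultilinearMap.map_update_add])
    (fun c x y => by
      simp only [Function.update_comm (lo_ne_hi i), MultilinearMap.map_update_smul])
    (fun x y y' => MultilinearMap.map_update_add ..)
    (fun c x y => MultilinearMap.map_update_smul ..)

theorem insert2_tmul (i : Fin (d - 1)) (v : Fin d → V 𝕜 m n) (x y : V 𝕜 m n) :
    insert2 i v (x ⊗ₜ y) =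
      PiTensorProduct.tprod 𝕜 (Function.update (Function.update v (lo i) x) (hi i) y) := rfl

theorem insert2_self (i : Fin (d - 1)) (v : Fin d → V 𝕜 m n) :
    insert2 i v (v (lo i) ⊗ₜ v (hi i)) = PiTensorProduct.tprod 𝕜 v := by
  rw [insert2_tmul, Function.update_eq_self, Function.update_eq_self]

theorem insert2_congr (i : Fin (d - 1)) {v w : Fin d → V 𝕜 m n}
    (h : ∀ k, k ≠ lo i → k ≠ hi i → v k = w k) : insert2 i v = insert2 i w := by
  refine TensorProduct.ext' fun x y => ?_
  rw [insert2_tmul, insert2_tmul]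
  congr 1
  ext1 k
  by_cases h1 : k = hi i
  · subst h1; simp
  by_cases h2 : k = lo i
  · subst h2; simp [lo_ne_hi]
  simp [h1, h2, h k h2 h1]

theorem map_insert2 (i : Fin (d - 1)) (G : Fin d → Module.End 𝕜 (V 𝕜 m n)) (v : Fin d → V 𝕜 m n)
    (z : V 𝕜 m n ⊗[𝕜] V 𝕜 m n) : PiTensorProduct.map G (insert2 i v z) =
      insert2 i (fun k => G k (v k)) (TensorProduct.map (G (lo i)) (G (hi i)) z) := by
  induction z with
  | zero => simp
  | add x y hx hy => simp only [map_add, hx, hy]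
  | tmul x y =>
    rw [insert2_tmul, TensorProduct.map_tmul, insert2_tmul, PiTensorProduct.map_tprod]
    congr 1
    ext1 k
    by_cases h1 : k = hi i
    · subst h1; simp
    by_cases h2 : k = lo i
    · subst h2; simp [lo_ne_hi]
    simp [h1, h2]

theorem twoLeg_insert2 (i : Fin (d - 1)) (X Y : Module.End 𝕜 (V 𝕜 m n)) (v : Fin d → V 𝕜 m n)
    (z : V 𝕜 m n ⊗[𝕜] V 𝕜 m n) :
    twoLeg i X Y (insert2 i v z) = insert2 i v (TensorProduct.map X Y z) := by
  rw [twoLeg, map_insert2]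
  simp only [if_true, if_neg (lo_ne_hi i).symm]
  congr 1
  refine insert2_congr i fun k h1 h2 => ?_
  simp [h1, h2]

theorem Rcheck_insert2 (i : Fin (d - 1)) (v : Fin d → V 𝕜 m n) (z : V 𝕜 m n ⊗[𝕜] V 𝕜 m n) :
    Rcheck m n q i (insert2 i v z) = insert2 i v (R2 m n q z) := by
  simp only [Rcheck, R2, LinearMap.add_apply, LinearMap.sum_apply, map_add, map_sum,
    LinearMap.smul_apply, twoLeg_insert2, map_smul]
  congr 1
  · congr 1
    refine Finset.sum_congr rfl fun a _ => Finset.sum_congr rfl fun b _ => ?_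
    split_ifs
    · simp
    · simp [twoLeg_insert2]
  · refine Finset.sum_congr rfl fun a _ => Finset.sum_congr rfl fun b _ => ?_
    split_ifs
    · simp [twoLeg_insert2]
    · simp

/-- An identity for `Ř` on `V ⊗ V` gives one for `Ř_i` on `V^{⊗ d}`. -/
theorem Rcheck_comp_map (i : Fin (d - 1)) {G G' : Fin d → Module.End 𝕜 (V 𝕜 m n)}
    (h : ∀ k, k ≠ lo i → k ≠ hi i → G k = G' k)
    (hR : R2 m n q ∘ₗ TensorProduct.map (G (lo i)) (G (hi i)) =
      TensorProduct.map (G' (lo i)) (G' (hi i)) ∘ₗ R2 m n q) :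
    Rcheck m n q i * PiTensorProduct.map G = PiTensorProduct.map G' * Rcheck m n q i := by
  refine PiTensorProduct.ext (MultilinearMap.ext fun v => ?_)
  have e := LinearMap.congr_fun hR (v (lo i) ⊗ₜ v (hi i))
  simp only [LinearMap.comp_apply] at e
  simp only [LinearMap.compMultilinearMap_apply, Module.End.mul_apply]
  rw [← insert2_self i v, map_insert2, Rcheck_insert2, Rcheck_insert2, map_insert2, e,
    insert2_congr i (w := fun k => G' k (v k)) fun k h1 h2 => by rw [h k h1 h2]]

/-- The version of `Rcheck_comp_map` for sums of two terms. -/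
theorem Rcheck_comp_map_add (i : Fin (d - 1)) {G H : Fin d → Module.End 𝕜 (V 𝕜 m n)}
    (h : ∀ k, k ≠ lo i → k ≠ hi i → G k = H k)
    (hR : R2 m n q ∘ₗ (TensorProduct.map (G (lo i)) (G (hi i)) +
        TensorProduct.map (H (lo i)) (H (hi i))) =
      (TensorProduct.map (G (lo i)) (G (hi i)) +
        TensorProduct.map (H (lo i)) (H (hi i))) ∘ₗ R2 m n q) :
    Commute (Rcheck m n q i) (PiTensorProduct.map G + PiTensorProduct.map H) := by
  refine PiTensorProduct.ext (MultilinearMap.ext fun v => ?_)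
  have e := LinearMap.congr_fun hR (v (lo i) ⊗ₜ v (hi i))
  simp only [LinearMap.comp_apply, LinearMap.add_apply] at e
  simp only [LinearMap.compMultilinearMap_apply, Module.End.mul_apply, LinearMap.add_apply]
  rw [← insert2_self i v, map_insert2, map_insert2, Rcheck_insert2, map_insert2, map_insert2,
    insert2_congr i (v := fun k => H k (v k)) (w := fun k => G k (v k))
      fun k h1 h2 => by rw [h k h1 h2], ← map_add, ← map_add, Rcheck_insert2, e]

/-- `l ⊗ ⋯ ⊗ l ⊗ x ⊗ r ⊗ ⋯ ⊗ r`, with `x` at position `j`. -/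
def leg (l x r : Fin d → Module.End 𝕜 (V 𝕜 m n)) (j : Fin d) : Module.End 𝕜 (VT 𝕜 m n d) :=
  PiTensorProduct.map fun k => if k < j then l k else if k = j then x k else r k

section LegComm
variable {X l r : Module.End 𝕜 (V 𝕜 m n)} {lv rv : Fin (m + n) → 𝕜}

theorem leg_comm (i : Fin (d - 1)) (hl : IsDiag l lv) (hr : IsDiag r rv) {j : Fin d} (h1 : j ≠ lo i)
    (h2 : j ≠ hi i) :
    Commute (Rcheck m n q i) (leg (fun _ => l) (fun _ => X) (fun _ => r) j) := by
  refine Rcheck_comp_map i (fun _ _ _ => rfl) ?_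
  by_cases h : hi i < j
  · have h' : lo i < j := lt_trans (by simp [lo, hi, Fin.lt_def]) h
    simp only [h, h', if_true]
    exact R2_diag hl
  · have h' : ¬ lo i < j := by
      simp only [lo, hi, Fin.lt_def, ne_eq, Fin.ext_iff] at *; omega
    simp only [h, h', h1.symm, h2.symm, if_false]
    exact R2_diag hr

theorem leg_hi_lo_agree (i : Fin (d - 1)) (k : Fin d) (h1 : k ≠ lo i) (h2 : k ≠ hi i) :
    (if k < lo i then l else if k = lo i then X else r) =
      if k < hi i then l else if k = hi i then X else r := by
  have : k < lo i ↔ k < hi i := by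
    simp only [lo, hi, Fin.lt_def, ne_eq, Fin.ext_iff] at *; omega
  simp [h1, h2, this]

theorem leg_sum_comm (i : Fin (d - 1)) (hl : IsDiag l lv) (hr : IsDiag r rv)
    (hR : R2 m n q ∘ₗ (TensorProduct.map X r + TensorProduct.map l X) =
      (TensorProduct.map X r + TensorProduct.map l X) ∘ₗ R2 m n q) :
    Commute (Rcheck m n q i) (∑ j, leg (fun _ => l) (fun _ => X) (fun _ => r) j) := by
  have hlt : lo i < hi i := by simp [lo, hi, Fin.lt_def]
  rw [← Finset.add_sum_erase _ _ (Finset.mem_univ (lo i)),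
    ← Finset.add_sum_erase _ _ (Finset.mem_erase.2 ⟨(lo_ne_hi i).symm, Finset.mem_univ (hi i)⟩),
    ← add_assoc]
  refine Commute.add_right ?_ (Commute.sum_right _ _ _ fun j hj => ?_)
  · refine Rcheck_comp_map_add i (leg_hi_lo_agree i) ?_
    simpa [hlt, hlt.not_gt, hlt.ne'] using hR
  · simp only [Finset.mem_erase, Finset.mem_univ, and_true] at hj
    exact leg_comm i hl hr hj.2 hj.1

theorem leg_lo_hi (i : Fin (d - 1))
    (hR : R2 m n q ∘ₗ TensorProduct.map X r = TensorProduct.map l X ∘ₗ R2 m n q) :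
    Rcheck m n q i * leg (fun _ => l) (fun _ => X) (fun _ => r) (lo i) =
      leg (fun _ => l) (fun _ => X) (fun _ => r) (hi i) * Rcheck m n q i := by
  have hlt : lo i < hi i := by simp [lo, hi, Fin.lt_def]
  refine Rcheck_comp_map i (leg_hi_lo_agree i) ?_
  simpa [hlt, hlt.not_gt, hlt.ne'] using hR

theorem leg_hi_lo (i : Fin (d - 1))
    (hR : R2 m n q ∘ₗ TensorProduct.map l X = TensorProduct.map X r ∘ₗ R2 m n q) :
    Rcheck m n q i * leg (fun _ => l) (fun _ => X) (fun _ => r) (hi i) =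
      leg (fun _ => l) (fun _ => X) (fun _ => r) (lo i) * Rcheck m n q i := by
  have hlt : lo i < hi i := by simp [lo, hi, Fin.lt_def]
  refine Rcheck_comp_map i (fun k h1 h2 => (leg_hi_lo_agree i k h1 h2).symm) ?_
  simpa [hlt, hlt.not_gt, hlt.ne'] using hR

end LegComm

/-! ### The action on tensor products of evaluation modules -/

theorem snocEquiv_tprod (v : Fin d → V 𝕜 m n) (w : V 𝕜 m n) :
    snocEquiv 𝕜 m n d (PiTensorProduct.tprod 𝕜 v ⊗ₜ w) =
      PiTensorProduct.tprod 𝕜 (Fin.snoc v w : Fin (d + 1) → V 𝕜 m n) := by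
  have h : (PiTensorProduct.subsingletonEquiv (R := 𝕜) (s := fun _ : Fin 1 => V 𝕜 m n) 0).symm w =
      PiTensorProduct.tprod 𝕜 fun _ => w := by
    rw [LinearEquiv.symm_apply_eq, PiTensorProduct.subsingletonEquiv_apply_tprod]
  simp only [snocEquiv, LinearEquiv.trans_apply, TensorProduct.congr_tmul, h,
    LinearEquiv.refl_apply]
  refine (TensorPower.tprod_mul_tprod 𝕜 v fun _ : Fin 1 => w).trans ?_
  rw [Fin.append_right_eq_snoc]

/-- The operator `A ⊗ B` on `V^{⊗ d} ⊗ V = V^{⊗ (d + 1)}`. -/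
theorem conj_snocEquiv_map (G : Fin d → Module.End 𝕜 (V 𝕜 m n)) (B : Module.End 𝕜 (V 𝕜 m n)) :
    LinearEquiv.conjAlgEquiv 𝕜 (snocEquiv 𝕜 m n d)
      (TensorProduct.map (PiTensorProduct.map G) B) =
        PiTensorProduct.map (Fin.snoc G B : Fin (d + 1) → Module.End 𝕜 (V 𝕜 m n)) := by
  refine PiTensorProduct.ext (MultilinearMap.ext fun v => ?_)
  have h : (snocEquiv 𝕜 m n d).symm (PiTensorProduct.tprod 𝕜 v) =
      PiTensorProduct.tprod 𝕜 (Fin.init v) ⊗ₜ v (Fin.last d) := by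
    rw [LinearEquiv.symm_apply_eq, snocEquiv_tprod, Fin.snoc_init_self]
  simp only [LinearMap.compMultilinearMap_apply, LinearEquiv.conjAlgEquiv_apply,
    LinearMap.comp_apply, LinearEquiv.coe_coe, h, TensorProduct.map_tmul,
    PiTensorProduct.map_tprod, snocEquiv_tprod]
  congr 1
  ext1 k
  refine Fin.lastCases ?_ (fun k => ?_) k
  · simp
  · simp [Fin.init]

theorem tensorRep_succ_of_comul_eq {x : Tilde m n q} {x₁ x₂ : Tilde m n q}
    (a : Fin (d + 1) → 𝕜ˣ) {A : Tilde m n q ⊗[𝕜] Tilde m n q}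
    (hx : Tilde.comul m n q x = x₁ ⊗ₜ x₂ + A) :
    tensorRep m n q (d + 1) a x = LinearEquiv.conjAlgEquiv 𝕜 (snocEquiv 𝕜 m n d)
      (TensorProduct.map (tensorRep m n q d (Fin.init a) x₁) (evalRep m n q (a (Fin.last d)) x₂)) +
      LinearEquiv.conjAlgEquiv 𝕜 (snocEquiv 𝕜 m n d)
        (Module.endTensorEndAlgHom (R := 𝕜) (S := 𝕜) (A := 𝕜) (Algebra.TensorProduct.map
          (tensorRep m n q d (Fin.init a)) (evalRep m n q (a (Fin.last d))) A)) := by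
  change LinearEquiv.conjAlgEquiv 𝕜 (snocEquiv 𝕜 m n d)
    (Module.endTensorEndAlgHom (R := 𝕜) (S := 𝕜) (A := 𝕜) (Algebra.TensorProduct.map
      (tensorRep m n q d (Fin.init a)) (evalRep m n q (a (Fin.last d))) (Tilde.comul m n q x))) = _
  rw [hx, map_add, map_add, map_add]
  rfl

/-- An element `g` of `Ũ` with `Δ g = g ⊗ g` and counit `1`. -/
def IsGroupLike (g : Tilde m n q) : Prop :=
  Tilde.comul m n q g = g ⊗ₜ g ∧ Tilde.counit m n q g = 1

theorem IsGroupLike.tensorRep {g : Tilde m n q} (h : IsGroupLike g) (a : Fin d → 𝕜ˣ) :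
    tensorRep m n q d a g = PiTensorProduct.map fun k => evalRep m n q (a k) g := by
  induction d with
  | zero =>
    change algebraMap 𝕜 _ (Tilde.counit m n q g) = _
    rw [h.2, map_one]
    refine PiTensorProduct.ext (MultilinearMap.ext fun v => ?_)
    simp only [LinearMap.compMultilinearMap_apply, PiTensorProduct.map_tprod, Module.End.one_apply]
    congr 1
    exact Subsingleton.elim _ _
  | succ d ih =>
    rw [tensorRep_succ_of_comul_eq a (h.1.trans (add_zero _).symm), ih, conj_snocEquiv_map]
    simp only [map_zero, add_zero]
    congr 1
    ext1 k
    refine Fin.lastCases ?_ (fun k => ?_) k <;> simp [Fin.init]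

/-- The action of a skew-primitive element, i.e. of the iterated coproduct
`∑_j l ⊗ ⋯ ⊗ l ⊗ x ⊗ r ⊗ ⋯ ⊗ r`. -/
theorem tensorRep_skewPrimitive {x l r : Tilde m n q} (hl : IsGroupLike l)
    (hx : Tilde.comul m n q x = x ⊗ₜ r + l ⊗ₜ x) (hx0 : Tilde.counit m n q x = 0)
    (a : Fin d → 𝕜ˣ) :
    tensorRep m n q d a x = ∑ j, leg (fun k => evalRep m n q (a k) l)
      (fun k => evalRep m n q (a k) x) (fun k => evalRep m n q (a k) r) j := by
  induction d with
  | zero =>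
    change algebraMap 𝕜 _ (Tilde.counit m n q x) = _
    simp [hx0]
  | succ d ih =>
    rw [tensorRep_succ_of_comul_eq a hx, Fin.sum_univ_castSucc, ih]
    congr 1
    · have e : ∀ Y : Fin d → Module.End 𝕜 (VT 𝕜 m n d), ∀ B : Module.End 𝕜 (V 𝕜 m n),
          TensorProduct.map (∑ j, Y j) B = ∑ j, TensorProduct.map (Y j) B := fun Y B => by
        rw [← TensorProduct.mapBilinear_apply, map_sum, LinearMap.sum_apply]
        rfl
      rw [e, map_sum]
      refine Finset.sum_congr rfl fun j _ => ?_
      rw [leg, conj_snocEquiv_map, leg]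
      congr 1
      ext1 k
      refine Fin.lastCases ?_ (fun k => ?_) k
      · simp [(Fin.castSucc_lt_last j).not_gt, (Fin.castSucc_lt_last j).ne']
      · simp [Fin.init]
    · refine (congrArg (LinearEquiv.conjAlgEquiv 𝕜 (snocEquiv 𝕜 m n d))
        (show _ = TensorProduct.map (QSuper.tensorRep m n q d (Fin.init a) l)
          (evalRep m n q (a (Fin.last d)) x) from rfl)).trans ?_
      rw [hl.tensorRep, conj_snocEquiv_map, leg]
      congr 1
      ext1 k
      refine Fin.lastCases ?_ (fun k => ?_) k
      · simp
      · simp [Fin.init, Fin.castSucc_lt_last]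

end Legs

/-! ### The generators on evaluation modules -/

section Generators
variable {𝕜 : Type*} [Field 𝕜] {m n : ℕ} {q : 𝕜ˣ}

theorem evalRep_sig (a : 𝕜ˣ) :
    evalRep m n q a (Tilde.sig m n q) = Matrix.toLinAlgEquiv' (sigMat m n) := by
  simp [evalRep, Tilde.lift, Tilde.sig, Tilde.of, Tilde.genMap]

theorem evalRep_K (a : 𝕜ˣ) (γ : lattice m n) :
    evalRep m n q a (Tilde.K q γ) = Matrix.toLinAlgEquiv' (KMat m n q γ) := by
  simp [evalRep, Tilde.lift, Tilde.K, Tilde.of, Tilde.genMap]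

theorem evalRep_E (a : 𝕜ˣ) (i : Fin (m + n)) :
    evalRep m n q a (Tilde.E q i) = Matrix.toLinAlgEquiv' (evalE m n q a i) := by
  simp [evalRep, Tilde.lift, Tilde.E, Tilde.of, Tilde.genMap]

theorem evalRep_F (a : 𝕜ˣ) (i : Fin (m + n)) :
    evalRep m n q a (Tilde.F q i) = Matrix.toLinAlgEquiv' (evalF m n q a i) := by
  simp [evalRep, Tilde.lift, Tilde.F, Tilde.of, Tilde.genMap]

theorem isDiag_diagonal (κ : Fin (m + n) → 𝕜) :
    IsDiag (Matrix.toLinAlgEquiv' (Matrix.diagonal κ)) κ := fun a => by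
  ext k
  by_cases h : k = a
  · subst h; simp
  · simp [h]

theorem isArrow_single (x y : Fin (m + n)) (w : 𝕜) :
    IsArrow (Matrix.toLinAlgEquiv' (Matrix.single y x w)) x y w := fun a => by
  ext k
  by_cases h : a = x
  · subst h
    simp [Matrix.single, Pi.single_apply, eq_comm]
  · simp [Matrix.single, h, Ne.symm h]

theorem IsDiag.mul {N : ℕ} {D D' : Module.End 𝕜 (Fin N → 𝕜)} {κ κ' : Fin N → 𝕜} (h : IsDiag D κ)
    (h' : IsDiag D' κ') : IsDiag (D * D') fun k => κ k * κ' k := fun a => by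
  rw [Module.End.mul_apply, h', map_smul, h, smul_smul, mul_comm]

theorem IsDiag.pow {N : ℕ} {D : Module.End 𝕜 (Fin N → 𝕜)} {κ : Fin N → 𝕜} (h : IsDiag D κ)
    (k : ℕ) : IsDiag (D ^ k) fun a => κ a ^ k := by
  induction k with
  | zero => intro a; simp
  | succ k ih => simpa only [pow_succ] using ih.mul h

theorem IsDiag.one {N : ℕ} : IsDiag (1 : Module.End 𝕜 (Fin N → 𝕜)) fun _ => 1 := fun a => by simp

theorem isDiag_sig (a : 𝕜ˣ) :
    IsDiag (evalRep m n q a (Tilde.sig m n q)) fun k => sgn 𝕜 (vpar m k) := by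
  rw [evalRep_sig]; exact isDiag_diagonal _

theorem isDiag_K (a : 𝕜ˣ) (γ : lattice m n) :
    IsDiag (evalRep m n q a (Tilde.K q γ)) fun k => qz q (form m γ.1 (eps k)) := by
  rw [evalRep_K]; exact isDiag_diagonal _

theorem isDiag_sigPow (a : 𝕜ˣ) (i : Fin (m + n)) :
    IsDiag (evalRep m n q a (Tilde.sigPow q i)) fun k => sgn 𝕜 (vpar m k) ^ npar m i := by
  rw [Tilde.sigPow, map_pow]; exact (isDiag_sig a).pow _

theorem isArrow_E (a : 𝕜ˣ) {i : Fin (m + n)} (hi : i.val ≠ 0) :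
    IsArrow (evalRep m n q a (Tilde.E q i)) i (pre i) (qz q (-dbar m i)) := by
  rw [evalRep_E, evalE, if_neg hi]; exact isArrow_single _ _ _

theorem isArrow_F (a : 𝕜ˣ) {i : Fin (m + n)} (hi : i.val ≠ 0) :
    IsArrow (evalRep m n q a (Tilde.F q i)) (pre i) i (qz q (dbar m i)) := by
  rw [evalRep_F, evalF, if_neg hi]; exact isArrow_single _ _ _

theorem exists_isArrow_E (a : 𝕜ˣ) (i : Fin (m + n)) :
    ∃ w, IsArrow (evalRep m n q a (Tilde.E q i)) i (pre i) w := by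
  obtain ⟨u, -, h, -⟩ := eval_aux m n q a i
  exact ⟨u, by rw [evalRep_E, h]; exact isArrow_single _ _ _⟩

theorem exists_isArrow_F (a : 𝕜ˣ) (i : Fin (m + n)) :
    ∃ w, IsArrow (evalRep m n q a (Tilde.F q i)) (pre i) i w := by
  obtain ⟨u, -, -, h⟩ := eval_aux m n q a i
  exact ⟨u⁻¹, by rw [evalRep_F, h]; exact isArrow_single _ _ _⟩

theorem map_upProd {A B G : Type*} [Monoid A] [Monoid B] [FunLike G A B] [MonoidHomClass G A B]
    (f : G) {N : ℕ} (x : Fin N → A) : f (upProd x) = upProd fun i => f (x i) := by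
  simp only [upProd, map_list_prod, List.map_ofFn]
  rfl

theorem map_downProd {A B G : Type*} [Monoid A] [Monoid B] [FunLike G A B] [MonoidHomClass G A B]
    (f : G) {N : ℕ} (x : Fin N → A) : f (downProd x) = downProd fun i => f (x i) := by
  simp only [downProd, map_list_prod, List.map_reverse, List.map_ofFn]
  rfl

theorem upProd_congr {A : Type*} [Monoid A] {N : ℕ} {x y : Fin N → A}
    (h : ∀ i, i.val ≠ 0 → x i = y i) : upProd x = upProd y := by
  unfold upProd
  congr 2
  ext1 k
  exact h _ (Nat.succ_ne_zero _)

theorem downProd_congr {A : Type*} [Monoid A] {N : ℕ} {x y : Fin N → A}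
    (h : ∀ i, i.val ≠ 0 → x i = y i) : downProd x = downProd y := by
  unfold downProd
  congr 3
  ext1 k
  exact h _ (Nat.succ_ne_zero _)

theorem evalRep_E_affine (a : 𝕜ˣ) {i : Fin (m + n)} (hi : i.val = 0) :
    evalRep m n q a (Tilde.E q i) = (a : 𝕜) • FPi m n q := by
  rw [evalRep_E, evalE, if_pos hi, map_smul, FPi, map_downProd, map_downProd]
  congr 1
  exact downProd_congr fun j hj => by rw [evalRep_F, evalF, if_neg hj]

theorem evalRep_F_affine (a : 𝕜ˣ) {i : Fin (m + n)} (hi : i.val = 0) :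
    evalRep m n q a (Tilde.F q i) = ((a⁻¹ : 𝕜ˣ) : 𝕜) • EPi m n q := by
  rw [evalRep_F, evalF, if_pos hi, map_smul, EPi, map_upProd, map_upProd]
  congr 1
  exact upProd_congr fun j hj => by rw [evalRep_E, evalE, if_neg hj]

/-! ### The element `K_Π` -/

/-- The weight `α_1 + ⋯ + α_{m+n-1}` of `K_Π`. -/
def rootPi (m n : ℕ) : lattice m n := ∑ k : Fin (m + n - 1), rootL ⟨k.val + 1, by omega⟩

theorem upProd_K (γ : Fin (m + n) → lattice m n) : upProd (fun i => Tilde.K q (γ i)) =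
    Tilde.K q (∑ k : Fin (m + n - 1), γ ⟨k.val + 1, by omega⟩) := by
  let f : Multiplicative (lattice m n) →* Tilde m n q :=
    { toFun := fun γ => Tilde.K q γ.toAdd
      map_one' := (Tilde.relations m n q).K_zero
      map_mul' := fun a b => ((Tilde.relations m n q).K_mul _ _).symm }
  refine (map_upProd f fun i => Multiplicative.ofAdd (γ i)).symm.trans ?_
  rw [upProd, List.prod_ofFn, ← ofAdd_sum]
  rfl

theorem downProd_K (γ : Fin (m + n) → lattice m n) : downProd (fun i => Tilde.K q (γ i)) =
    Tilde.K q (∑ k : Fin (m + n - 1), γ ⟨k.val + 1, by omega⟩) := by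
  let f : Multiplicative (lattice m n) →* Tilde m n q :=
    { toFun := fun γ => Tilde.K q γ.toAdd
      map_one' := (Tilde.relations m n q).K_zero
      map_mul' := fun a b => ((Tilde.relations m n q).K_mul _ _).symm }
  refine (map_downProd f fun i => Multiplicative.ofAdd (γ i)).symm.trans ?_
  rw [downProd, List.prod_reverse, List.prod_ofFn, ← ofAdd_sum]
  rfl

/-- All simple roots add up to the null root `δ`, which pairs to zero with all weights. -/
theorem form_rootPi {i : Fin (m + n)} (hi : i.val = 0) (k : Fin (m + n)) :
    form m (rootPi m n).1 (eps k) = -form m (root i) (eps k) := by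
  have hlt := i.isLt
  let g : ℕ → Fin (m + n) → ℤ := fun k => if h : k < m + n then Pi.single ⟨k, h⟩ 1 else 0
  have h1 : (rootPi m n).1.1 = g 0 - g (m + n - 1) := by
    have e : (rootPi m n).1 = ∑ k : Fin (m + n - 1), root (⟨k.val + 1, by omega⟩ : Fin (m + n)) := by
      simp [rootPi, rootL]
    rw [e, Prod.fst_sum, ← Finset.sum_range_sub',
      ← Fin.sum_univ_eq_sum_range (fun k => g k - g (k + 1))]
    refine Finset.sum_congr rfl fun k _ => ?_
    have hk := k.isLt
    simp only [root, g, dif_pos (show k.val < m + n by omega),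
      dif_pos (show k.val + 1 < m + n by omega)]
    congr 2
  have h2 : (root i).1 = g (m + n - 1) - g 0 := by
    have e0 : i = ⟨0, by omega⟩ := Fin.ext hi
    have e1 : pre i = ⟨m + n - 1, by omega⟩ := Fin.ext (by simp [pre, hi])
    simp only [root, g, dif_pos (show 0 < m + n by omega), dif_pos (show m + n - 1 < m + n by omega),
      ← e1, ← e0]
  rw [form_eps, form_eps, h1, h2]
  simp only [Pi.sub_apply]
  ring

theorem KPi_eq (a : 𝕜ˣ) {i : Fin (m + n)} (hi : i.val = 0) :
    KPi m n q = evalRep m n q a (Tilde.K q (-rootL i)) := by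
  rw [KPi, upProd_K, evalRep_K, evalRep_K]
  congr 1
  unfold KMat
  congr 1
  ext1 k
  congr 1
  exact (form_rootPi hi k).trans (Tilde.form_neg _ _).symm

theorem KPiInv_eq (a : 𝕜ˣ) {i : Fin (m + n)} (hi : i.val = 0) :
    KPiInv m n q = evalRep m n q a (Tilde.K q (rootL i)) := by
  rw [KPiInv, downProd_K, evalRep_K, evalRep_K]
  congr 1
  unfold KMat
  congr 1
  ext1 k
  congr 1
  rw [Finset.sum_neg_distrib]
  refine (Tilde.form_neg _ _).trans ?_
  rw [neg_eq_iff_eq_neg]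
  exact form_rootPi hi k

theorem sigV_eq (a : 𝕜ˣ) : sigV m n q = evalRep m n q a (Tilde.sig m n q) := by
  rw [sigV, evalRep_sig, evalRep_sig]

/-! ### Group-like and skew-primitive generators -/

theorem isGroupLike_one : IsGroupLike (1 : Tilde m n q) :=
  ⟨by rw [map_one, Algebra.TensorProduct.one_def], map_one _⟩

theorem IsGroupLike.mul {g h : Tilde m n q} (hg : IsGroupLike g) (hh : IsGroupLike h) :
    IsGroupLike (g * h) :=
  ⟨by rw [map_mul, hg.1, hh.1, Algebra.TensorProduct.tmul_mul_tmul], by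
    rw [map_mul, hg.2, hh.2, one_mul]⟩

theorem IsGroupLike.pow {g : Tilde m n q} (hg : IsGroupLike g) (k : ℕ) : IsGroupLike (g ^ k) := by
  induction k with
  | zero => simpa using isGroupLike_one
  | succ k ih => rw [pow_succ]; exact ih.mul hg

theorem isGroupLike_sig : IsGroupLike (Tilde.sig m n q) :=
  ⟨comul_sig, by simp [Tilde.counit, Tilde.lift, Tilde.sig, Tilde.of, Tilde.genMap]⟩

theorem isGroupLike_K (γ : lattice m n) : IsGroupLike (Tilde.K q γ) :=
  ⟨comul_K γ, by simp [Tilde.counit, Tilde.lift, Tilde.K, Tilde.of, Tilde.genMap]⟩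

theorem isGroupLike_sigPow (i : Fin (m + n)) : IsGroupLike (Tilde.sigPow q i) :=
  isGroupLike_sig.pow _

variable {d : ℕ}

theorem tensorRep_E (a : Fin d → 𝕜ˣ) (i : Fin (m + n)) : tensorRep m n q d a (Tilde.E q i) =
    ∑ j, leg (fun k => evalRep m n q (a k) (Tilde.K q (rootL i) * Tilde.sigPow q i))
      (fun k => evalRep m n q (a k) (Tilde.E q i)) (fun _ => 1) j := by
  rw [tensorRep_skewPrimitive (r := 1) ((isGroupLike_K _).mul (isGroupLike_sigPow i)) (comul_E i)
    (by simp [Tilde.counit, Tilde.lift, Tilde.E, Tilde.of, Tilde.genMap])]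
  simp only [map_one]

theorem tensorRep_F (a : Fin d → 𝕜ˣ) (i : Fin (m + n)) : tensorRep m n q d a (Tilde.F q i) =
    ∑ j, leg (fun k => evalRep m n q (a k) (Tilde.sigPow q i))
      (fun k => evalRep m n q (a k) (Tilde.F q i))
      (fun k => evalRep m n q (a k) (Tilde.K q (-rootL i))) j :=
  tensorRep_skewPrimitive (isGroupLike_sigPow i) (comul_F i)
    (by simp [Tilde.counit, Tilde.lift, Tilde.F, Tilde.of, Tilde.genMap]) a

theorem evalRep_sigPow (a b : 𝕜ˣ) (i : Fin (m + n)) :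
    evalRep m n q a (Tilde.sigPow q i) = evalRep m n q b (Tilde.sigPow q i) := by
  rw [Tilde.sigPow, map_pow, map_pow, evalRep_sig, evalRep_sig]

/-! The generators other than `E_0` and `F_0` do not see the evaluation parameters. -/

theorem tensorRep_sig_eq (a : Fin d → 𝕜ˣ) : tensorRep m n q d a (Tilde.sig m n q) =
    PiTensorProduct.map fun _ => evalRep m n q 1 (Tilde.sig m n q) := by
  rw [isGroupLike_sig.tensorRep]; simp only [evalRep_sig]

theorem tensorRep_K_eq (a : Fin d → 𝕜ˣ) (γ : lattice m n) : tensorRep m n q d a (Tilde.K q γ) =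
    PiTensorProduct.map fun _ => evalRep m n q 1 (Tilde.K q γ) := by
  rw [(isGroupLike_K γ).tensorRep]; simp only [evalRep_K]

theorem tensorRep_E_eq (a : Fin d → 𝕜ˣ) {i : Fin (m + n)} (hi : i.val ≠ 0) :
    tensorRep m n q d a (Tilde.E q i) =
      ∑ j, leg (fun _ => evalRep m n q 1 (Tilde.K q (rootL i) * Tilde.sigPow q i))
        (fun _ => evalRep m n q 1 (Tilde.E q i)) (fun _ => 1) j := by
  rw [tensorRep_E]
  simp only [map_mul, evalRep_K, evalRep_E, evalE, if_neg hi, evalRep_sigPow _ 1]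

theorem tensorRep_F_eq (a : Fin d → 𝕜ˣ) {i : Fin (m + n)} (hi : i.val ≠ 0) :
    tensorRep m n q d a (Tilde.F q i) =
      ∑ j, leg (fun _ => evalRep m n q 1 (Tilde.sigPow q i))
        (fun _ => evalRep m n q 1 (Tilde.F q i))
        (fun _ => evalRep m n q 1 (Tilde.K q (-rootL i))) j := by
  rw [tensorRep_F]
  simp only [evalRep_K, evalRep_F, evalF, if_neg hi, evalRep_sigPow _ 1]

theorem leg_smul (l r : Fin d → Module.End 𝕜 (V 𝕜 m n)) (c : Fin d → 𝕜)
    (X : Module.End 𝕜 (V 𝕜 m n)) (j : Fin d) :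
    leg l (fun k => c k • X) r j = c j • leg l (fun _ => X) r j := by
  have e : ∀ Y : Fin d → Module.End 𝕜 (V 𝕜 m n), leg l Y r j = PiTensorProduct.map
      (Function.update (fun k => if k < j then l k else r k) j (Y j)) := fun Y => by
    rw [leg]
    congr 1
    ext1 k
    by_cases h : k = j
    · subst h; simp
    · simp [h]
  rw [e, e, PiTensorProduct.map_update_smul]

theorem tensorRep_E_affine (hm : 1 ≤ m) (hn : 1 ≤ n) (a : Fin d → 𝕜ˣ) {i : Fin (m + n)}
    (hi : i.val = 0) :
    tensorRep m n q d a (Tilde.E q i) = ∑ j, (a j : 𝕜) • YE m n d q j := by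
  have hp : npar m i = 1 := by rw [npar_eq hm hn, if_pos (Or.inl hi)]
  rw [tensorRep_E]
  refine Finset.sum_congr rfl fun j _ => ?_
  simp only [evalRep_E_affine _ hi]
  rw [leg_smul]
  congr 1
  rw [leg, YE]
  congr 1
  ext1 k
  rw [Tilde.sigPow, hp, pow_one, ← (Tilde.relations m n q).sig_K, map_mul, ← KPiInv_eq _ hi,
    ← sigV_eq]
  rfl

theorem tensorRep_F_affine (hm : 1 ≤ m) (hn : 1 ≤ n) (a : Fin d → 𝕜ˣ) {i : Fin (m + n)}
    (hi : i.val = 0) :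
    tensorRep m n q d a (Tilde.F q i) = ∑ j, (((a j)⁻¹ : 𝕜ˣ) : 𝕜) • YF m n d q j := by
  have hp : npar m i = 1 := by rw [npar_eq hm hn, if_pos (Or.inl hi)]
  rw [tensorRep_F]
  refine Finset.sum_congr rfl fun j _ => ?_
  simp only [evalRep_F_affine _ hi]
  rw [leg_smul]
  congr 1
  rw [leg, YF]
  congr 1
  ext1 k
  rw [Tilde.sigPow, hp, pow_one, ← KPi_eq _ hi, ← sigV_eq]

/-! ### Commutation with the Hecke algebra -/

theorem Rcheck_comm_sig (a : Fin d → 𝕜ˣ) (j : Fin (d - 1)) :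
    Commute (Rcheck m n q j) (tensorRep m n q d a (Tilde.sig m n q)) := by
  rw [tensorRep_sig_eq]
  exact Rcheck_comp_map j (fun _ _ _ => rfl) (R2_diag (isDiag_sig 1))

theorem Rcheck_comm_K (a : Fin d → 𝕜ˣ) (γ : lattice m n) (j : Fin (d - 1)) :
    Commute (Rcheck m n q j) (tensorRep m n q d a (Tilde.K q γ)) := by
  rw [tensorRep_K_eq]
  exact Rcheck_comp_map j (fun _ _ _ => rfl) (R2_diag (isDiag_K 1 γ))

theorem vpar_cases (k : Fin (m + n)) : vpar m k = 0 ∨ vpar m k = 1 := by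
  unfold vpar; split_ifs <;> simp

/-- The signs by which `σ^{p(α_i)}` acts, in terms of those in `Ř`. -/
theorem sgn_pow_npar (i b : Fin (m + n)) :
    sgn 𝕜 (vpar m b) ^ npar m i = sg 𝕜 m (pre i) b * sg 𝕜 m i b := by
  unfold npar sg sgn
  rcases vpar_cases (pre i) with h1 | h1 <;> rcases vpar_cases i with h2 | h2 <;>
    rcases vpar_cases b with h3 | h3 <;> simp [h1, h2, h3]

theorem form_root_eps (i k : Fin (m + n)) : form m (root i) (eps k) =
    dbar m k * ((if k = pre i then 1 else 0) - if k = i then 1 else 0) := by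
  rw [form_eps]; simp [root, Pi.single_apply]

theorem sg_self (a : Fin (m + n)) : sg 𝕜 m a a = sgn 𝕜 (vpar m a) := by
  unfold sg; rcases vpar_cases a with h | h <;> simp [h]

theorem tau_inv (a : Fin (m + n)) : (tau m q a)⁻¹ = sgn 𝕜 (vpar m a) * qz q (-dbar m a) := by
  have : (sgn 𝕜 (vpar m a))⁻¹ = sgn 𝕜 (vpar m a) := by
    rcases sgn_cases (𝕜 := 𝕜) (vpar m a) with h | h <;> rw [h] <;> norm_num
  rw [tau, mul_inv, this, qz_neg]

theorem qz_zero : qz q 0 = 1 := by simp [qz]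

theorem Rcheck_comm_E (hN : 2 ≤ m + n) (a : Fin d → 𝕜ˣ) {i : Fin (m + n)} (hi : i.val ≠ 0)
    (j : Fin (d - 1)) : Commute (Rcheck m n q j) (tensorRep m n q d a (Tilde.E q i)) := by
  have hp := pre_ne_self hN i
  have hl := (isDiag_K (q := q) 1 (rootL i)).mul (isDiag_sigPow (q := q) 1 i)
  simp only [← map_mul, rootL, form_root_eps, sgn_pow_npar] at hl
  rw [tensorRep_E_eq a hi]
  refine leg_sum_comm j hl .one (R2_raise (p := pre i) ?_ (isArrow_E 1 hi) hl .one ?_ ?_ ?_)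
  · simp only [pre, hi, if_false]; omega
  · simp only [if_true, if_neg hp, sub_zero, mul_one, tau, sg_self, sg_comm i]
    ring
  · simp only [if_true, if_neg hp.symm, zero_sub, mul_neg, mul_one, tau_inv, sg_self]
    ring
  · intro b h1 h2
    simp [h1, h2, qz_zero]

theorem Rcheck_comm_F (hN : 2 ≤ m + n) (a : Fin d → 𝕜ˣ) {i : Fin (m + n)} (hi : i.val ≠ 0)
    (j : Fin (d - 1)) : Commute (Rcheck m n q j) (tensorRep m n q d a (Tilde.F q i)) := by
  have hp := pre_ne_self hN i
  have hl := isDiag_sigPow (q := q) 1 i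
  have hr := isDiag_K (q := q) 1 (-rootL i)
  have e : ∀ k, form m (-rootL i : lattice m n).1 (eps k) = -form m (root i) (eps k) :=
    fun k => Tilde.form_neg _ _
  simp only [sgn_pow_npar] at hl
  simp only [e, form_root_eps] at hr
  rw [tensorRep_F_eq a hi]
  refine leg_sum_comm j hl hr (R2_lower (i := i) ?_ (isArrow_F 1 hi) hl hr ?_ ?_ ?_)
  · simp only [pre, hi, if_false]; omega
  · have := qz_ne_zero q (dbar m (pre i))
    simp only [if_true, if_neg hp, sub_zero, mul_one, tau, sg_self, sg_comm i, qz_neg]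
    field_simp
  · have := qz_ne_zero q (dbar m i)
    simp only [if_true, if_neg hp.symm, zero_sub, mul_neg, mul_one, tau_inv, sg_self, neg_neg,
      qz_neg]
    field_simp
  · intro b h1 h2
    simp [h1, h2, qz_zero]

section Affine
variable (j : Fin (d - 1))

theorem sg_eq_one {f : Fin (m + n)} (hm : 1 ≤ m) (hf : f.val = 0) (b : Fin (m + n)) :
    sg 𝕜 m f b = 1 := by
  have : vpar m f = 0 := by unfold vpar; split_ifs <;> omega
  simp [sg, sgn, this]

theorem sg_eq_sgn {f : Fin (m + n)} (hn : 1 ≤ n) (hf : f.val = 0) (b : Fin (m + n)) :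
    sg 𝕜 m (pre f) b = sgn 𝕜 (vpar m b) := by
  have : vpar m (pre f) = 1 := by simp only [vpar, pre]; split_ifs <;> omega
  simp [sg, this]

theorem sgn_mul_self (k : ℕ) : sgn 𝕜 k * sgn 𝕜 k = 1 := by
  rcases sgn_cases (𝕜 := 𝕜) k with h | h <;> simp [h]

theorem R2_FPi (hm : 1 ≤ m) (hn : 1 ≤ n) : R2 m n q ∘ₗ TensorProduct.map (FPi m n q) 1 =
    TensorProduct.map (sigV m n q * KPiInv m n q) (FPi m n q) ∘ₗ R2 m n q := by
  let f : Fin (m + n) := ⟨0, by omega⟩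
  have hp := pre_ne_self (by omega) f
  have hl := (isDiag_sig (q := q) 1).mul (isDiag_K (q := q) 1 (rootL f))
  rw [← KPiInv_eq 1 (i := f) rfl, ← sigV_eq] at hl
  simp only [rootL, form_root_eps] at hl
  obtain ⟨w, hX⟩ := exists_isArrow_E (q := q) 1 f
  rw [evalRep_E_affine 1 (i := f) rfl, Units.val_one, one_smul] at hX
  have tz := tau_ne_zero (q := q) f
  refine R2_first_last (fun a ha => ?_) (fun a ha => ?_) hp.symm hX hl .one ?_ ?_ ?_
  · simp only [f, Fin.lt_def, ne_eq, Fin.ext_iff] at *; omega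
  · simp only [f, pre, if_true, Fin.lt_def, ne_eq, Fin.ext_iff] at *; omega
  · simp only [if_true, if_neg hp.symm, zero_sub, mul_neg, mul_one, ← tau_inv]
    rw [inv_mul_cancel₀ tz, sg_eq_one hm rfl]
  · simp only [if_true, if_neg hp, sub_zero, mul_one, sg_eq_one hm (f := f) rfl]
    rfl
  · intro b h1 h2
    simp only [h1, h2, if_false, sub_zero, mul_zero, qz_zero, mul_one, sg_eq_one hm (f := f) rfl,
      sg_eq_sgn hn (f := f) rfl]

theorem R2_EPi (hm : 1 ≤ m) (hn : 1 ≤ n) : R2 m n q ∘ₗ TensorProduct.map (sigV m n q) (EPi m n q) =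
    TensorProduct.map (EPi m n q) (KPi m n q) ∘ₗ R2 m n q := by
  let f : Fin (m + n) := ⟨0, by omega⟩
  have hp := pre_ne_self (by omega) f
  have hl := isDiag_sig (m := m) (n := n) (q := q) 1
  have hr := isDiag_K (q := q) 1 (-rootL f)
  have e : ∀ k, form m (-rootL f : lattice m n).1 (eps k) = -form m (root f) (eps k) :=
    fun k => Tilde.form_neg _ _
  rw [← KPi_eq 1 (i := f) rfl] at hr
  rw [← sigV_eq] at hl
  simp only [e, form_root_eps] at hr
  obtain ⟨w, hX⟩ := exists_isArrow_F (q := q) 1 f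
  rw [evalRep_F_affine 1 (i := f) rfl, inv_one, Units.val_one, one_smul] at hX
  have tz := tau_ne_zero (q := q) f
  refine R2_last_first (fun a ha => ?_) (fun a ha => ?_) hp.symm hX hl hr ?_ ?_ ?_
  · simp only [f, Fin.lt_def, ne_eq, Fin.ext_iff] at *; omega
  · simp only [f, pre, if_true, Fin.lt_def, ne_eq, Fin.ext_iff] at *; omega
  · simp only [if_true, if_neg hp.symm, zero_sub, mul_neg, mul_one, neg_neg,
      sg_eq_one hm (f := f) rfl, tau, ← mul_assoc, sgn_mul_self]
  · have := qz_ne_zero q (dbar m (pre f))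
    simp only [if_true, if_neg hp, sub_zero, mul_one, sg_eq_one hm (f := f) rfl, tau, qz_neg]
    field_simp
  · intro b h1 h2
    simp only [h1, h2, if_false, sub_zero, mul_zero, neg_zero, qz_zero, mul_one,
      sg_eq_one hm (f := f) rfl, sg_eq_sgn hn (f := f) rfl]

theorem Rcheck_YE_lo (hm : 1 ≤ m) (hn : 1 ≤ n) :
    Rcheck m n q j * YE m n d q (lo j) = YE m n d q (hi j) * Rcheck m n q j :=
  leg_lo_hi j (R2_FPi hm hn)

theorem Rcheck_YF_hi (hm : 1 ≤ m) (hn : 1 ≤ n) :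
    Rcheck m n q j * YF m n d q (hi j) = YF m n d q (lo j) * Rcheck m n q j :=
  leg_hi_lo j (R2_EPi hm hn)

theorem Rcheck_comm_YE (hm : 1 ≤ m) (hn : 1 ≤ n) {k : Fin d} (h1 : k ≠ lo j) (h2 : k ≠ hi j) :
    Commute (Rcheck m n q j) (YE m n d q k) := by
  have hl := (isDiag_sig (q := q) 1).mul (isDiag_K (q := q) 1 (rootL (⟨0, by omega⟩ : Fin (m + n))))
  rw [← KPiInv_eq 1 rfl, ← sigV_eq] at hl
  exact leg_comm j hl .one h1 h2

theorem Rcheck_comm_YF (hm : 1 ≤ m) (hn : 1 ≤ n) {k : Fin d} (h1 : k ≠ lo j) (h2 : k ≠ hi j) :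
    Commute (Rcheck m n q j) (YF m n d q k) := by
  have hl := isDiag_sig (m := m) (n := n) (q := q) 1
  have hr := isDiag_K (q := q) 1 (-rootL (⟨0, by omega⟩ : Fin (m + n)))
  rw [← KPi_eq 1 rfl] at hr
  rw [← sigV_eq] at hl
  exact leg_comm j hl hr h1 h2

end Affine
end Generators

/-! ### Laurent polynomials and Demazure operators -/

section Laurent
variable (𝕜 : Type*) [Field 𝕜] (d : ℕ)

/-- The ring `𝕜[y_1^{±1}, …, y_d^{±1}]` of Laurent polynomials, as the group algebra of `ℤ^d`. -/
abbrev Laurent : Type _ := AddMonoidAlgebra 𝕜 (Fin d → ℤ)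

namespace Laurent
variable {𝕜 d}

/-- The variable `y_j`. -/
def Y (𝕜 : Type*) [Field 𝕜] {d : ℕ} (j : Fin d) : Laurent 𝕜 d :=
  AddMonoidAlgebra.single (Pi.single j 1) 1

/-- The inverse of the variable `y_j`. -/
def Yinv (𝕜 : Type*) [Field 𝕜] {d : ℕ} (j : Fin d) : Laurent 𝕜 d :=
  AddMonoidAlgebra.single (-Pi.single j 1) 1

theorem Y_mul_Yinv (j : Fin d) : Y 𝕜 j * Yinv 𝕜 j = 1 := by
  simp [Y, Yinv, AddMonoidAlgebra.single_mul_single, AddMonoidAlgebra.one_def]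

theorem Y_injective : Function.Injective (Y 𝕜 (d := d)) := by
  intro i j h
  have h' : (Pi.single i 1 : Fin d → ℤ) = Pi.single j 1 :=
    AddMonoidAlgebra.single_left_injective one_ne_zero h
  by_contra hij
  have := congrFun h' i
  simp [hij] at this

/-- The variables and their inverses generate all Laurent polynomials. -/
theorem subalgebra_eq_top (S : Subalgebra 𝕜 (Laurent 𝕜 d)) (h : ∀ j, Y 𝕜 j ∈ S)
    (h' : ∀ j, Yinv 𝕜 j ∈ S) : S = ⊤ := by
  have h1 : ∀ (j : Fin d) (z : ℤ), AddMonoidAlgebra.single (Pi.single j z) (1 : 𝕜) ∈ S := by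
    intro j z
    induction z using Int.induction_on with
    | zero => simpa [AddMonoidAlgebra.one_def] using S.one_mem
    | succ k ih =>
      have := S.mul_mem ih (h j)
      rwa [Y, AddMonoidAlgebra.single_mul_single, ← Pi.single_add, one_mul] at this
    | pred k ih =>
      have := S.mul_mem ih (h' j)
      rwa [Yinv, AddMonoidAlgebra.single_mul_single, ← sub_eq_add_neg, ← Pi.single_sub,
        one_mul] at this
  have h2 : ∀ v : Fin d → ℤ, AddMonoidAlgebra.single v (1 : 𝕜) ∈ S := by
    intro v
    have e : AddMonoidAlgebra.single v (1 : 𝕜) =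
        ∏ j, AddMonoidAlgebra.single (Pi.single j (v j)) (1 : 𝕜) := by
      have := map_prod (AddMonoidAlgebra.of 𝕜 (Fin d → ℤ))
        (fun j => Multiplicative.ofAdd (Pi.single j (v j) : Fin d → ℤ)) Finset.univ
      rw [← ofAdd_sum, Finset.univ_sum_single] at this
      exact this
    rw [e]
    exact S.prod_mem fun j _ => h1 j _
  refine eq_top_iff.2 fun p _ => ?_
  induction p using AddMonoidAlgebra.induction_on with
  | of v => exact h2 _
  | add f g hf hg => exact S.add_mem (hf trivial) (hg trivial)
  | smul r f hf => exact S.smul_mem (hf trivial) r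

/-- The action of a permutation of the variables. -/
def perm (σ : Equiv.Perm (Fin d)) : Laurent 𝕜 d →ₐ[𝕜] Laurent 𝕜 d :=
  AddMonoidAlgebra.mapDomainAlgHom 𝕜 𝕜
    ({ toFun := fun v => v ∘ σ.symm
       map_zero' := rfl
       map_add' := fun _ _ => rfl } : (Fin d → ℤ) →+ (Fin d → ℤ))

theorem perm_single (σ : Equiv.Perm (Fin d)) (v : Fin d → ℤ) (r : 𝕜) :
    perm σ (AddMonoidAlgebra.single v r) = AddMonoidAlgebra.single (v ∘ σ.symm) r := by
  simp [perm]

theorem single_comp_symm (σ : Equiv.Perm (Fin d)) (j : Fin d) :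
    (Pi.single j 1 : Fin d → ℤ) ∘ σ.symm = Pi.single (σ j) 1 := by
  ext k
  simp [Pi.single_apply, Equiv.symm_apply_eq]

theorem perm_Y (σ : Equiv.Perm (Fin d)) (j : Fin d) : perm σ (Y 𝕜 j) = Y 𝕜 (σ j) := by
  rw [Y, perm_single, single_comp_symm, Y]

theorem perm_Yinv (σ : Equiv.Perm (Fin d)) (j : Fin d) : perm σ (Yinv 𝕜 j) = Yinv 𝕜 (σ j) := by
  rw [Yinv, perm_single, Yinv, ← single_comp_symm]
  rfl

theorem perm_perm (σ τ : Equiv.Perm (Fin d)) (p : Laurent 𝕜 d) :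
    perm σ (perm τ p) = perm (σ * τ) p := by
  have : (perm σ).comp (perm τ) = perm (𝕜 := 𝕜) (σ * τ) := by
    ext v
    simp only [AlgHom.comp_apply, perm_single]
    rfl
  exact DFunLike.congr_fun this p

theorem perm_one (p : Laurent 𝕜 d) : perm 1 p = p := by
  have : perm (1 : Equiv.Perm (Fin d)) = AlgHom.id 𝕜 (Laurent 𝕜 d) := by
    ext v
    simp only [perm_single]
    rfl
  exact DFunLike.congr_fun this p

/-- Divisibility of `p - s p` by `y_b - y_a`, which makes the Demazure operator well defined. -/
theorem Y_sub_dvd (a b : Fin d) (p : Laurent 𝕜 d) :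
    Y 𝕜 b - Y 𝕜 a ∣ p - perm (Equiv.swap a b) p := by
  let S : Subalgebra 𝕜 (Laurent 𝕜 d) :=
    { carrier := {p | Y 𝕜 b - Y 𝕜 a ∣ p - perm (Equiv.swap a b) p}
      mul_mem' := fun {p p'} h h' => by
        rw [Set.mem_ofPred_eq] at h h' ⊢
        have e : p * p' - perm (Equiv.swap a b) (p * p') =
            (p - perm (Equiv.swap a b) p) * p' +
              perm (Equiv.swap a b) p * (p' - perm (Equiv.swap a b) p') := by
          rw [map_mul]; ring
        rw [e]
        exact dvd_add (h.mul_right _) (h'.mul_left _)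
      add_mem' := fun {p p'} h h' => by
        rw [Set.mem_ofPred_eq] at h h' ⊢
        rw [map_add, add_sub_add_comm]
        exact dvd_add h h'
      algebraMap_mem' := fun r => by
        rw [Set.mem_ofPred_eq, AlgHom.commutes, sub_self]
        exact dvd_zero _ }
  have hmem : ∀ r, r ∈ S ↔ Y 𝕜 b - Y 𝕜 a ∣ r - perm (Equiv.swap a b) r := fun r => Iff.rfl
  have hS : S = ⊤ := by
    refine subalgebra_eq_top S (fun j => ?_) fun j => ?_
    · rw [hmem, perm_Y]
      by_cases h1 : j = a
      · subst h1; rw [Equiv.swap_apply_left, ← neg_sub (Y 𝕜 b), dvd_neg]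
      by_cases h2 : j = b
      · subst h2; rw [Equiv.swap_apply_right]
      rw [Equiv.swap_apply_of_ne_of_ne h1 h2, sub_self]
      exact dvd_zero _
    · rw [hmem, perm_Yinv]
      have e : Yinv 𝕜 a - Yinv 𝕜 b = (Y 𝕜 b - Y 𝕜 a) * (Yinv 𝕜 a * Yinv 𝕜 b) := by
        linear_combination (-Yinv 𝕜 a) * Y_mul_Yinv (𝕜 := 𝕜) b +
          Yinv 𝕜 b * Y_mul_Yinv (𝕜 := 𝕜) a
      by_cases h1 : j = a
      · subst h1; rw [Equiv.swap_apply_left, e]; exact dvd_mul_right _ _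
      by_cases h2 : j = b
      · subst h2; rw [Equiv.swap_apply_right, ← neg_sub (Yinv 𝕜 a), dvd_neg, e]; exact dvd_mul_right _ _
      rw [Equiv.swap_apply_of_ne_of_ne h1 h2, sub_self]
      exact dvd_zero _
  have : p ∈ S := hS ▸ trivial
  exact this

theorem Y_sub_ne_zero {a b : Fin d} (h : a ≠ b) : Y 𝕜 b - Y 𝕜 a ≠ 0 :=
  sub_ne_zero.2 fun e => h (Y_injective e).symm

/-- The Demazure operator `p ↦ y_b (p - s p) / (y_b - y_a)`, where `s` exchanges `y_a` and `y_b`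
(and junk for `a = b`). -/
def D (a b : Fin d) (p : Laurent 𝕜 d) : Laurent 𝕜 d := Y 𝕜 b * (Y_sub_dvd a b p).choose

theorem D_spec (a b : Fin d) (p : Laurent 𝕜 d) :
    (Y 𝕜 b - Y 𝕜 a) * D a b p = Y 𝕜 b * (p - perm (Equiv.swap a b) p) := by
  rw [D, mul_left_comm, ← (Y_sub_dvd a b p).choose_spec]

theorem D_unique {a b : Fin d} (h : a ≠ b) {p r : Laurent 𝕜 d}
    (hr : (Y 𝕜 b - Y 𝕜 a) * r = Y 𝕜 b * (p - perm (Equiv.swap a b) p)) : r = D a b p :=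
  mul_left_cancel₀ (Y_sub_ne_zero h) (hr.trans (D_spec a b p).symm)

theorem D_add {a b : Fin d} (h : a ≠ b) (p p' : Laurent 𝕜 d) :
    D a b (p + p') = D a b p + D a b p' := by
  refine (D_unique h ?_).symm
  rw [map_add]
  linear_combination D_spec a b p + D_spec a b p'

theorem D_sub {a b : Fin d} (h : a ≠ b) (p p' : Laurent 𝕜 d) :
    D a b (p - p') = D a b p - D a b p' := by
  refine (D_unique h ?_).symm
  rw [map_sub]
  linear_combination D_spec a b p - D_spec a b p'

theorem D_smul {a b : Fin d} (h : a ≠ b) (r : 𝕜) (p : Laurent 𝕜 d) :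
    D a b (r • p) = r • D a b p := by
  refine (D_unique h ?_).symm
  rw [mul_smul_comm, D_spec, map_smul, ← smul_sub, mul_smul_comm]

theorem perm_D (σ : Equiv.Perm (Fin d)) {a b : Fin d} (h : a ≠ b) (p : Laurent 𝕜 d) :
    perm σ (D a b p) = D (σ a) (σ b) (perm σ p) := by
  refine D_unique (σ.injective.ne h) ?_
  have e := congrArg (perm σ) (D_spec a b p)
  simp only [map_mul, map_sub, perm_Y, perm_perm] at e
  rw [e, perm_perm, Equiv.mul_swap_eq_swap_mul]

/-- In a field containing the Laurent polynomials, the Demazure operator is given by its fraction;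
the braid relations are checked there. -/
theorem algebraMap_D {F : Type*} [Field F] [Algebra (Laurent 𝕜 d) F]
    (hF : Function.Injective (algebraMap (Laurent 𝕜 d) F)) {a b : Fin d} (h : a ≠ b)
    (p : Laurent 𝕜 d) :
    algebraMap (Laurent 𝕜 d) F (D a b p) = algebraMap _ F (Y 𝕜 b) * (algebraMap _ F p -
      algebraMap _ F (perm (Equiv.swap a b) p)) /
        (algebraMap _ F (Y 𝕜 b) - algebraMap _ F (Y 𝕜 a)) := by
  have h' : algebraMap _ F (Y 𝕜 b) - algebraMap _ F (Y 𝕜 a) ≠ 0 := by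
    rw [← map_sub]
    exact (map_ne_zero_iff _ hF).2 (Y_sub_ne_zero h)
  rw [eq_div_iff h', mul_comm]
  simpa only [map_mul, map_sub] using congrArg (algebraMap _ F) (D_spec a b p)

theorem D_Y_mul {a b : Fin d} (h : a ≠ b) (p : Laurent 𝕜 d) :
    D a b (Y 𝕜 a * p) = Y 𝕜 b * D a b p - Y 𝕜 b * p := by
  refine (D_unique h ?_).symm
  rw [map_mul, perm_Y, Equiv.swap_apply_left]
  linear_combination Y 𝕜 b * D_spec a b p

theorem D_Y_mul_of_ne {a b j : Fin d} (h : a ≠ b) (h1 : j ≠ a) (h2 : j ≠ b) (p : Laurent 𝕜 d) :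
    D a b (Y 𝕜 j * p) = Y 𝕜 j * D a b p := by
  refine (D_unique h ?_).symm
  rw [map_mul, perm_Y, Equiv.swap_apply_of_ne_of_ne h1 h2]
  linear_combination Y 𝕜 j * D_spec a b p

theorem D_one {a b : Fin d} (h : a ≠ b) : D a b (1 : Laurent 𝕜 d) = 0 := by
  refine (D_unique h ?_).symm
  simp

section Relations
variable {a b : Fin d}

theorem swap_swap (p : Laurent 𝕜 d) : perm (Equiv.swap a b) (perm (Equiv.swap a b) p) = p := by
  rw [perm_perm, Equiv.swap_mul_self, perm_one]

theorem D_D (h : a ≠ b) (p : Laurent 𝕜 d) : D a b (D a b p) = D a b p := by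
  refine (D_unique h ?_).symm
  have e := D_spec b a (perm (Equiv.swap a b) p)
  rw [Equiv.swap_comm b a, swap_swap] at e
  rw [perm_D _ h, Equiv.swap_apply_left, Equiv.swap_apply_right]
  refine mul_left_cancel₀ (Y_sub_ne_zero h) ?_
  linear_combination (Y 𝕜 b - Y 𝕜 a) * D_spec a b p - Y 𝕜 b * D_spec a b p - Y 𝕜 b * e

/-- The relation `1 + s ∂ + ∂ s = s`. -/
theorem swap_D_add (h : a ≠ b) (p : Laurent 𝕜 d) :
    p + perm (Equiv.swap a b) (D a b p) + D a b (perm (Equiv.swap a b) p) =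
      perm (Equiv.swap a b) p := by
  have e := D_spec b a (perm (Equiv.swap a b) p)
  have e' := D_spec a b (perm (Equiv.swap a b) p)
  rw [Equiv.swap_comm b a, swap_swap] at e
  rw [swap_swap] at e'
  rw [perm_D _ h, Equiv.swap_apply_left, Equiv.swap_apply_right]
  refine mul_left_cancel₀ (Y_sub_ne_zero h) ?_
  linear_combination -e + e'

end Relations

section Braid
variable {a b c : Fin d}

theorem swap_outer (hac : a ≠ c) (hbc : b ≠ c) (p : Laurent 𝕜 d) : perm (Equiv.swap a c) p =
    perm (Equiv.swap a b) (perm (Equiv.swap b c) (perm (Equiv.swap a b) p)) := by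
  rw [perm_perm, perm_perm]
  congr 1
  rw [Equiv.swap_comm a b, Equiv.swap_comm b c, Equiv.swap_mul_swap_mul_swap hbc.symm hac.symm]

theorem swap_braid (hab : a ≠ b) (hac : a ≠ c) (hbc : b ≠ c) (p : Laurent 𝕜 d) :
    perm (Equiv.swap b c) (perm (Equiv.swap a b) (perm (Equiv.swap b c) p)) =
      perm (Equiv.swap a b) (perm (Equiv.swap b c) (perm (Equiv.swap a b) p)) := by
  rw [← swap_outer hac hbc, Equiv.swap_comm b c, Equiv.swap_comm a b,
    ← swap_outer hac.symm hab.symm, Equiv.swap_comm]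

theorem injective_fractionRing :
    Function.Injective (algebraMap (Laurent 𝕜 d) (FractionRing (Laurent 𝕜 d))) :=
  IsFractionRing.injective _ _

theorem algebraMap_Y_sub_ne_zero (h : a ≠ b) :
    algebraMap (Laurent 𝕜 d) (FractionRing (Laurent 𝕜 d)) (Y 𝕜 b) - algebraMap _ _ (Y 𝕜 a) ≠ 0 := by
  rw [← map_sub]
  exact (map_ne_zero_iff _ injective_fractionRing).2 (Y_sub_ne_zero h)

theorem D_braid (hab : a ≠ b) (hac : a ≠ c) (hbc : b ≠ c) (p : Laurent 𝕜 d) :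
    D a b (D b c (D a b p)) = D b c (D a b (D b c p)) := by
  have hF := injective_fractionRing (𝕜 := 𝕜) (d := d)
  have n1 := algebraMap_Y_sub_ne_zero (𝕜 := 𝕜) hab
  have n2 := algebraMap_Y_sub_ne_zero (𝕜 := 𝕜) hac
  have n3 := algebraMap_Y_sub_ne_zero (𝕜 := 𝕜) hbc
  have n1' := algebraMap_Y_sub_ne_zero (𝕜 := 𝕜) hab.symm
  have n2' := algebraMap_Y_sub_ne_zero (𝕜 := 𝕜) hac.symm
  have n3' := algebraMap_Y_sub_ne_zero (𝕜 := 𝕜) hbc.symm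
  apply hF
  simp only [algebraMap_D hF, hab, hbc, hac, hab.symm, hac.symm, hbc.symm, perm_D, ne_eq,
    not_false_eq_true, Equiv.swap_apply_left, Equiv.swap_apply_right,
    Equiv.swap_apply_of_ne_of_ne, swap_outer hac hbc, swap_braid hab hac hbc, swap_swap,
    Equiv.swap_comm b a, Equiv.swap_comm c b]
  field_simp
  ring

/-- The relation `s₁ ∂₂ s₁ + s₁ ∂₂ ∂₁ + ∂₁ ∂₂ s₁ = ∂₂ s₁ ∂₂`. -/
theorem D_swap_D (hab : a ≠ b) (hac : a ≠ c) (hbc : b ≠ c) (p : Laurent 𝕜 d) :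
    perm (Equiv.swap a b) (D b c (perm (Equiv.swap a b) p)) +
      perm (Equiv.swap a b) (D b c (D a b p)) + D a b (D b c (perm (Equiv.swap a b) p)) =
        D b c (perm (Equiv.swap a b) (D b c p)) := by
  have hF := injective_fractionRing (𝕜 := 𝕜) (d := d)
  have n1 := algebraMap_Y_sub_ne_zero (𝕜 := 𝕜) hab
  have n2 := algebraMap_Y_sub_ne_zero (𝕜 := 𝕜) hac
  have n3 := algebraMap_Y_sub_ne_zero (𝕜 := 𝕜) hbc
  have n1' := algebraMap_Y_sub_ne_zero (𝕜 := 𝕜) hab.symm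
  have n2' := algebraMap_Y_sub_ne_zero (𝕜 := 𝕜) hac.symm
  have n3' := algebraMap_Y_sub_ne_zero (𝕜 := 𝕜) hbc.symm
  apply hF
  simp only [map_add, algebraMap_D hF, hab, hbc, hac, hab.symm, hac.symm, hbc.symm, perm_D, ne_eq,
    not_false_eq_true, Equiv.swap_apply_left, Equiv.swap_apply_right,
    Equiv.swap_apply_of_ne_of_ne, swap_outer hac hbc, swap_braid hab hac hbc, swap_swap,
    Equiv.swap_comm b a]
  field_simp
  ring

/-- The relation `s₂ ∂₁ s₂ + s₂ ∂₁ ∂₂ + ∂₂ ∂₁ s₂ = ∂₁ s₂ ∂₁`. -/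
theorem D_swap_D' (hab : a ≠ b) (hac : a ≠ c) (hbc : b ≠ c) (p : Laurent 𝕜 d) :
    perm (Equiv.swap b c) (D a b (perm (Equiv.swap b c) p)) +
      perm (Equiv.swap b c) (D a b (D b c p)) + D b c (D a b (perm (Equiv.swap b c) p)) =
        D a b (perm (Equiv.swap b c) (D a b p)) := by
  have hF := injective_fractionRing (𝕜 := 𝕜) (d := d)
  have n1 := algebraMap_Y_sub_ne_zero (𝕜 := 𝕜) hab
  have n2 := algebraMap_Y_sub_ne_zero (𝕜 := 𝕜) hac
  have n3 := algebraMap_Y_sub_ne_zero (𝕜 := 𝕜) hbc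
  have n1' := algebraMap_Y_sub_ne_zero (𝕜 := 𝕜) hab.symm
  have n2' := algebraMap_Y_sub_ne_zero (𝕜 := 𝕜) hac.symm
  have n3' := algebraMap_Y_sub_ne_zero (𝕜 := 𝕜) hbc.symm
  apply hF
  simp only [map_add, algebraMap_D hF, hab, hbc, hac, hab.symm, hac.symm, hbc.symm, perm_D, ne_eq,
    not_false_eq_true, Equiv.swap_apply_left, Equiv.swap_apply_right,
    Equiv.swap_apply_of_ne_of_ne, swap_outer hac hbc, swap_braid hab hac hbc, swap_swap,
    Equiv.swap_comm c b]
  field_simp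
  ring

end Braid

theorem D_comm {a b a' b' : Fin d} (h : a ≠ b) (h' : a' ≠ b') (h1 : a ≠ a') (h2 : a ≠ b')
    (h3 : b ≠ a') (h4 : b ≠ b') (p : Laurent 𝕜 d) : D a b (D a' b' p) = D a' b' (D a b p) := by
  refine D_unique h' ?_
  rw [sub_mul, ← D_Y_mul_of_ne h h2.symm h4.symm, ← D_Y_mul_of_ne h h1.symm h3.symm, ← D_sub h,
    ← sub_mul, D_spec, D_Y_mul_of_ne h h2.symm h4.symm, D_sub h, perm_D _ h,
    Equiv.swap_apply_of_ne_of_ne h1 h2, Equiv.swap_apply_of_ne_of_ne h3 h4]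

end Laurent
end Laurent

/-! ### The Bernstein presentation: induced modules of the affine Hecke algebra -/

section Bernstein
variable {𝕜 : Type*} [Field 𝕜]

section Abstract
variable {A B : Type*} [Ring A] [Algebra 𝕜 A] [Ring B] [Algebra 𝕜 B] {h : 𝕜}

/-- The braid relation for `s_i ⊗ R_i + h ∂_i ⊗ 1`.  The hypotheses on `s_i` and `∂_i` are what is
left on the first tensor factor when the `R_i` satisfy the Hecke relations. -/
theorem tensor_braid {s₁ s₂ d₁ d₂ : A} {R₁ R₂ : B}
    (hs : s₂ * s₁ * s₂ = s₁ * s₂ * s₁) (e₁ : d₂ * s₁ * s₂ = s₁ * s₂ * d₁)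
    (e₂ : s₂ * s₁ * d₂ = d₁ * s₂ * s₁) (e₃ : s₂ * d₁ * s₂ = s₁ * d₂ * s₁)
    (e₄ : d₂ * s₁ * d₂ = s₁ * d₂ * s₁ + s₁ * d₂ * d₁ + d₁ * d₂ * s₁)
    (e₅ : d₁ * s₂ * d₁ = s₁ * d₂ * s₁ + s₂ * d₁ * d₂ + d₂ * d₁ * s₂)
    (e₆ : d₂ * d₁ * d₂ = d₁ * d₂ * d₁) (hR : R₂ * R₁ * R₂ = R₁ * R₂ * R₁)
    (q₁ : R₁ * R₁ = h • R₁ + 1) (q₂ : R₂ * R₂ = h • R₂ + 1) :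
    (s₁ ⊗ₜ[𝕜] R₁ + h • (d₁ ⊗ₜ 1)) * (s₂ ⊗ₜ R₂ + h • (d₂ ⊗ₜ 1)) * (s₁ ⊗ₜ R₁ + h • (d₁ ⊗ₜ 1)) =
      (s₂ ⊗ₜ[𝕜] R₂ + h • (d₂ ⊗ₜ 1)) * (s₁ ⊗ₜ R₁ + h • (d₁ ⊗ₜ 1)) *
        (s₂ ⊗ₜ R₂ + h • (d₂ ⊗ₜ 1)) := by
  simp only [mul_add, add_mul, Algebra.TensorProduct.tmul_mul_tmul, smul_mul_assoc, mul_smul_comm,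
    mul_one, one_mul, hs, e₁, e₂, e₃, e₄, e₅, e₆, hR, q₁, q₂, TensorProduct.tmul_add,
    TensorProduct.tmul_smul, TensorProduct.add_tmul, smul_add, smul_smul]
  module

theorem tensor_comm {s₁ s₂ d₁ d₂ : A} {R₁ R₂ : B} (hs : s₁ * s₂ = s₂ * s₁)
    (e₁ : s₁ * d₂ = d₂ * s₁) (e₂ : d₁ * s₂ = s₂ * d₁) (hd : d₁ * d₂ = d₂ * d₁)
    (hR : R₁ * R₂ = R₂ * R₁) :
    (s₁ ⊗ₜ[𝕜] R₁ + h • (d₁ ⊗ₜ 1)) * (s₂ ⊗ₜ R₂ + h • (d₂ ⊗ₜ 1)) =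
      (s₂ ⊗ₜ[𝕜] R₂ + h • (d₂ ⊗ₜ 1)) * (s₁ ⊗ₜ R₁ + h • (d₁ ⊗ₜ 1)) := by
  simp only [mul_add, add_mul, Algebra.TensorProduct.tmul_mul_tmul, smul_mul_assoc, mul_smul_comm,
    mul_one, one_mul, hs, e₁, e₂, hd, hR]
  module

/-- The quadratic relation for `s ⊗ R + h ∂ ⊗ 1`. -/
theorem tensor_quad {s δ : A} {R : B} (hs : s * s = 1) (hd : δ * δ = δ) (e : 1 + s * δ + δ * s = s)
    (hR : R * R = h • R + 1) :
    (s ⊗ₜ[𝕜] R + h • (δ ⊗ₜ 1)) * (s ⊗ₜ R + h • (δ ⊗ₜ 1)) =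
      h • (s ⊗ₜ R + h • (δ ⊗ₜ 1)) + 1 := by
  have e' : s ⊗ₜ[𝕜] R = 1 ⊗ₜ R + (s * δ) ⊗ₜ R + (δ * s) ⊗ₜ R := by
    rw [← TensorProduct.add_tmul, ← TensorProduct.add_tmul, e]
  simp only [mul_add, add_mul, Algebra.TensorProduct.tmul_mul_tmul, smul_mul_assoc, mul_smul_comm,
    mul_one, one_mul, hs, hd, hR, TensorProduct.tmul_add, TensorProduct.tmul_smul]
  rw [smul_add, smul_smul, e', Algebra.TensorProduct.one_def]
  module

theorem tensor_T_y_T {s δ y y' : A} {R : B} (hs : s * s = 1) (hd : δ * δ = δ)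
    (e : 1 + s * δ + δ * s = s) (hR : R * R = h • R + 1) (sy : s * y = y' * s)
    (dy : δ * y = y' * δ - y') :
    (s ⊗ₜ[𝕜] R + h • (δ ⊗ₜ 1)) * (y ⊗ₜ 1) * (s ⊗ₜ R + h • (δ ⊗ₜ 1)) = y' ⊗ₜ 1 := by
  have e' : (y' * s) ⊗ₜ[𝕜] R = y' ⊗ₜ R + (y' * (s * δ)) ⊗ₜ R + (y' * (δ * s)) ⊗ₜ R := by
    rw [← TensorProduct.add_tmul, ← TensorProduct.add_tmul]
    nth_rewrite 1 [← e]
    rw [mul_add, mul_add, mul_one]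
  simp only [mul_add, add_mul, Algebra.TensorProduct.tmul_mul_tmul, smul_mul_assoc, mul_smul_comm,
    mul_one, one_mul, sy, dy, hR, TensorProduct.tmul_add, TensorProduct.tmul_smul,
    TensorProduct.sub_tmul, sub_mul, mul_assoc, hs, hd, smul_sub, sub_self]
  rw [e']
  module

end Abstract

section Induced
variable {d : ℕ} {q : 𝕜ˣ}
open Laurent

/-- The exchange of `y_i` and `y_{i+1}`. -/
def sOp (𝕜 : Type*) [Field 𝕜] {d : ℕ} (i : Fin (d - 1)) : Module.End 𝕜 (Laurent 𝕜 d) :=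
  (perm (Equiv.swap (lo i) (hi i))).toLinearMap

/-- The Demazure operator for `y_i` and `y_{i+1}`. -/
def dOp (𝕜 : Type*) [Field 𝕜] {d : ℕ} (i : Fin (d - 1)) : Module.End 𝕜 (Laurent 𝕜 d) where
  toFun := D (lo i) (hi i)
  map_add' := D_add (lo_ne_hi i)
  map_smul' := D_smul (lo_ne_hi i)

/-- Multiplication by a Laurent polynomial. -/
def yOp (p : Laurent 𝕜 d) : Module.End 𝕜 (Laurent 𝕜 d) := LinearMap.mulLeft 𝕜 p

theorem sOp_apply (i : Fin (d - 1)) (p : Laurent 𝕜 d) :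
    sOp 𝕜 i p = perm (Equiv.swap (lo i) (hi i)) p := rfl

theorem dOp_apply (i : Fin (d - 1)) (p : Laurent 𝕜 d) : dOp 𝕜 i p = D (lo i) (hi i) p := rfl

theorem yOp_apply (p r : Laurent 𝕜 d) : yOp p r = p * r := rfl

variable {B : Type*} [Ring B] [Algebra 𝕜 B]

/-- The images of the generators of the affine Hecke algebra in the Bernstein representation: `T̂_i`
acts by `s_i ⊗ R_i + (q - q⁻¹) ∂_i ⊗ 1`, and the `y_j` act by multiplication. -/
def bernsteinGen (q : 𝕜ˣ) (R : Fin (d - 1) → B) : HGen d → Module.End 𝕜 (Laurent 𝕜 d) ⊗[𝕜] B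
  | .T i => sOp 𝕜 i ⊗ₜ R i + (qz q 1 - qz q (-1)) • (dOp 𝕜 i ⊗ₜ 1)
  | .y j => yOp (Y 𝕜 j) ⊗ₜ 1
  | .yinv j => yOp (Yinv 𝕜 j) ⊗ₜ 1

theorem bernstein_rel {R : Fin (d - 1) → B} (hR : HeckeRelations d q R) {x y : FreeAlgebra 𝕜 (HGen d)}
    (hxy : AffHeckeRel d q x y) : FreeAlgebra.lift 𝕜 (bernsteinGen q R) x =
      FreeAlgebra.lift 𝕜 (bernsteinGen q R) y := by
  have hs : ∀ i : Fin (d - 1), sOp 𝕜 i * sOp 𝕜 i = 1 := fun i => LinearMap.ext fun p => swap_swap p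
  have hd : ∀ i : Fin (d - 1), dOp 𝕜 i * dOp 𝕜 i = dOp 𝕜 i := fun i =>
    LinearMap.ext fun p => D_D (lo_ne_hi i) p
  have he : ∀ i : Fin (d - 1), 1 + sOp 𝕜 i * dOp 𝕜 i + dOp 𝕜 i * sOp 𝕜 i = sOp 𝕜 i := fun i =>
    LinearMap.ext fun p => swap_D_add (lo_ne_hi i) p
  cases hxy with
  | braid i j h =>
    simp only [map_mul, FreeAlgebra.lift_ι_apply, bernsteinGen]
    have e : lo j = hi i := Fin.ext h.symm
    have n1 : lo i ≠ hi i := lo_ne_hi i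
    have n2 : hi i ≠ hi j := by simp only [hi, ne_eq, Fin.ext_iff]; omega
    have n3 : lo i ≠ hi j := by simp only [lo, hi, ne_eq, Fin.ext_iff]; omega
    have f₁ (p : Laurent 𝕜 d) : D (hi i) (hi j) (perm (Equiv.swap (lo i) (hi i))
        (perm (Equiv.swap (hi i) (hi j)) p)) = perm (Equiv.swap (lo i) (hi i))
          (perm (Equiv.swap (hi i) (hi j)) (D (lo i) (hi i) p)) := by
      rw [perm_D _ n1, Equiv.swap_apply_of_ne_of_ne n1 n3, Equiv.swap_apply_left, perm_D _ n3,
        Equiv.swap_apply_left, Equiv.swap_apply_of_ne_of_ne n3.symm n2.symm]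
    have f₂ (p : Laurent 𝕜 d) : perm (Equiv.swap (hi i) (hi j)) (perm (Equiv.swap (lo i) (hi i))
        (D (hi i) (hi j) p)) = D (lo i) (hi i) (perm (Equiv.swap (hi i) (hi j))
          (perm (Equiv.swap (lo i) (hi i)) p)) := by
      rw [perm_D _ n2, Equiv.swap_apply_right, Equiv.swap_apply_of_ne_of_ne n3.symm n2.symm,
        perm_D _ n3, Equiv.swap_apply_of_ne_of_ne n1 n3, Equiv.swap_apply_right]
    have f₃ (p : Laurent 𝕜 d) : perm (Equiv.swap (hi i) (hi j)) (D (lo i) (hi i)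
        (perm (Equiv.swap (hi i) (hi j)) p)) = perm (Equiv.swap (lo i) (hi i))
          (D (hi i) (hi j) (perm (Equiv.swap (lo i) (hi i)) p)) := by
      rw [perm_D _ n1, Equiv.swap_apply_of_ne_of_ne n1 n3, Equiv.swap_apply_left, swap_swap,
        perm_D _ n2, Equiv.swap_apply_right, Equiv.swap_apply_of_ne_of_ne n3.symm n2.symm,
        swap_swap]
    refine tensor_braid ?_ ?_ ?_ ?_ ?_ ?_ ?_ (hR.braid i j h).symm (hR.quad i) (hR.quad j) <;>
      refine LinearMap.ext fun p => ?_ <;>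
      simp only [Module.End.mul_apply, LinearMap.add_apply, sOp_apply, dOp_apply, e]
    · exact swap_braid n1 n3 n2 p
    · exact f₁ p
    · exact f₂ p
    · exact f₃ p
    · exact (D_swap_D n1 n3 n2 p).symm
    · rw [← f₃]
      exact (D_swap_D' n1 n3 n2 p).symm
    · exact (D_braid n1 n3 n2 p).symm
  | comm i j h =>
    simp only [map_mul, FreeAlgebra.lift_ι_apply, bernsteinGen]
    have n1 : lo i ≠ lo j := by simp only [lo, ne_eq, Fin.ext_iff]; omega
    have n2 : lo i ≠ hi j := by simp only [lo, hi, ne_eq, Fin.ext_iff]; omega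
    have n3 : hi i ≠ lo j := by simp only [lo, hi, ne_eq, Fin.ext_iff]; omega
    have n4 : hi i ≠ hi j := by simp only [hi, ne_eq, Fin.ext_iff]; omega
    refine tensor_comm ?_ ?_ ?_ ?_ (hR.comm i j h) <;> refine LinearMap.ext fun p => ?_ <;>
      simp only [Module.End.mul_apply, sOp_apply, dOp_apply]
    · rw [perm_perm, perm_perm, Equiv.mul_swap_eq_swap_mul,
        Equiv.swap_apply_of_ne_of_ne n1.symm n3.symm, Equiv.swap_apply_of_ne_of_ne n2.symm n4.symm]
    · rw [perm_D _ (lo_ne_hi j), Equiv.swap_apply_of_ne_of_ne n1.symm n3.symm,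
        Equiv.swap_apply_of_ne_of_ne n2.symm n4.symm]
    · rw [perm_D _ (lo_ne_hi i), Equiv.swap_apply_of_ne_of_ne n1 n2,
        Equiv.swap_apply_of_ne_of_ne n3 n4]
    · exact D_comm (lo_ne_hi i) (lo_ne_hi j) n1 n2 n3 n4 p
  | quad i =>
    simp only [map_mul, map_add, map_smul, map_one, FreeAlgebra.lift_ι_apply, bernsteinGen]
    exact tensor_quad (hs i) (hd i) (he i) (hR.quad i)
  | y_yinv j =>
    simp only [map_mul, map_one, FreeAlgebra.lift_ι_apply, bernsteinGen,
      Algebra.TensorProduct.tmul_mul_tmul, mul_one, Algebra.TensorProduct.one_def]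
    congr 1
    refine LinearMap.ext fun p => ?_
    rw [Module.End.mul_apply, yOp_apply, yOp_apply, ← mul_assoc, Y_mul_Yinv, one_mul]
    rfl
  | yinv_y j =>
    simp only [map_mul, map_one, FreeAlgebra.lift_ι_apply, bernsteinGen,
      Algebra.TensorProduct.tmul_mul_tmul, mul_one, Algebra.TensorProduct.one_def]
    congr 1
    refine LinearMap.ext fun p => ?_
    rw [Module.End.mul_apply, yOp_apply, yOp_apply, ← mul_assoc, mul_comm (Yinv 𝕜 j), Y_mul_Yinv,
      one_mul]
    rfl
  | y_y j k =>
    simp only [map_mul, FreeAlgebra.lift_ι_apply, bernsteinGen,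
      Algebra.TensorProduct.tmul_mul_tmul, mul_one]
    congr 1
    refine LinearMap.ext fun p => ?_
    simp only [Module.End.mul_apply, yOp_apply]
    ring
  | y_T j i h1 h2 =>
    have e₁ : yOp (Y 𝕜 j) * sOp 𝕜 i = sOp 𝕜 i * yOp (Y 𝕜 j) := LinearMap.ext fun p => by
      simp only [Module.End.mul_apply, yOp_apply, sOp_apply, map_mul, perm_Y,
        Equiv.swap_apply_of_ne_of_ne h1 h2]
    have e₂ : yOp (Y 𝕜 j) * dOp 𝕜 i = dOp 𝕜 i * yOp (Y 𝕜 j) := LinearMap.ext fun p => by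
      simp only [Module.End.mul_apply, yOp_apply, dOp_apply, D_Y_mul_of_ne (lo_ne_hi i) h1 h2]
    simp only [map_mul, FreeAlgebra.lift_ι_apply, bernsteinGen, mul_add, add_mul,
      Algebra.TensorProduct.tmul_mul_tmul, mul_one, one_mul, mul_smul_comm, smul_mul_assoc, e₁, e₂]
  | T_y_T i =>
    simp only [map_mul, FreeAlgebra.lift_ι_apply, bernsteinGen]
    refine tensor_T_y_T (hs i) (hd i) (he i) (hR.quad i) ?_ ?_ <;> refine LinearMap.ext fun p => ?_
    · simp only [Module.End.mul_apply, yOp_apply, sOp_apply, map_mul, perm_Y,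
        Equiv.swap_apply_left]
    · simp only [Module.End.mul_apply, LinearMap.sub_apply, yOp_apply, dOp_apply,
        D_Y_mul (lo_ne_hi i)]

/-- The Bernstein representation: a representation `R` of the finite Hecke algebra induces one of
the affine Hecke algebra on Laurent polynomials with coefficients in the representation space. -/
def bernstein {R : Fin (d - 1) → B} (hR : HeckeRelations d q R) :
    AffHecke d q →ₐ[𝕜] Module.End 𝕜 (Laurent 𝕜 d) ⊗[𝕜] B :=
  RingQuot.liftAlgHom 𝕜 ⟨FreeAlgebra.lift 𝕜 (bernsteinGen q R), fun _ _ h => bernstein_rel hR h⟩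

end Induced

section Induction
variable {X : Type*} {r : FreeAlgebra 𝕜 X → FreeAlgebra 𝕜 X → Prop}

theorem ringQuot_induction {P : RingQuot r → Prop} (hc : ∀ c : 𝕜, P (algebraMap 𝕜 _ c))
    (hg : ∀ x, P (RingQuot.mkAlgHom 𝕜 r (FreeAlgebra.ι 𝕜 x)))
    (hmul : ∀ a b, P a → P b → P (a * b)) (hadd : ∀ a b, P a → P b → P (a + b)) (x : RingQuot r) :
    P x := by
  obtain ⟨x, rfl⟩ := RingQuot.mkAlgHom_surjective 𝕜 r x
  induction x using FreeAlgebra.induction with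
  | grade0 c => rw [AlgHom.commutes]; exact hc c
  | grade1 x => exact hg x
  | mul a b ha hb => rw [map_mul]; exact hmul _ _ ha hb
  | add a b ha hb => rw [map_add]; exact hadd _ _ ha hb

end Induction
end Bernstein

/-! ### The kernel of the canonical map -/

section Inverse
variable {𝕜 : Type*} [Field 𝕜] (m n d : ℕ) (q : 𝕜ˣ)
open Laurent

/-- The affine Hecke algebra acting on Laurent polynomials with coefficients in `V^{⊗ d}`. -/
def affRep : AffHecke d q →ₐ[𝕜] Module.End 𝕜 (Laurent 𝕜 d ⊗[𝕜] VT 𝕜 m n d) :=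
  AlgHom.comp (B := Module.End 𝕜 (Laurent 𝕜 d) ⊗[𝕜] Module.End 𝕜 (VT 𝕜 m n d))
    (Module.endTensorEndAlgHom (R := 𝕜) (S := 𝕜) (A := 𝕜))
    (bernstein (B := Module.End 𝕜 (VT 𝕜 m n d)) (Rcheck_relations m n q))

theorem bernstein_gen {B : Type*} [Ring B] [Algebra 𝕜 B] {R : Fin (d - 1) → B}
    (hR : HeckeRelations d q R) (g : HGen d) :
    bernstein hR (RingQuot.mkAlgHom 𝕜 (AffHeckeRel d q) (.ι 𝕜 g)) = bernsteinGen q R g := by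
  rw [bernstein, RingQuot.liftAlgHom_mkAlgHom_apply, FreeAlgebra.lift_ι_apply]

theorem affRep_T (i : Fin (d - 1)) (p : Laurent 𝕜 d) (v : VT 𝕜 m n d) :
    affRep m n d q (AffHecke.T q i) (p ⊗ₜ v) = sOp 𝕜 i p ⊗ₜ Rcheck m n q i v +
      (qz q 1 - qz q (-1)) • (dOp 𝕜 i p ⊗ₜ v) := by
  have h := bernstein_gen (B := Module.End 𝕜 (VT 𝕜 m n d)) d q (Rcheck_relations m n q) (.T i)
  change Module.endTensorEndAlgHom (R := 𝕜) (S := 𝕜) (A := 𝕜) (bernstein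
    (B := Module.End 𝕜 (VT 𝕜 m n d)) (Rcheck_relations m n q) (AffHecke.T q i)) (p ⊗ₜ v) = _
  rw [AffHecke.T, h, bernsteinGen, map_add, map_smul]
  rfl

theorem affRep_y (j : Fin d) (p : Laurent 𝕜 d) (v : VT 𝕜 m n d) :
    affRep m n d q (AffHecke.y q j) (p ⊗ₜ v) = (Y 𝕜 j * p) ⊗ₜ v := by
  have h := bernstein_gen (B := Module.End 𝕜 (VT 𝕜 m n d)) d q (Rcheck_relations m n q) (.y j)
  change Module.endTensorEndAlgHom (R := 𝕜) (S := 𝕜) (A := 𝕜) (bernstein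
    (B := Module.End 𝕜 (VT 𝕜 m n d)) (Rcheck_relations m n q) (AffHecke.y q j)) (p ⊗ₜ v) = _
  rw [AffHecke.y, h, bernsteinGen]
  rfl

theorem ofHecke_T (i : Fin (d - 1)) : AffHecke.ofHecke d q (Hecke.T q i) = AffHecke.T q i := by
  rw [AffHecke.ofHecke, Hecke.lift, Hecke.T, RingQuot.liftAlgHom_mkAlgHom_apply,
    FreeAlgebra.lift_ι_apply]

theorem heckeRep_T (i : Fin (d - 1)) : heckeRep m n q d (Hecke.T q i) = Rcheck m n q i := by
  rw [heckeRep, Hecke.lift, Hecke.T]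
  exact (RingQuot.liftAlgHom_mkAlgHom_apply ..).trans (FreeAlgebra.lift_ι_apply ..)

variable {d q} in
theorem Hecke.induction {P : Hecke d q → Prop} (hc : ∀ c : 𝕜, P (algebraMap 𝕜 _ c))
    (hT : ∀ i, P (Hecke.T q i)) (hmul : ∀ a b, P a → P b → P (a * b))
    (hadd : ∀ a b, P a → P b → P (a + b)) (x : Hecke d q) : P x :=
  ringQuot_induction hc hT hmul hadd x

/-- The subspace `1 ⊗ V^{⊗ d}` carries the original action of the finite Hecke algebra. -/
theorem affRep_ofHecke (h : Hecke d q) (v : VT 𝕜 m n d) :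
    affRep m n d q (AffHecke.ofHecke d q h) ((1 : Laurent 𝕜 d) ⊗ₜ v) =
      (1 : Laurent 𝕜 d) ⊗ₜ heckeRep m n q d h v := by
  induction h using Hecke.induction generalizing v with
  | hc c =>
    rw [AlgHom.commutes, AlgHom.commutes, AlgHom.commutes, Module.algebraMap_end_apply,
      Module.algebraMap_end_apply, TensorProduct.tmul_smul]
  | hT i =>
    rw [ofHecke_T, affRep_T, heckeRep_T, dOp_apply, D_one (lo_ne_hi i), sOp_apply, map_one,
      TensorProduct.zero_tmul, smul_zero, add_zero]
  | hmul a b ha hb =>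
    rw [map_mul, map_mul, map_mul, Module.End.mul_apply, hb, ha, Module.End.mul_apply]
  | hadd a b ha hb =>
    rw [map_add, map_add, map_add, LinearMap.add_apply, hb, ha, LinearMap.add_apply,
      TensorProduct.tmul_add]

variable {d} in
/-- The evaluation of Laurent polynomials at `y_j = c_j`. -/
def evalAt (c : Fin d → 𝕜ˣ) : Laurent 𝕜 d →ₐ[𝕜] 𝕜 :=
  AddMonoidAlgebra.lift 𝕜 𝕜 (Fin d → ℤ)
    { toFun := fun v => ((∏ j, c j ^ (Multiplicative.toAdd v j) : 𝕜ˣ) : 𝕜)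
      map_one' := by simp
      map_mul' := fun v w => by simp [zpow_add, Finset.prod_mul_distrib] }

variable {d} in
theorem evalAt_Y (c : Fin d → 𝕜ˣ) (j : Fin d) : evalAt c (Y 𝕜 j) = c j := by
  rw [evalAt, Y, AddMonoidAlgebra.lift_single]
  simp only [MonoidHom.coe_mk, OneHom.coe_mk, one_smul, toAdd_ofAdd, Units.val_inj]
  rw [Finset.prod_eq_single j]
  · simp
  · intro k _ hk
    simp [hk]
  · simp

variable {d}

/-- The evaluation at `y_j = c_j` with coefficients in `V^{⊗ d}`. -/
def evalVT (c : Fin d → 𝕜ˣ) : Laurent 𝕜 d ⊗[𝕜] VT 𝕜 m n d →ₗ[𝕜] VT 𝕜 m n d :=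
  (TensorProduct.lid 𝕜 _).toLinearMap ∘ₗ LinearMap.rTensor _ (evalAt c).toLinearMap

theorem evalVT_tmul (c : Fin d → 𝕜ˣ) (p : Laurent 𝕜 d) (v : VT 𝕜 m n d) :
    evalVT m n c (p ⊗ₜ v) = evalAt c p • v := rfl

theorem evalVT_y (c : Fin d → 𝕜ˣ) (j : Fin d) (w : Laurent 𝕜 d ⊗[𝕜] VT 𝕜 m n d) :
    evalVT m n c (affRep m n d q (AffHecke.y q j) w) = (c j : 𝕜) • evalVT m n c w := by
  induction w with
  | zero => simp
  | tmul p v => rw [affRep_y, evalVT_tmul, evalVT_tmul, map_mul, evalAt_Y, mul_smul]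
  | add x y hx hy => rw [map_add, map_add, map_add, hx, hy, smul_add]

theorem evalVT_Hc (c : Fin d → 𝕜ˣ) {x : AffHecke d q} (hx : x ∈ Hc q c)
    (w : Laurent 𝕜 d ⊗[𝕜] VT 𝕜 m n d) : evalVT m n c (affRep m n d q x w) = 0 := by
  induction hx using Submodule.span_induction generalizing w with
  | mem x hx =>
    obtain ⟨j, rfl⟩ := hx
    rw [map_sub, AlgHom.commutes, LinearMap.sub_apply, map_sub, evalVT_y,
      Module.algebraMap_end_apply, map_smul, sub_self]
  | zero => rw [map_zero, LinearMap.zero_apply, map_zero]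
  | add x y _ _ hx hy => rw [map_add, LinearMap.add_apply, map_add, hx, hy, add_zero]
  | smul a x _ hx =>
    rw [MulOpposite.smul_eq_mul_unop, map_mul, Module.End.mul_apply, hx]

/-- The linear map `x ↦ (v ↦ ev_c (x (1 ⊗ v)))` on `M_c`. -/
def fromMc (c : Fin d → 𝕜ˣ) : Mc q c →ₗ[𝕜] Module.End 𝕜 (VT 𝕜 m n d) :=
  ((Hc q c).restrictScalars 𝕜).liftQ
    { toFun := fun x => evalVT m n c ∘ₗ affRep m n d q x ∘ₗ TensorProduct.mk 𝕜 _ _ 1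
      map_add' := fun x y => by
        refine LinearMap.ext fun v => ?_
        simp only [map_add, LinearMap.comp_apply, LinearMap.add_apply]
      map_smul' := fun r x => by
        refine LinearMap.ext fun v => ?_
        simp only [map_smul, LinearMap.comp_apply, LinearMap.smul_apply, RingHom.id_apply] }
    (fun x hx => LinearMap.ext fun v => evalVT_Hc m n q c hx _) ∘ₗ
  (Submodule.Quotient.restrictScalarsEquiv 𝕜 (Hc q c)).symm.toLinearMap

theorem fromMc_mk (c : Fin d → 𝕜ˣ) (x : AffHecke d q) (v : VT 𝕜 m n d) :
    fromMc m n q c ((Hc q c).mkQ x) v = evalVT m n c (affRep m n d q x (1 ⊗ₜ v)) := rfl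

/-- The map `J(M_c) → V^{⊗ d}` inverse to the canonical map. -/
def fromJ (c : Fin d → 𝕜ˣ) : J m n d q (Mc q c) →ₗ[𝕜] VT 𝕜 m n d :=
  (balanced m n d q (Mc q c)).liftQ (TensorProduct.lift (fromMc m n q c)) (by
    refine Submodule.span_le.2 ?_
    rintro _ ⟨h, x, v, rfl⟩
    obtain ⟨x, rfl⟩ := (Hc q c).mkQ_surjective x
    rw [SetLike.mem_coe, LinearMap.mem_ker, map_sub, TensorProduct.lift.tmul,
      TensorProduct.lift.tmul, ← map_smul, fromMc_mk, fromMc_mk, op_smul_eq_mul,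
      map_mul, Module.End.mul_apply, affRep_ofHecke, sub_self])

theorem fromJ_tmul (c : Fin d → 𝕜ˣ) (x : AffHecke d q) (v : VT 𝕜 m n d) :
    fromJ m n q c (J.tmul m n d q ((Hc q c).mkQ x) v) =
      evalVT m n c (affRep m n d q x (1 ⊗ₜ v)) := rfl

theorem fromJ_tmul_one (c : Fin d → 𝕜ˣ) (v : VT 𝕜 m n d) :
    fromJ m n q c (J.tmul m n d q ((Hc q c).mkQ 1) v) = v := by
  rw [fromJ_tmul, map_one, Module.End.one_apply, evalVT_tmul, map_one, one_smul]

end Inverse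

/-! ### Straightening in the affine Hecke algebra -/

section Straightening
variable {𝕜 : Type*} [Field 𝕜]

section Ring
variable {A : Type*} [Ring A] [Algebra 𝕜 A] {h : 𝕜} {T u w u' w' : A}

/-- If `T² = h T + 1` then `T - h` is inverse to `T`, so `T u T = w` can be read as an exchange
relation for `T` and `u` or for `T` and `w`. -/
theorem T_mul_lo (hT : T * T = h • T + 1) (e : T * u * T = w) : T * u = w * T - h • w := by
  have e1 : T * u * (T * T) = w * T := by rw [← e, mul_assoc (T * u)]
  rw [hT, mul_add, mul_one, mul_smul_comm, e] at e1
  rw [← e1, add_sub_cancel_left]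

theorem T_mul_hi (hT : T * T = h • T + 1) (e : T * u * T = w) : T * w = u * T + h • w := by
  have e1 : T * T * (u * T) = T * w := by rw [← e]; simp only [mul_assoc]
  rw [hT, add_mul, one_mul, smul_mul_assoc, ← mul_assoc, e] at e1
  rw [← e1, add_comm]

theorem T_mul_inv_lo (hT : T * T = h • T + 1) (e : T * u * T = w) (u1 : u * u' = 1)
    (w1 : w' * w = 1) : T * u' = w' * T + h • u' := by
  have e1 := congrArg (fun x => w' * x * u') (T_mul_lo hT e)
  simp only [mul_sub, sub_mul, mul_smul_comm, smul_mul_assoc] at e1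
  rw [w1, one_mul, ← mul_assoc w' w T, w1, one_mul, mul_assoc w', mul_assoc T, u1, mul_one] at e1
  rw [e1, sub_add_cancel]

theorem T_mul_inv_hi (hT : T * T = h • T + 1) (e : T * u * T = w) (u1 : u' * u = 1)
    (w1 : w * w' = 1) : T * w' = u' * T - h • u' := by
  have e1 := congrArg (fun x => u' * x * w') (T_mul_hi hT e)
  simp only [mul_add, add_mul, mul_smul_comm, smul_mul_assoc] at e1
  rw [mul_assoc u' w, w1, mul_one, ← mul_assoc u' u, u1, one_mul, mul_assoc u', mul_assoc T, w1,
    mul_one] at e1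
  rw [e1, add_sub_cancel_right]

theorem commute_of_inv (h1 : u * u' = 1) (h2 : u' * u = 1) (h : Commute T u) : Commute T u' :=
  h.units_inv_right (u := ⟨u, u', h1, h2⟩)

end Ring

namespace AffHecke
variable {d : ℕ} (q : 𝕜ˣ)

theorem T_sq (i : Fin (d - 1)) : T q i * T q i = (qz q 1 - qz q (-1)) • T q i + 1 :=
  (hecke_relations q).quad i

theorem y_mul_yinv (j : Fin d) : y q j * yinv q j = 1 := by
  simpa only [map_mul, map_one, y, yinv] using RingQuot.mkAlgHom_rel 𝕜 (AffHeckeRel.y_yinv (q := q) j)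

theorem yinv_mul_y (j : Fin d) : yinv q j * y q j = 1 := by
  simpa only [map_mul, map_one, y, yinv] using RingQuot.mkAlgHom_rel 𝕜 (AffHeckeRel.yinv_y (q := q) j)

theorem T_y_T (i : Fin (d - 1)) : T q i * y q (lo i) * T q i = y q (hi i) := by
  simpa only [map_mul, T, y] using RingQuot.mkAlgHom_rel 𝕜 (AffHeckeRel.T_y_T (q := q) i)

theorem T_comm_y (i : Fin (d - 1)) {j : Fin d} (h1 : j ≠ lo i) (h2 : j ≠ hi i) :
    Commute (T q i) (y q j) := by
  have := RingQuot.mkAlgHom_rel 𝕜 (AffHeckeRel.y_T (q := q) j i h1 h2)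
  simp only [map_mul] at this
  exact this.symm

theorem T_comm_yinv (i : Fin (d - 1)) {j : Fin d} (h1 : j ≠ lo i) (h2 : j ≠ hi i) :
    Commute (T q i) (yinv q j) :=
  commute_of_inv (y_mul_yinv q j) (yinv_mul_y q j) (T_comm_y q i h1 h2)

/-- The subalgebra generated by the `y_j` and their inverses. -/
def ySub (d : ℕ) (q : 𝕜ˣ) : Subalgebra 𝕜 (AffHecke d q) :=
  Algebra.adjoin 𝕜 (Set.range (y q) ∪ Set.range (yinv q))

theorem y_mem (j : Fin d) : y q j ∈ ySub d q := Algebra.subset_adjoin (.inl ⟨j, rfl⟩)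

theorem yinv_mem (j : Fin d) : yinv q j ∈ ySub d q := Algebra.subset_adjoin (.inr ⟨j, rfl⟩)

/-- Straightening: `T̂_i` can be moved to the right across the `y_j` and their inverses. -/
theorem T_mul_ySub (i : Fin (d - 1)) {p : AffHecke d q} (hp : p ∈ ySub d q) :
    ∃ p₁ ∈ ySub d q, ∃ p₂ ∈ ySub d q, T q i * p = p₁ * T q i + p₂ := by
  induction hp using Algebra.adjoin_induction with
  | mem x hx =>
    rcases hx with ⟨j, rfl⟩ | ⟨j, rfl⟩
    · by_cases h1 : j = lo i
      · subst h1
        exact ⟨_, y_mem q (hi i), _, neg_mem ((ySub d q).smul_mem (y_mem q (hi i)) _),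
          (T_mul_lo (T_sq q i) (T_y_T q i)).trans (sub_eq_add_neg _ _)⟩
      by_cases h2 : j = hi i
      · subst h2
        exact ⟨_, y_mem q (lo i), _, (ySub d q).smul_mem (y_mem q (hi i)) _,
          T_mul_hi (T_sq q i) (T_y_T q i)⟩
      · exact ⟨_, y_mem q j, 0, zero_mem _, by rw [add_zero]; exact T_comm_y q i h1 h2⟩
    · by_cases h1 : j = lo i
      · subst h1
        exact ⟨_, yinv_mem q (hi i), _, (ySub d q).smul_mem (yinv_mem q (lo i)) _,
          T_mul_inv_lo (T_sq q i) (T_y_T q i) (y_mul_yinv q _) (yinv_mul_y q _)⟩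
      by_cases h2 : j = hi i
      · subst h2
        exact ⟨_, yinv_mem q (lo i), _, neg_mem ((ySub d q).smul_mem (yinv_mem q (lo i)) _),
          (T_mul_inv_hi (T_sq q i) (T_y_T q i) (yinv_mul_y q _) (y_mul_yinv q _)).trans
            (sub_eq_add_neg _ _)⟩
      · exact ⟨_, yinv_mem q j, 0, zero_mem _, by rw [add_zero]; exact T_comm_yinv q i h1 h2⟩
  | algebraMap r =>
    exact ⟨_, (ySub d q).algebraMap_mem r, 0, zero_mem _, by
      rw [add_zero]; exact Algebra.commutes' r _ |>.symm⟩
  | add x x' _ _ hx hx' =>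
    obtain ⟨a, ha, b, hb, e⟩ := hx
    obtain ⟨a', ha', b', hb', e'⟩ := hx'
    exact ⟨_, add_mem ha ha', _, add_mem hb hb', by rw [mul_add, e, e', add_mul]; abel⟩
  | mul x x' _ hm' hx hx' =>
    obtain ⟨a, ha, b, hb, e⟩ := hx
    obtain ⟨a', ha', b', hb', e'⟩ := hx'
    exact ⟨_, mul_mem ha ha', _, add_mem (mul_mem ha hb') (mul_mem hb hm'), by
      rw [← mul_assoc, e, add_mul, mul_assoc, e', mul_add, ← mul_assoc, add_assoc]⟩

/-- Every element of the affine Hecke algebra is a sum of products `p h` of a Laurent polynomial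
`p` in the `y_j` and an element `h` of the finite Hecke algebra. -/
theorem mem_ySub_mul (a : AffHecke d q) : a ∈ Subalgebra.toSubmodule (ySub d q) *
    Subalgebra.toSubmodule (ofHecke d q).range := by
  set Q := Subalgebra.toSubmodule (ySub d q) * Subalgebra.toSubmodule (ofHecke d q).range with hQ
  have hmem : ∀ p ∈ ySub d q, ∀ h ∈ (ofHecke d q).range, p * h ∈ Q := fun p hp h hh =>
    Submodule.mul_mem_mul hp hh
  have key : ∀ x ∈ Q, a * x ∈ Q := by
    refine ringQuot_induction (P := fun a => ∀ x ∈ Q, a * x ∈ Q) (fun c x hx => ?_)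
      (fun g => ?_) (fun a b ha hb x hx => ?_) (fun a b ha hb x hx => ?_) a
    · rw [← Algebra.smul_def]
      exact Q.smul_mem c hx
    · have hy : ∀ b ∈ ySub d q, ∀ x ∈ Q, b * x ∈ Q := fun b hb x hx => by
        refine Submodule.mul_induction_on hx (fun p hp h hh => ?_) (fun x y hx hy => ?_)
        · rw [← mul_assoc]
          exact hmem _ (mul_mem hb hp) _ hh
        · rw [mul_add]
          exact add_mem hx hy
      cases g with
      | T i =>
        intro x hx
        refine Submodule.mul_induction_on hx (fun p hp h hh => ?_) (fun x y hx hy => ?_)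
        · obtain ⟨p₁, h₁, p₂, h₂, e⟩ := T_mul_ySub q i hp
          change T q i * (p * h) ∈ Q
          rw [← mul_assoc, e, add_mul, mul_assoc]
          exact add_mem (hmem _ h₁ _ (mul_mem ⟨Hecke.T q i, ofHecke_T d q i⟩ hh)) (hmem _ h₂ _ hh)
        · rw [mul_add]
          exact add_mem hx hy
      | y j => exact hy _ (y_mem q j)
      | yinv j => exact hy _ (yinv_mem q j)
    · rw [mul_assoc]
      exact ha _ (hb _ hx)
    · rw [add_mul]
      exact add_mem (ha _ hx) (hb _ hx)
  have := key 1 (by rw [← one_mul 1]; exact hmem _ (one_mem _) _ (one_mem _))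
  rwa [mul_one] at this

end AffHecke

section Quotient
open AffHecke
variable {d : ℕ} (q : 𝕜ˣ) (c : Fin d → 𝕜ˣ)

/-- The projection onto `M_c`, as a linear map over the ground field. -/
def mkMc : AffHecke d q →ₗ[𝕜] Mc q c := (Hc q c).mkQ.restrictScalars 𝕜

theorem mkMc_surjective : Function.Surjective (mkMc q c) := (Hc q c).mkQ_surjective

theorem mkMc_y_mul (j : Fin d) (x : AffHecke d q) :
    mkMc q c (y q j * x) = (c j : 𝕜) • mkMc q c x := by
  rw [← sub_eq_zero, ← map_smul, ← map_sub, Algebra.smul_def, ← sub_mul]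
  refine (Submodule.Quotient.mk_eq_zero _).2 ?_
  exact (Hc q c).smul_mem (MulOpposite.op x) (Submodule.subset_span ⟨j, rfl⟩)

theorem mkMc_yinv_mul (j : Fin d) (x : AffHecke d q) :
    mkMc q c (yinv q j * x) = (((c j)⁻¹ : 𝕜ˣ) : 𝕜) • mkMc q c x := by
  have h := mkMc_y_mul q c j (yinv q j * x)
  rw [← mul_assoc, y_mul_yinv, one_mul] at h
  rw [h, smul_smul, Units.inv_mul, one_smul]

/-- `H_d(q²) → M_c` is surjective, as the `y_j` on the left act by scalars. -/
theorem exists_ofHecke (x : Mc q c) : ∃ h : Hecke d q, x = mkMc q c (ofHecke d q h) := by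
  obtain ⟨a, rfl⟩ := mkMc_surjective q c x
  refine Submodule.mul_induction_on (mem_ySub_mul q a) (fun p hp h hh => ?_) ?_
  · obtain ⟨h, rfl⟩ := hh
    have : ∃ r : 𝕜, ∀ x, mkMc q c (p * x) = r • mkMc q c x := by
      induction (hp : p ∈ Algebra.adjoin 𝕜 _) using Algebra.adjoin_induction with
      | mem x hx =>
        rcases hx with ⟨j, rfl⟩ | ⟨j, rfl⟩
        · exact ⟨_, mkMc_y_mul q c j⟩
        · exact ⟨_, mkMc_yinv_mul q c j⟩
      | algebraMap r => exact ⟨r, fun x => by rw [← Algebra.smul_def, map_smul]⟩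
      | add x x' _ _ hx hx' =>
        obtain ⟨⟨r, hr⟩, r', hr'⟩ := hx, hx'
        exact ⟨r + r', fun x => by rw [add_mul, map_add, hr, hr', add_smul]⟩
      | mul x x' _ _ hx hx' =>
        obtain ⟨⟨r, hr⟩, r', hr'⟩ := hx, hx'
        exact ⟨r * r', fun x => by rw [mul_assoc, hr, hr', smul_smul]⟩
    obtain ⟨r, hr⟩ := this
    exact ⟨r • h, by rw [map_smul, map_smul]; exact hr _⟩
  · rintro x y ⟨h, hx⟩ ⟨h', hy⟩
    exact ⟨h + h', by rw [map_add, map_add, map_add, hx, hy]⟩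

end Quotient
end Straightening

/-! ### The canonical map and the action on `𝓕(M_c)` -/

section Canonical
variable {𝕜 : Type*} [Field 𝕜] (m n : ℕ) {d : ℕ} (q : 𝕜ˣ) (c : Fin d → 𝕜ˣ)
open AffHecke

/-- The bilinear map `(a, v) ↦ a ⊗ v ∈ J(M_c)`. -/
def mkJ : AffHecke d q →ₗ[𝕜] VT 𝕜 m n d →ₗ[𝕜] J m n d q (Mc q c) :=
  (TensorProduct.mk 𝕜 (Mc q c) (VT 𝕜 m n d)).compr₂ (balanced m n d q (Mc q c)).mkQ ∘ₗ mkMc q c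

theorem mkJ_apply (a : AffHecke d q) (v : VT 𝕜 m n d) :
    mkJ m n q c a v = J.tmul m n d q (mkMc q c a) v := rfl

theorem mkJ_mul_ofHecke (a : AffHecke d q) (h : Hecke d q) (v : VT 𝕜 m n d) :
    mkJ m n q c (a * ofHecke d q h) v = mkJ m n q c a (heckeRep m n q d h v) := by
  rw [← sub_eq_zero]
  refine (map_sub (balanced m n d q (Mc q c)).mkQ _ _).symm.trans
    ((Submodule.Quotient.mk_eq_zero _).2 (Submodule.subset_span ⟨h, mkMc q c a, v, rfl⟩))

theorem mkJ_mul_T (a : AffHecke d q) (i : Fin (d - 1)) (v : VT 𝕜 m n d) :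
    mkJ m n q c (a * T q i) v = mkJ m n q c a (Rcheck m n q i v) := by
  rw [← ofHecke_T, mkJ_mul_ofHecke, heckeRep_T]

theorem mkJ_yinv (j : Fin d) : mkJ m n q c (yinv q j) = (((c j)⁻¹ : 𝕜ˣ) : 𝕜) • mkJ m n q c 1 := by
  refine LinearMap.ext fun v => ?_
  have h := mkMc_yinv_mul q c j 1
  rw [mul_one] at h
  simp only [mkJ, LinearMap.comp_apply, h, map_smul]

theorem mkJ_y (j : Fin d) : mkJ m n q c (y q j) = (c j : 𝕜) • mkJ m n q c 1 := by
  refine LinearMap.ext fun v => ?_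
  have h := mkMc_y_mul q c j 1
  rw [mul_one] at h
  simp only [mkJ, LinearMap.comp_apply, h, map_smul]

/-- Every pure tensor of `J(M_c)` is in the image of the canonical map. -/
theorem tmul_eq_mkJ_one (h : Hecke d q) (v : VT 𝕜 m n d) :
    J.tmul m n d q (mkMc q c (ofHecke d q h)) v = mkJ m n q c 1 (heckeRep m n q d h v) := by
  rw [← mkJ_mul_ofHecke, one_mul, mkJ_apply]

theorem mkJ_one_bijective : Function.Bijective (mkJ m n q c 1) := by
  refine ⟨Function.LeftInverse.injective (g := fromJ m n q c) (fromJ_tmul_one m n q c), ?_⟩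
  rw [← LinearMap.range_eq_top, eq_top_iff]
  rintro x -
  obtain ⟨z, rfl⟩ := (balanced m n d q (Mc q c)).mkQ_surjective x
  induction z with
  | zero => rw [map_zero]; exact zero_mem _
  | tmul x v =>
    obtain ⟨h, rfl⟩ := exists_ofHecke q c x
    exact ⟨_, (tmul_eq_mkJ_one m n q c h v).symm⟩
  | add x y hx hy => rw [map_add]; exact add_mem hx hy

/-- The canonical isomorphism `v ↦ 1 ⊗ v`. -/
def canonicalEquiv : VT 𝕜 m n d ≃ₗ[𝕜] J m n d q (Mc q c) :=
  LinearEquiv.ofBijective (mkJ m n q c 1) (mkJ_one_bijective m n q c)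

theorem canonicalEquiv_apply (v : VT 𝕜 m n d) :
    canonicalEquiv m n q c v = mkJ m n q c 1 v := rfl

theorem canonicalEquiv_symm_tmul (h : Hecke d q) (v : VT 𝕜 m n d) :
    (canonicalEquiv m n q c).symm (J.tmul m n d q (mkMc q c (ofHecke d q h)) v) =
      heckeRep m n q d h v := by
  rw [LinearEquiv.symm_apply_eq, tmul_eq_mkJ_one, canonicalEquiv_apply]

theorem sum_eq_of_pair {ι G : Type*} [Fintype ι] [DecidableEq ι] [AddCommMonoid G] {f g : ι → G}
    {a b : ι} (hab : a ≠ b) (h : f a + f b = g a + g b) (h' : ∀ k, k ≠ a → k ≠ b → f k = g k) :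
    ∑ k, f k = ∑ k, g k := by
  have hb : b ∈ Finset.univ.erase a := by simp [hab.symm]
  rw [← Finset.add_sum_erase _ f (Finset.mem_univ a), ← Finset.add_sum_erase _ f hb,
    ← Finset.add_sum_erase _ g (Finset.mem_univ a), ← Finset.add_sum_erase _ g hb, ← add_assoc,
    ← add_assoc, h]
  congr 1
  refine Finset.sum_congr rfl fun k hk => ?_
  simp only [Finset.mem_erase, Finset.mem_univ, and_true] at hk
  exact h' k hk.2 hk.1

/-- Let `z_k` be elements of the affine Hecke algebra and `X_k` operators on `V^{⊗ d}` which are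
exchanged by `T̂_i` and `Ř_i` for the two indices `α, β` and commute with them otherwise.  Then the
operator `∑ z_k ⊗ X_k` is balanced over `T̂_i`: the correction terms cancel by the quadratic
relation. -/
theorem sum_mkJ_T {i : Fin (d - 1)} {z : Fin d → AffHecke d q}
    {X : Fin d → Module.End 𝕜 (VT 𝕜 m n d)} {α β : Fin d} (hαβ : α ≠ β)
    (h1 : T q i * z α = z β * T q i + (qz q 1 - qz q (-1)) • z α)
    (h2 : T q i * z β = z α * T q i - (qz q 1 - qz q (-1)) • z α)
    (h3 : ∀ k, k ≠ α → k ≠ β → Commute (T q i) (z k))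
    (h4 : Rcheck m n q i * X α = X β * Rcheck m n q i)
    (h5 : ∀ k, k ≠ α → k ≠ β → Commute (Rcheck m n q i) (X k))
    (a : AffHecke d q) (v : VT 𝕜 m n d) :
    ∑ k, mkJ m n q c (a * T q i * z k) (X k v) =
      ∑ k, mkJ m n q c (a * z k) (X k (Rcheck m n q i v)) := by
  refine sum_eq_of_pair hαβ ?_ fun k hα hβ => ?_
  · have e4 : ∀ v, Rcheck m n q i (X α v) = X β (Rcheck m n q i v) := LinearMap.congr_fun h4
    have e5 : X α (Rcheck m n q i v) = Rcheck m n q i (X β v) + (qz q 1 - qz q (-1)) • X α v -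
        (qz q 1 - qz q (-1)) • X β v := by
      have hq : ∀ v, Rcheck m n q i (Rcheck m n q i v) =
          (qz q 1 - qz q (-1)) • Rcheck m n q i v + v :=
        LinearMap.congr_fun ((Rcheck_relations m n q).quad i)
      -- multiply `Ř X_α Ř = X_β Ř² = (q - q⁻¹) Ř X_α + X_β` by `Ř⁻¹ = Ř - (q - q⁻¹)`
      have e6 : Rcheck m n q i (X α (Rcheck m n q i v)) =
          (qz q 1 - qz q (-1)) • Rcheck m n q i (X α v) + X β v := by
        rw [e4, hq, map_add, map_smul, e4]
      have e7 := hq (X α (Rcheck m n q i v))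
      rw [e6, map_add, map_smul, hq] at e7
      rw [eq_sub_of_add_eq' e7.symm]
      module
    rw [mul_assoc, h1, mul_assoc, h2, mul_add, mul_sub, ← mul_assoc, ← mul_assoc, map_add, map_sub,
      mul_smul_comm, map_smul, LinearMap.add_apply, LinearMap.sub_apply, LinearMap.smul_apply,
      LinearMap.smul_apply, mkJ_mul_T, mkJ_mul_T, e4, e5, map_sub, map_add, map_smul, map_smul]
    abel
  · rw [mul_assoc, h3 k hα hβ, ← mul_assoc, mkJ_mul_T]
    exact congrArg _ (LinearMap.congr_fun (h5 k hα hβ) v)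

/-- An operator `∑ z_k ⊗ X_k` which is balanced over all `T̂_i` is balanced over `H_d(q²)`. -/
theorem sum_mkJ_ofHecke {z : Fin d → AffHecke d q} {X : Fin d → Module.End 𝕜 (VT 𝕜 m n d)}
    (hT : ∀ i a v, ∑ k, mkJ m n q c (a * T q i * z k) (X k v) =
      ∑ k, mkJ m n q c (a * z k) (X k (Rcheck m n q i v)))
    (h : Hecke d q) (a : AffHecke d q) (v : VT 𝕜 m n d) :
    ∑ k, mkJ m n q c (a * ofHecke d q h * z k) (X k v) =
      ∑ k, mkJ m n q c (a * z k) (X k (heckeRep m n q d h v)) := by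
  induction h using Hecke.induction generalizing a v with
  | hc r =>
    refine Finset.sum_congr rfl fun k _ => ?_
    rw [AlgHom.commutes, AlgHom.commutes, Module.algebraMap_end_apply, ← Algebra.commutes,
      ← Algebra.smul_def, smul_mul_assoc, map_smul, map_smul, map_smul, LinearMap.smul_apply]
  | hT i => rw [ofHecke_T, heckeRep_T, hT]
  | hmul h h' ih ih' =>
    rw [map_mul, map_mul, ← mul_assoc, ih', ih, Module.End.mul_apply]
  | hadd h h' ih ih' =>
    simp only [map_add, mul_add, add_mul, LinearMap.add_apply, Finset.sum_add_distrib, ih, ih']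

variable {m n q}

/-- The formula for `E_0` is compatible with `x h ⊗ v = x ⊗ h v`. -/
theorem sum_yinv_YE (hm : 1 ≤ m) (hn : 1 ≤ n) (h : Hecke d q) (v : VT 𝕜 m n d) :
    ∑ k, mkJ m n q c (ofHecke d q h * yinv q k) (YE m n d q k v) =
      ∑ k, mkJ m n q c (yinv q k) (YE m n d q k (heckeRep m n q d h v)) := by
  have := sum_mkJ_ofHecke m n q c (z := yinv q) (X := YE m n d q) (fun i a v => ?_) h 1 v
  · simpa only [one_mul] using this
  · exact sum_mkJ_T m n q c (lo_ne_hi i)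
      (T_mul_inv_lo (T_sq q i) (T_y_T q i) (y_mul_yinv q _) (yinv_mul_y q _))
      (T_mul_inv_hi (T_sq q i) (T_y_T q i) (yinv_mul_y q _) (y_mul_yinv q _))
      (fun k => T_comm_yinv q i) (Rcheck_YE_lo i hm hn) (fun k => Rcheck_comm_YE i hm hn) a v

/-- The formula for `F_0` is compatible with `x h ⊗ v = x ⊗ h v`. -/
theorem sum_y_YF (hm : 1 ≤ m) (hn : 1 ≤ n) (h : Hecke d q) (v : VT 𝕜 m n d) :
    ∑ k, mkJ m n q c (ofHecke d q h * y q k) (YF m n d q k v) =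
      ∑ k, mkJ m n q c (y q k) (YF m n d q k (heckeRep m n q d h v)) := by
  have := sum_mkJ_ofHecke m n q c (z := y q) (X := YF m n d q) (fun i a v => ?_) h 1 v
  · simpa only [one_mul] using this
  · exact sum_mkJ_T m n q c (lo_ne_hi i).symm (T_mul_hi (T_sq q i) (T_y_T q i))
      (T_mul_lo (T_sq q i) (T_y_T q i)) (fun k h1 h2 => T_comm_y q i h2 h1) (Rcheck_YF_hi i hm hn)
      (fun k h1 h2 => Rcheck_comm_YF i hm hn h2 h1) a v

theorem heckeRep_comm {X : Module.End 𝕜 (VT 𝕜 m n d)} (hX : ∀ i, Commute (Rcheck m n q i) X)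
    (h : Hecke d q) (v : VT 𝕜 m n d) : heckeRep m n q d h (X v) = X (heckeRep m n q d h v) := by
  induction h using Hecke.induction generalizing v with
  | hc r =>
    rw [AlgHom.commutes, Module.algebraMap_end_apply, Module.algebraMap_end_apply, map_smul]
  | hT i => rw [heckeRep_T]; exact LinearMap.congr_fun (hX i) v
  | hmul h h' ih ih' => rw [map_mul, Module.End.mul_apply, Module.End.mul_apply, ih', ih]
  | hadd h h' ih ih' => rw [map_add, LinearMap.add_apply, LinearMap.add_apply, ih, ih', map_add]

/-- The action of `U` on `J(M_c)` transported along the canonical isomorphism. -/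
def schurWeyl (hm : 2 ≤ m) (hn : 2 ≤ n) : U m n q →ₐ[𝕜] Module.End 𝕜 (J m n d q (Mc q c)) :=
  (LinearEquiv.conjAlgEquiv 𝕜 (canonicalEquiv m n q c)).toAlgHom.comp
    (tensorRepU hm hn d fun j => (c j)⁻¹)

theorem schurWeyl_apply (hm : 2 ≤ m) (hn : 2 ≤ n) (u : U m n q) (h : Hecke d q)
    (v : VT 𝕜 m n d) :
    schurWeyl c hm hn u (J.tmul m n d q (mkMc q c (ofHecke d q h)) v) =
      mkJ m n q c 1 (tensorRepU hm hn d (fun j => (c j)⁻¹) u (heckeRep m n q d h v)) := by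
  rw [← canonicalEquiv_symm_tmul, ← canonicalEquiv_apply]
  rfl

theorem schurWeyl_proj (hm : 2 ≤ m) (hn : 2 ≤ n) (u : Tilde m n q) (h : Hecke d q)
    (v : VT 𝕜 m n d) :
    schurWeyl c hm hn (U.proj m n q u) (J.tmul m n d q (mkMc q c (ofHecke d q h)) v) =
      mkJ m n q c 1 (tensorRep m n q d (fun j => (c j)⁻¹) u (heckeRep m n q d h v)) := by
  rw [schurWeyl_apply, ← tensorRepU_comp_proj hm hn]
  rfl

theorem schurWeyl_of_comm (hm : 2 ≤ m) (hn : 2 ≤ n) {u : Tilde m n q}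
    {X : Module.End 𝕜 (VT 𝕜 m n d)} (hu : tensorRep m n q d (fun j => (c j)⁻¹) u = X)
    (hX : ∀ i, Commute (Rcheck m n q i) X) (x : Mc q c) (v : VT 𝕜 m n d) :
    schurWeyl c hm hn (U.proj m n q u) (J.tmul m n d q x v) = J.tmul m n d q x (X v) := by
  obtain ⟨h, rfl⟩ := exists_ofHecke q c x
  rw [schurWeyl_proj, hu, tmul_eq_mkJ_one, heckeRep_comm hX]

theorem isSchurWeyl (hm : 2 ≤ m) (hn : 2 ≤ n) :
    IsSchurWeyl m n d q (Mc q c) (schurWeyl c hm hn) where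
  sig := schurWeyl_of_comm c hm hn (by rw [tensorRep_sig_eq, tensorRep_sig_eq])
    (Rcheck_comm_sig _)
  K γ := schurWeyl_of_comm c hm hn (by rw [tensorRep_K_eq, tensorRep_K_eq]) (Rcheck_comm_K _ γ)
  E i hi := schurWeyl_of_comm c hm hn (by rw [tensorRep_E_eq _ hi, tensorRep_E_eq _ hi])
    (Rcheck_comm_E (by omega) _ hi)
  F i hi := schurWeyl_of_comm c hm hn (by rw [tensorRep_F_eq _ hi, tensorRep_F_eq _ hi])
    (Rcheck_comm_F (by omega) _ hi)
  E_zero i hi x v := by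
    obtain ⟨h, rfl⟩ := exists_ofHecke q c x
    rw [schurWeyl_proj, tensorRep_E_affine (by omega) (by omega) _ hi, LinearMap.sum_apply, map_sum]
    refine Eq.trans ?_ (sum_yinv_YE c (by omega) (by omega) h v).symm
    refine Finset.sum_congr rfl fun k _ => ?_
    rw [mkJ_yinv, LinearMap.smul_apply, LinearMap.smul_apply, map_smul]
  F_zero i hi x v := by
    obtain ⟨h, rfl⟩ := exists_ofHecke q c x
    rw [schurWeyl_proj, tensorRep_F_affine (by omega) (by omega) _ hi, LinearMap.sum_apply, map_sum]
    refine Eq.trans ?_ (sum_y_YF c (by omega) (by omega) h v).symm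
    refine Finset.sum_congr rfl fun k _ => ?_
    rw [mkJ_y, LinearMap.smul_apply, LinearMap.smul_apply, map_smul, inv_inv]

theorem J.hom_ext {M : Type*} [AddCommGroup M] [Module 𝕜 M] [Module (AffHecke d q)ᵐᵒᵖ M]
    {f g : Module.End 𝕜 (J m n d q M)}
    (h : ∀ x v, f (J.tmul m n d q x v) = g (J.tmul m n d q x v)) : f = g :=
  Submodule.linearMap_qext _ (TensorProduct.ext' h)

/-- The formulas for the generators determine the action on `𝓕(M)`. -/
theorem IsSchurWeyl.unique {M : Type*} [AddCommGroup M] [Module 𝕜 M]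
    [Module (AffHecke d q)ᵐᵒᵖ M] {Φ Φ' : U m n q →ₐ[𝕜] Module.End 𝕜 (J m n d q M)}
    (h : IsSchurWeyl m n d q M Φ) (h' : IsSchurWeyl m n d q M Φ') : Φ = Φ' := by
  refine U.hom_ext (B := Module.End 𝕜 (J m n d q M)) ?_ (fun γ => ?_) (fun i => ?_) (fun i => ?_)
  · exact J.hom_ext fun x v => (h.sig x v).trans (h'.sig x v).symm
  · exact J.hom_ext fun x v => (h.K γ x v).trans (h'.K γ x v).symm
  · by_cases hi : i.val = 0
    · exact J.hom_ext fun x v => (h.E_zero i hi x v).trans (h'.E_zero i hi x v).symm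
    · exact J.hom_ext fun x v => (h.E i hi x v).trans (h'.E i hi x v).symm
  · by_cases hi : i.val = 0
    · exact J.hom_ext fun x v => (h.F_zero i hi x v).trans (h'.F_zero i hi x v).symm
    · exact J.hom_ext fun x v => (h.F i hi x v).trans (h'.F i hi x v).symm

end Canonical

end QSuper
end

theorem proposition17p2 {𝕜 : Type*} [Field 𝕜] [CharZero 𝕜] (q : 𝕜ˣ)
    (hq : ∀ k : ℕ, 0 < k → q ^ k ≠ 1) (m n d : ℕ) (hm : 2 ≤ m) (hn : 2 ≤ n) (hd : 1 ≤ d)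
    (c : Fin d → 𝕜ˣ) :
    ∃ (Φ : QSuper.U m n q →ₐ[𝕜] Module.End 𝕜 (QSuper.J m n d q (QSuper.Mc q c)))
      (Ψ : QSuper.U m n q →ₐ[𝕜] Module.End 𝕜 (QSuper.VT 𝕜 m n d)),
      QSuper.IsSchurWeyl m n d q (QSuper.Mc q c) Φ ∧
      (∀ Φ', QSuper.IsSchurWeyl m n d q (QSuper.Mc q c) Φ' → Φ' = Φ) ∧
      Ψ.comp (QSuper.U.proj m n q) = QSuper.tensorRep m n q d (fun j => (c j)⁻¹) ∧
      ∃ e : QSuper.VT 𝕜 m n d ≃ₗ[𝕜] QSuper.J m n d q (QSuper.Mc q c),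
        (∀ v, e v = QSuper.J.tmul m n d q ((QSuper.Hc q c).mkQ 1) v) ∧
        ∀ (u : QSuper.U m n q) (v : QSuper.VT 𝕜 m n d), e (Ψ u v) = Φ u (e v) := by
  refine ⟨QSuper.schurWeyl c hm hn, QSuper.tensorRepU hm hn d fun j => (c j)⁻¹,
    QSuper.isSchurWeyl c hm hn, fun Φ' h => h.unique (QSuper.isSchurWeyl c hm hn),
    QSuper.tensorRepU_comp_proj hm hn d _, QSuper.canonicalEquiv m n q c, fun v => rfl,
    fun u v => ?_⟩
  have h := QSuper.schurWeyl_apply c hm hn u 1 v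
  rw [map_one (QSuper.AffHecke.ofHecke d q), map_one (QSuper.heckeRep m n q d)] at h
  exact h.symm
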